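/- For $p=(A,B,C,D,E)$ let $X_p\subset\mathbb P^3$ be the quartic surface $$A(x^4+y^4+z^4+w^4)+Bxyzw+C(x^2y^2+z^2w^2)+D(x^2z^2+y^2w^2)+E(x^2w^2+y^2z^2)=0,$$ and put $$\Delta=16A^3+AB^2-4A(C^2+D^2+E^2)+4CDE,\qquad q_{\pm C}=2A\pm C,\quad q_{\pm D}=2A\pm D,\quad q_{\pm E}=2A\pm E,$$ $$\begin{aligned}p_{\pm0}&=4A\pm B+2C+2D+2E, & p_{\pm1}&=4A\pm B+2C-2D-2E,\\ p_{\pm2}&=4A\pm B-2C+2D-2E, & p_{\pm3}&=4A\pm B-2C-2D+2E.\end{aligned}$$ The Segre cubic is $S_3=\{\Delta=0\}\subset\mathbb P^4$. It has ten nodes $[1,0,-2,-2,2]$, $[1,0,-2,2,-2]$, $[1,0,2,-2,-2]$, $[1,0,2,2,2]$, $[0,\mp2,1,0,0]$, $[0,\mp2,0,1,0]$, $[0,\mp2,0,0,1]$. The 15 singular hyperplanes are the zero sets of $A$, $q_{\pm C}$, $q_{\pm D}$, $q_{\pm E}$, $p_{\pm0},\dots,p_{\pm3}$. Let $K$ be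 a number field with algebraic closure $\overline K$, and let $p\in\mathbb P^4(K)$ with $p\notin S_3$. Eklund's conics on $X_p$ are the following curves over $\overline K$. For a node $q$ of $S_3$ let $p'$ be the third point of intersection, other than $q$, of $S_3$ with the line through $p$ and $q$. For a singular point $[r_0:r_1:r_2:r_3]$ of $X_{p'}$ let $T$ be the plane $r_0x+r_1y+r_2z+r_3w=0$. Take all smooth conics contained in $X_p\cap T$, for all such $q$ and $T$. **Theorem.** There is a nonempty Zariski open subset $U$ of $\mathbb P^4$, defined over $\mathbb Q$ (the complement of the zero set of a nonzero homogeneous polynomial with rational coefficients), such that the following holds for every number field $K$. (1) For every $p=[A,B,C,D,E]\in U(K)$ not lying on the Segre cubic or on the 15 singular hyperplanes there are exactly $320$ of Eklund's conics on $X_p$, and the smallest extension $L$ of $K$ in $\overline K$ over which all of them are defined is $$\begin{aligned}L=K\Big(&\sqrt{-\Delta Aq_{+C}q_{-C}},\ \sqrt{-\Delta Aq_{+D}q_{-D}},\ \sqrt{-\Delta Aq_{+E}q_{-E}},\ \sqrt{\Delta q_{+C}p_{+0}p_{-1}},\ \sqrt{\Delta q_{+C}p_{-0}p_{+1}},\\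 &\sqrt{\Delta q_{+D}p_{+0}p_{-2}},\ \sqrt{\Delta q_{+D}p_{-0}p_{+2}},\ \sqrt{\Delta q_{+E}p_{+0}p_{-3}},\ \sqrt{\Delta q_{+E}p_{-0}p_{+3}},\ \sqrt{-\Delta q_{-C}p_{+2}p_{-3}}\Big).\end{aligned}$$ (2) There is a thin subset $\Omega\subset\mathbb P^4(K)$ (in the sense of Serre) such that, for every $p$ as in (1) that does not lie in $\Omega$, the extension $L/K$ is Galois with $\mathrm{Gal}(L/K)\cong C_2^{10}$. -/

import Mathlib

open scoped LinearAlgebra.Projectivization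

noncomputable section

namespace HeisenbergQuartic

/-! ### The family of quartic surfaces, the Segre cubic and the singular hyperplanes

A point `[A : B : C : D : E]` of the parameter space is given by a coordinate vector `p`, with
`A = p 0`, `B = p 1`, `C = p 2`, `D = p 3`, `E = p 4`.  The coordinates `x, y, z, w` of the
projective 3-space are numbered `0, 1, 2, 3`. -/

section Forms

variable {R : Type*} [CommRing R]

/-- The quartic form defining the surface with parameter `p`:
`A(x⁴+y⁴+z⁴+w⁴) + Bxyzw + C(x²y²+z²w²) + D(x²z²+y²w²) + E(x²w²+y²z²)`. -/
def quartic (p : Fin 5 → R) : MvPolynomial (Fin 4) R :=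
  let x : MvPolynomial (Fin 4) R := MvPolynomial.X 0
  let y : MvPolynomial (Fin 4) R := MvPolynomial.X 1
  let z : MvPolynomial (Fin 4) R := MvPolynomial.X 2
  let w : MvPolynomial (Fin 4) R := MvPolynomial.X 3
  MvPolynomial.C (p 0) * (x ^ 4 + y ^ 4 + z ^ 4 + w ^ 4)
    + MvPolynomial.C (p 1) * (x * y * z * w)
    + MvPolynomial.C (p 2) * (x ^ 2 * y ^ 2 + z ^ 2 * w ^ 2)
    + MvPolynomial.C (p 3) * (x ^ 2 * z ^ 2 + y ^ 2 * w ^ 2)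
    + MvPolynomial.C (p 4) * (x ^ 2 * w ^ 2 + y ^ 2 * z ^ 2)

/-- The cubic form `Δ` whose zero set is the Segre cubic. -/
def segreCubic (p : Fin 5 → R) : R :=
  16 * p 0 ^ 3 + p 0 * p 1 ^ 2 - 4 * p 0 * (p 2 ^ 2 + p 3 ^ 2 + p 4 ^ 2) + 4 * p 2 * p 3 * p 4

/-- `q_{+C}` -/
def qPlusC (p : Fin 5 → R) : R := 2 * p 0 + p 2
/-- `q_{-C}` -/
def qMinusC (p : Fin 5 → R) : R := 2 * p 0 - p 2
/-- `q_{+D}` -/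
def qPlusD (p : Fin 5 → R) : R := 2 * p 0 + p 3
/-- `q_{-D}` -/
def qMinusD (p : Fin 5 → R) : R := 2 * p 0 - p 3
/-- `q_{+E}` -/
def qPlusE (p : Fin 5 → R) : R := 2 * p 0 + p 4
/-- `q_{-E}` -/
def qMinusE (p : Fin 5 → R) : R := 2 * p 0 - p 4
/-- `p_{+0}` -/
def pPlus0 (p : Fin 5 → R) : R := 4 * p 0 + p 1 + 2 * p 2 + 2 * p 3 + 2 * p 4
/-- `p_{+1}` -/
def pPlus1 (p : Fin 5 → R) : R := 4 * p 0 + p 1 + 2 * p 2 - 2 * p 3 - 2 * p 4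
/-- `p_{+2}` -/
def pPlus2 (p : Fin 5 → R) : R := 4 * p 0 + p 1 - 2 * p 2 + 2 * p 3 - 2 * p 4
/-- `p_{+3}` -/
def pPlus3 (p : Fin 5 → R) : R := 4 * p 0 + p 1 - 2 * p 2 - 2 * p 3 + 2 * p 4
/-- `p_{-0}` -/
def pMinus0 (p : Fin 5 → R) : R := 4 * p 0 - p 1 + 2 * p 2 + 2 * p 3 + 2 * p 4
/-- `p_{-1}` -/
def pMinus1 (p : Fin 5 → R) : R := 4 * p 0 - p 1 + 2 * p 2 - 2 * p 3 - 2 * p 4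
/-- `p_{-2}` -/
def pMinus2 (p : Fin 5 → R) : R := 4 * p 0 - p 1 - 2 * p 2 + 2 * p 3 - 2 * p 4
/-- `p_{-3}` -/
def pMinus3 (p : Fin 5 → R) : R := 4 * p 0 - p 1 - 2 * p 2 - 2 * p 3 + 2 * p 4

/-- The 15 linear forms whose zero sets are the singular hyperplanes. -/
def singularForm (p : Fin 5 → R) : Fin 15 → R :=
  ![p 0, qPlusC p, qMinusC p, qPlusD p, qMinusD p, qPlusE p, qMinusE p,
    pPlus0 p, pPlus1 p, pPlus2 p, pPlus3 p, pMinus0 p, pMinus1 p, pMinus2 p, pMinus3 p]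

/-- The ten elements whose square roots are adjoined. -/
def radicand (p : Fin 5 → R) : Fin 10 → R :=
  ![-(segreCubic p * p 0 * qPlusC p * qMinusC p),
    -(segreCubic p * p 0 * qPlusD p * qMinusD p),
    -(segreCubic p * p 0 * qPlusE p * qMinusE p),
    segreCubic p * qPlusC p * pPlus0 p * pMinus1 p,
    segreCubic p * qPlusC p * pMinus0 p * pPlus1 p,
    segreCubic p * qPlusD p * pPlus0 p * pMinus2 p,
    segreCubic p * qPlusD p * pMinus0 p * pPlus2 p,
    segreCubic p * qPlusE p * pPlus0 p * pMinus3 p,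
    segreCubic p * qPlusE p * pMinus0 p * pPlus3 p,
    -(segreCubic p * qMinusC p * pPlus2 p * pMinus3 p)]

/-- The ten nodes of the Segre cubic. -/
def node : Fin 10 → Fin 5 → R :=
  ![![1, 0, -2, -2, 2], ![1, 0, -2, 2, -2], ![1, 0, 2, -2, -2], ![1, 0, 2, 2, 2],
    ![0, -2, 1, 0, 0], ![0, 2, 1, 0, 0], ![0, -2, 0, 1, 0], ![0, 2, 0, 1, 0],
    ![0, -2, 0, 0, 1], ![0, 2, 0, 0, 1]]

/-- `s` is a coordinate vector of the third point of intersection of the Segre cubic with the line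
joining `p` (a point off the cubic) to the `i`-th node.  As the node is a double point of the
cubic, this is the only point of the line, besides possibly the node itself, that lies on the
cubic; as `p` is off the cubic, it has a coordinate vector of the form `p + c • node i`. -/
def IsThirdPoint (p : Fin 5 → R) (i : Fin 10) (s : Fin 5 → R) : Prop :=
  (∃ c : R, s = p + c • node i) ∧ segreCubic s = 0

end Forms

/-! ### The 320 conics -/

section Conics

variable {k : Type*} [Field k]

/-- The common zero set in projective 3-space of a set of homogeneous polynomials. -/
def zeroLocus (S : Set (MvPolynomial (Fin 4) k)) : Set (ℙ k (Fin 4 → k)) :=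
  {x | ∀ F ∈ S, MvPolynomial.eval x.rep F = 0}

/-- The quartic surface `X_p`. -/
def surface (p : Fin 5 → k) : Set (ℙ k (Fin 4 → k)) :=
  zeroLocus {quartic p}

/-- The linear form `r₀x + r₁y + r₂z + r₃w`, an equation of the plane dual to the point `r`. -/
def dualForm (r : Fin 4 → k) : MvPolynomial (Fin 4) k :=
  ∑ j, MvPolynomial.C (r j) * MvPolynomial.X j

/-- The point with coordinate vector `r` is a singular point of the surface `X_s`. -/
def IsSingularPoint (s : Fin 5 → k) (r : Fin 4 → k) : Prop :=
  r ≠ 0 ∧ MvPolynomial.eval r (quartic s) = 0 ∧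
    ∀ j, MvPolynomial.eval r (MvPolynomial.pderiv j (quartic s)) = 0

/-- `Z` is a smooth conic in the plane dual to `r`: it is cut out in that plane by a quadratic
form, and the intersection is transversal at each of its points (Jacobian criterion). -/
def IsSmoothConicIn (r : Fin 4 → k) (Z : Set (ℙ k (Fin 4 → k))) : Prop :=
  ∃ Q : MvPolynomial (Fin 4) k, Q.IsHomogeneous 2 ∧ Z = zeroLocus {dualForm r, Q} ∧
    ∀ x ∈ Z, LinearIndependent k
      ![r, fun j => MvPolynomial.eval x.rep (MvPolynomial.pderiv j Q)]

/-- The conics on `X_p` given by Eklund's construction (here `k` is algebraically closed): for each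
node of the Segre cubic take the third point `s` of the cubic on the line through `p` and the node,
for each singular point `r` of the Kummer surface `X_s` take the plane `T` dual to `r`, and take the
smooth conics that make up `X_p ∩ T`. -/
def conics (p : Fin 5 → k) : Set (Set (ℙ k (Fin 4 → k))) :=
  {Z | ∃ (i : Fin 10) (s : Fin 5 → k) (r : Fin 4 → k),
    IsThirdPoint p i s ∧ IsSingularPoint s r ∧ IsSmoothConicIn r Z ∧ Z ⊆ surface p}

end Conics

/-! ### Fields of definition -/

section FieldOfDefinition

variable {K : Type*} [Field K]

/-- A subset of projective 3-space over the algebraic closure of `K` is defined over `M` if it is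
the common zero set of homogeneous polynomials with coefficients in `M`. -/
def IsDefinedOver (M : IntermediateField K (AlgebraicClosure K))
    (Z : Set (ℙ (AlgebraicClosure K) (Fin 4 → AlgebraicClosure K))) : Prop :=
  ∃ S : Set (MvPolynomial (Fin 4) M), (∀ F ∈ S, ∃ d, F.IsHomogeneous d) ∧
    Z = zeroLocus (MvPolynomial.map (algebraMap M (AlgebraicClosure K)) '' S)

/-- `L` is the smallest extension of `K` inside its algebraic closure over which all the conics
of `conics p` are defined. -/
def IsFieldOfDefinition (p : Fin 5 → K) (L : IntermediateField K (AlgebraicClosure K)) : Prop :=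
  IsLeast {M : IntermediateField K (AlgebraicClosure K) |
    ∀ Z ∈ conics (fun j => algebraMap K (AlgebraicClosure K) (p j)), IsDefinedOver M Z} L

/-- The extension of `K` generated by the square roots of the ten elements `radicand p j`. -/
def radicalField (p : Fin 5 → K) : IntermediateField K (AlgebraicClosure K) :=
  IntermediateField.adjoin K
    {t | ∃ j, t ^ 2 = algebraMap K (AlgebraicClosure K) (radicand p j)}

end FieldOfDefinition

/-! ### Thin sets in the sense of Serre -/

section Thin

variable {K : Type*} [Field K] {n : ℕ}

/-- A subset of affine `n`-space over `K` is thin if it is contained in the union of the zero set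
of a nonzero polynomial `g` and of finitely many sets `{t | F(t, Y) has a root in K}`, where
`F ∈ K[T₁, …, Tₙ][Y]` is irreducible over `K(T₁, …, Tₙ)` of degree at least two in `Y`. -/
def IsThinAffine (Ω : Set (Fin n → K)) : Prop :=
  ∃ (g : MvPolynomial (Fin n) K) (𝓕 : Finset (Polynomial (MvPolynomial (Fin n) K))),
    g ≠ 0 ∧
    (∀ F ∈ 𝓕, 2 ≤ F.natDegree ∧ Irreducible
      (F.map (algebraMap (MvPolynomial (Fin n) K) (FractionRing (MvPolynomial (Fin n) K))))) ∧
    ∀ t ∈ Ω, MvPolynomial.eval t g = 0 ∨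
      ∃ F ∈ 𝓕, ∃ y : K, (F.map (MvPolynomial.eval t)).eval y = 0

theorem vecCons_one_ne_zero (t : Fin n → K) : (Matrix.vecCons 1 t : Fin (n + 1) → K) ≠ 0 :=
  fun h => one_ne_zero (congrFun h 0)

/-- A set of `K`-rational points of projective `n`-space is thin if its part in the affine chart
`x₀ ≠ 0`, consisting of the points `[1 : t₁ : … : tₙ]`, is thin (the complement of the chart is a
proper closed subset, hence itself thin). -/
def IsThin (Ω : Set (ℙ K (Fin (n + 1) → K))) : Prop :=
  IsThinAffine {t : Fin n → K |
    Projectivization.mk K (Matrix.vecCons 1 t) (vecCons_one_ne_zero t) ∈ Ω}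

end Thin

end HeisenbergQuartic

end

/-! The count. The vector `kummer r` is the parameter of a quartic of the family that is singular at
`r`; it lies on the Segre cubic, and a suitable multiple of its quartic restricts to the plane T
dual to `r` as the square of a quadratic form Q (`quarticVal_kummer_of_plane`). The quartic of a
node is itself the square of one of the ten fundamental quadrics q. Hence, if p = -4·kummer(r) -
η²·node, the quartic of p restricts to T as Q² - η²q² = (Q - ηq)(Q + ηq), a pair of conics. This is
written out for the four nodes with diagonal q; the linear substitutions `twist` carry the other six
to these. The Segre cubic is double at the node, so η² is determined by p. A general point of the
cubic is of the form -4·kummer(r), with `r` unique up to the sixteen Heisenberg transformations and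
twelfth roots of unity (`exists_kummer`, `exists_heis`). This gives 10·16·2 = 320 conics. They are
smooth because the discriminants of the two conics in a plane multiply, up to factors that do not
matter, to the Nieto quintic (`nieto_kummer`), which is nonzero at a general parameter.

The field of definition. Pulled back by `kummer`, each singular form is a constant times a product
of six fundamental quadrics. Consequently certain products ±Δ·ℓ₁ℓ₂ℓ₃ of Δ with three singular forms,
six of them for each node and fifteen in all, become squares of monomials in η and the quadrics
(`syntheme_conicParam`). An automorphism preserving the conic of (r, η) acts by (r, η) ↦ (cr, c⁶η)
with c¹² = 1 and therefore fixes these monomials; so any field of definition contains all the square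
roots (`IsGeneric.radicalField_le`). Conversely, an automorphism over the field of square roots
moves (r, η) by a Heisenberg transformation, a sign of η and a rescaling; the six monomials of the
node detect the first two, which must be trivial (`IsBase.exists_smul_of_fixed`), and a rescaling
does not move the conic. Modulo squares the ten radicands generate all fifteen products
(`exists_syntheme_mul_sq`).

The Galois group. By Kummer theory it is C₂¹⁰ as soon as no nonempty product of distinct radicands
is a square in K (`nonempty_mulEquiv_of_independent`). On the affine chart A = 1 no such product is
a square of a polynomial, because it vanishes to odd order along one of the hyperplanes
(`not_isSquare_prod_radicand`); the parameters at which it specializes to a square therefore form a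
thin set. -/

namespace HeisenbergQuartic

/-! ### Kummer quartics, their tropes, and the pencils through the nodes. -/

section Heisenberg

variable {R S : Type*} [CommRing R] [CommRing S]

/-- The sign vectors of the four diagonal fundamental quadrics. -/
def sgn : Fin 4 → Fin 4 → ℤ :=
  ![![1, 1, 1, 1], ![1, 1, -1, -1], ![1, -1, 1, -1], ![1, -1, -1, 1]]

/-- The permutations of the coordinates in the Heisenberg group. -/
def kleinPerm : Fin 4 → Fin 4 → Fin 4 :=
  ![![0, 1, 2, 3], ![1, 0, 3, 2], ![2, 3, 0, 1], ![3, 2, 1, 0]]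

/-- The action of the Heisenberg group on coordinate vectors. -/
def heis (k l : Fin 4) (r : Fin 4 → R) : Fin 4 → R :=
  fun j => (sgn l j : R) * r (kleinPerm k j)

/-- The ten fundamental quadrics. -/
def quadrics (r : Fin 4 → R) : Fin 10 → R :=
  ![r 0 ^ 2 + r 1 ^ 2 + r 2 ^ 2 + r 3 ^ 2, r 0 ^ 2 + r 1 ^ 2 - r 2 ^ 2 - r 3 ^ 2,
    r 0 ^ 2 - r 1 ^ 2 + r 2 ^ 2 - r 3 ^ 2, r 0 ^ 2 - r 1 ^ 2 - r 2 ^ 2 + r 3 ^ 2,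
    r 0 * r 1 + r 2 * r 3, r 0 * r 1 - r 2 * r 3, r 0 * r 2 + r 1 * r 3, r 0 * r 2 - r 1 * r 3,
    r 0 * r 3 + r 1 * r 2, r 0 * r 3 - r 1 * r 2]

/-- The product of the ten fundamental quadrics. -/
def quadricProd (r : Fin 4 → R) : R :=
  (r 0 ^ 2 + r 1 ^ 2 + r 2 ^ 2 + r 3 ^ 2) * (r 0 ^ 2 + r 1 ^ 2 - r 2 ^ 2 - r 3 ^ 2) *
    (r 0 ^ 2 - r 1 ^ 2 + r 2 ^ 2 - r 3 ^ 2) * (r 0 ^ 2 - r 1 ^ 2 - r 2 ^ 2 + r 3 ^ 2) *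
    ((r 0 ^ 2 * r 1 ^ 2 - r 2 ^ 2 * r 3 ^ 2) * (r 0 ^ 2 * r 2 ^ 2 - r 1 ^ 2 * r 3 ^ 2) *
      (r 0 ^ 2 * r 3 ^ 2 - r 1 ^ 2 * r 2 ^ 2))

/-- The parameter of the Kummer surface in the family that is singular at `r`. -/
def kummer (r : Fin 4 → R) : Fin 5 → R :=
  ![(r 0 ^ 2 * r 1 ^ 2 - r 2 ^ 2 * r 3 ^ 2) * (r 0 ^ 2 * r 2 ^ 2 - r 1 ^ 2 * r 3 ^ 2) *
      (r 0 ^ 2 * r 3 ^ 2 - r 1 ^ 2 * r 2 ^ 2),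
    2 * (r 0 * r 1 * r 2 * r 3) *
      ((r 0 ^ 2 + r 1 ^ 2 + r 2 ^ 2 + r 3 ^ 2) * (r 0 ^ 2 + r 1 ^ 2 - r 2 ^ 2 - r 3 ^ 2) *
        (r 0 ^ 2 - r 1 ^ 2 + r 2 ^ 2 - r 3 ^ 2) * (r 0 ^ 2 - r 1 ^ 2 - r 2 ^ 2 + r 3 ^ 2)),
    -((r 0 ^ 4 + r 1 ^ 4 - r 2 ^ 4 - r 3 ^ 4) * (r 0 ^ 2 * r 2 ^ 2 - r 1 ^ 2 * r 3 ^ 2) *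
      (r 0 ^ 2 * r 3 ^ 2 - r 1 ^ 2 * r 2 ^ 2)),
    -((r 0 ^ 4 + r 2 ^ 4 - r 1 ^ 4 - r 3 ^ 4) * (r 0 ^ 2 * r 1 ^ 2 - r 2 ^ 2 * r 3 ^ 2) *
      (r 0 ^ 2 * r 3 ^ 2 - r 1 ^ 2 * r 2 ^ 2)),
    -((r 0 ^ 4 + r 3 ^ 4 - r 1 ^ 4 - r 2 ^ 4) * (r 0 ^ 2 * r 1 ^ 2 - r 2 ^ 2 * r 3 ^ 2) *
      (r 0 ^ 2 * r 2 ^ 2 - r 1 ^ 2 * r 3 ^ 2))]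

/-- The coefficients of the diagonal quadratic form that cuts out the double conic of the Kummer
surface with parameter `-4 • kummer r` in the plane dual to `r`. -/
def tropeCoeff (r : Fin 4 → R) : Fin 4 → R :=
  ![r 0 ^ 2 * (r 0 ^ 4 - r 1 ^ 4 - r 2 ^ 4 - r 3 ^ 4) + 2 * (r 1 ^ 2 * r 2 ^ 2 * r 3 ^ 2),
    r 1 ^ 2 * (r 1 ^ 4 - r 0 ^ 4 - r 2 ^ 4 - r 3 ^ 4) + 2 * (r 0 ^ 2 * r 2 ^ 2 * r 3 ^ 2),
    r 2 ^ 2 * (r 2 ^ 4 - r 0 ^ 4 - r 1 ^ 4 - r 3 ^ 4) + 2 * (r 0 ^ 2 * r 1 ^ 2 * r 3 ^ 2),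
    r 3 ^ 2 * (r 3 ^ 4 - r 0 ^ 4 - r 1 ^ 4 - r 2 ^ 4) + 2 * (r 0 ^ 2 * r 1 ^ 2 * r 2 ^ 2)]

/-- The index of the node of the Segre cubic whose quartic is the square of the diagonal quadric
with signs `sgn i`. -/
def diagNode : Fin 4 → Fin 10 := ![3, 2, 1, 0]

/-- The values of the polynomial `quartic p`. -/
def quarticVal (p : Fin 5 → R) (v : Fin 4 → R) : R :=
  p 0 * (v 0 ^ 4 + v 1 ^ 4 + v 2 ^ 4 + v 3 ^ 4) + p 1 * (v 0 * v 1 * v 2 * v 3)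
    + p 2 * (v 0 ^ 2 * v 1 ^ 2 + v 2 ^ 2 * v 3 ^ 2)
    + p 3 * (v 0 ^ 2 * v 2 ^ 2 + v 1 ^ 2 * v 3 ^ 2)
    + p 4 * (v 0 ^ 2 * v 3 ^ 2 + v 1 ^ 2 * v 2 ^ 2)

/-- The partial derivatives of the polynomial `quartic p`. -/
def quarticGrad (p : Fin 5 → R) (v : Fin 4 → R) : Fin 4 → R :=
  ![4 * p 0 * v 0 ^ 3 + p 1 * (v 1 * v 2 * v 3)
      + 2 * v 0 * (p 2 * v 1 ^ 2 + p 3 * v 2 ^ 2 + p 4 * v 3 ^ 2),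
    4 * p 0 * v 1 ^ 3 + p 1 * (v 0 * v 2 * v 3)
      + 2 * v 1 * (p 2 * v 0 ^ 2 + p 3 * v 3 ^ 2 + p 4 * v 2 ^ 2),
    4 * p 0 * v 2 ^ 3 + p 1 * (v 0 * v 1 * v 3)
      + 2 * v 2 * (p 2 * v 3 ^ 2 + p 3 * v 0 ^ 2 + p 4 * v 1 ^ 2),
    4 * p 0 * v 3 ^ 3 + p 1 * (v 0 * v 1 * v 2)
      + 2 * v 3 * (p 2 * v 2 ^ 2 + p 3 * v 1 ^ 2 + p 4 * v 0 ^ 2)]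

theorem eval_quartic (p : Fin 5 → R) (v : Fin 4 → R) :
    MvPolynomial.eval v (quartic p) = quarticVal p v := by
  simp [quartic, quarticVal]

theorem eval_pderiv_quartic (p : Fin 5 → R) (v : Fin 4 → R) (j : Fin 4) :
    MvPolynomial.eval v (MvPolynomial.pderiv j (quartic p)) = quarticGrad p v j := by
  fin_cases j <;>
    simp [quartic, quarticGrad, MvPolynomial.pderiv_X, Derivation.leibniz_pow] <;>
    ring

/-- Being singular at `r` imposes four linear equations on the five parameters; `kummer r` is a
solution with denominators cleared, and such solutions trace out the Segre cubic. -/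
theorem segreCubic_kummer (r : Fin 4 → R) : segreCubic (kummer r) = 0 := by
  simp [segreCubic, kummer]
  ring

theorem quarticGrad_kummer (r : Fin 4 → R) (j : Fin 4) : quarticGrad (kummer r) r j = 0 := by
  fin_cases j <;> simp [quarticGrad, kummer] <;> ring

theorem quarticVal_kummer (r : Fin 4 → R) : quarticVal (kummer r) r = 0 := by
  simp [quarticVal, kummer]
  ring

/-- In the plane dual to `r` the Kummer surface with parameter `-4 • kummer r` is a double
conic. -/
theorem quarticVal_kummer_of_plane (r v : Fin 4 → R)
    (h : r 0 * v 0 + r 1 * v 1 + r 2 * v 2 + r 3 * v 3 = 0) :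
    quarticVal ((-4 : R) • kummer r) v =
      (tropeCoeff r 0 * v 0 ^ 2 + tropeCoeff r 1 * v 1 ^ 2 + tropeCoeff r 2 * v 2 ^ 2
        + tropeCoeff r 3 * v 3 ^ 2) ^ 2 := by
  -- The square of a diagonal form contains no xyzw term. What is missing is a multiple of the
  -- product of four planes, the images of the plane of `r` under the sign changes; one of them is
  -- that plane itself.
  have key : quarticVal ((-4 : R) • kummer r) v =
      (tropeCoeff r 0 * v 0 ^ 2 + tropeCoeff r 1 * v 1 ^ 2 + tropeCoeff r 2 * v 2 ^ 2
        + tropeCoeff r 3 * v 3 ^ 2) ^ 2 -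
      ((r 0 ^ 2 + r 1 ^ 2 + r 2 ^ 2 + r 3 ^ 2) * (r 0 ^ 2 + r 1 ^ 2 - r 2 ^ 2 - r 3 ^ 2) *
        (r 0 ^ 2 - r 1 ^ 2 + r 2 ^ 2 - r 3 ^ 2) * (r 0 ^ 2 - r 1 ^ 2 - r 2 ^ 2 + r 3 ^ 2)) *
      ((r 0 * v 0 + r 1 * v 1 + r 2 * v 2 + r 3 * v 3) *
        (r 0 * v 0 + r 1 * v 1 - r 2 * v 2 - r 3 * v 3) *
        (r 0 * v 0 - r 1 * v 1 + r 2 * v 2 - r 3 * v 3) *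
        (r 0 * v 0 - r 1 * v 1 - r 2 * v 2 + r 3 * v 3)) := by
    simp [quarticVal, kummer, tropeCoeff]
    ring
  rw [key, h]
  ring

/-- The derivative of the Segre cubic at `p` in the direction of the `m`-th node. -/
def segrePolar (m : Fin 10) (p : Fin 5 → R) : R :=
  (48 * p 0 ^ 2 + p 1 ^ 2 - 4 * (p 2 ^ 2 + p 3 ^ 2 + p 4 ^ 2)) * node m 0
    + 2 * p 0 * p 1 * node m 1 + (4 * p 3 * p 4 - 8 * p 0 * p 2) * node m 2
    + (4 * p 2 * p 4 - 8 * p 0 * p 3) * node m 3 + (4 * p 2 * p 3 - 8 * p 0 * p 4) * node m 4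

/-- The node is a double point of the cubic, so the terms in c² and c³ drop out. The third point is
thus the solution of a linear equation in `c`. -/
theorem segreCubic_add_smul_node (p : Fin 5 → R) (c : R) (m : Fin 10) :
    segreCubic (p + c • node m) = segreCubic p + c * segrePolar m p := by
  fin_cases m <;> simp [segreCubic, segrePolar, node] <;> ring

/-- Together with the linearity in `c`, this makes Δ a monomial in η and the fundamental quadrics
along the line joining a Kummer parameter to a diagonal node. -/
theorem segrePolar_kummer (r : Fin 4 → R) (i : Fin 4) :
    segrePolar (diagNode i) (kummer r) =
      4 * quadricProd r * quadrics r (Fin.castLE (by norm_num) i) ^ 2 := by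
  fin_cases i <;> simp [segrePolar, diagNode, node, kummer, quadricProd, quadrics] <;> ring

end Heisenberg

end HeisenbergQuartic

namespace HeisenbergQuartic

/-! ### The Nieto quintic as a product of two discriminants of conics. -/

section Nieto

variable {R S : Type*} [CommRing R] [CommRing S]

/-- The quintic form defining the Nieto quintic. -/
def nieto (p : Fin 5 → R) : R :=
  (64 * p 0 ^ 2 - p 1 ^ 2) *
      (-64 * (4 * p 0 ^ 3 - p 0 * (p 2 ^ 2 + p 3 ^ 2 + p 4 ^ 2) - p 2 * p 3 * p 4))
    + 256 * p 0 * (16 * p 0 ^ 4 - 8 * p 0 ^ 2 * (p 2 ^ 2 + p 3 ^ 2 + p 4 ^ 2)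
      - 16 * p 0 * (p 2 * p 3 * p 4) + (p 2 ^ 2 + p 3 ^ 2 + p 4 ^ 2) ^ 2
      - 4 * (p 2 ^ 2 * p 3 ^ 2 + p 3 ^ 2 * p 4 ^ 2 + p 2 ^ 2 * p 4 ^ 2))

/-- The quintic is symmetric in C, D, E. Passing to elementary symmetric functions keeps the later
identities small enough to expand. -/
theorem nieto_symm (A B s1 s2 s3 C D E : R) (h1 : C + D + E = s1)
    (h2 : C * D + D * E + C * E = s2) (h3 : C * D * E = s3) :
    nieto ![A, B, C, D, E] = (64 * A ^ 2 - B ^ 2) *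
      (-64 * (4 * A ^ 3 - A * (s1 ^ 2 - 2 * s2) - s3))
    + 256 * A * (16 * A ^ 4 - 8 * A ^ 2 * (s1 ^ 2 - 2 * s2)
      - 16 * A * s3 + (s1 ^ 2 - 2 * s2) ^ 2 - 4 * (s2 ^ 2 - 2 * s1 * s3)) := by
  subst h1 h2 h3
  simp [nieto]
  ring

/-- The core of the discriminant identity. The letters stand for functions of the four squared
coordinates, given in `nieto_squares`; `H` is η² and `u` the sum of the squares. The last factor is
a difference of two squares once H = h², which yields the two discriminants. -/
theorem nieto_symm_kummer (m P q n H A B B2 s1 s2 s3 k1 k2 k3 u : R)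
    (hu : u ^ 3 = m + 4 * n) (hk1 : k1 = -q * m - 2 * P) (hk2 : k2 = P * m * n - 4 * P ^ 2)
    (hk3 : k3 = -P ^ 2 * (-4 * q * m - 8 * P + m ^ 2 + 2 * m * n))
    (hA : A = -4 * P - H) (hB : B ^ 2 = B2) (hB2 : B2 = 64 * m ^ 2 * (P + q ^ 2))
    (h1 : s1 = -4 * k1 - 6 * H) (h2 : s2 = 16 * k2 + 16 * H * k1 + 12 * H ^ 2)
    (h3 : s3 = -64 * k3 - 32 * H * k2 - 16 * H ^ 2 * k1 - 8 * H ^ 3) :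
    (64 * A ^ 2 - B ^ 2) *
      (-64 * (4 * A ^ 3 - A * (s1 ^ 2 - 2 * s2) - s3))
    + 256 * A * (16 * A ^ 4 - 8 * A ^ 2 * (s1 ^ 2 - 2 * s2)
      - 16 * A * s3 + (s1 ^ 2 - 2 * s2) ^ 2 - 4 * (s2 ^ 2 - 2 * s1 * s3)) =
    -65536 * m * P * u ^ 3 * (4 * m ^ 2 * P ^ 2 - H * (4 * P - m * q + H) ^ 2) := by
  rw [hu, hB]
  subst hB2 h1 h2 h3 hA hk1 hk2 hk3
  ring

/-- The discriminant of the conic cut out by the diagonal quadratic form `f` in the plane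
dual to `r`. -/
def conicDisc (X f : Fin 4 → R) : R :=
  X 0 * f 1 * f 2 * f 3 + X 1 * f 0 * f 2 * f 3 + X 2 * f 0 * f 1 * f 3 + X 3 * f 0 * f 1 * f 2

/-- Besides the sum of the four variables there remains a cubic in `h` without quadratic term. Its
values at `h` and `-h` multiply to a difference of squares, the shape of `nieto_symm_kummer`. -/
theorem conicDisc_factor (X Y Z W h : R) :
    conicDisc ![X, Y, Z, W]
      ![X * (X ^ 2 - Y ^ 2 - Z ^ 2 - W ^ 2) + 2 * (Y * Z * W) - h,
        Y * (Y ^ 2 - X ^ 2 - Z ^ 2 - W ^ 2) + 2 * (X * Z * W) - h,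
        Z * (Z ^ 2 - X ^ 2 - Y ^ 2 - W ^ 2) + 2 * (X * Y * W) - h,
        W * (W ^ 2 - X ^ 2 - Y ^ 2 - Z ^ 2) + 2 * (X * Y * Z) - h] =
    (X + Y + Z + W) *
      (2 * ((X + Y - Z - W) * (X - Y + Z - W) * (X - Y - Z + W)) *
          ((X * Y - Z * W) * (X * Z - Y * W) * (X * W - Y * Z))
        - (4 * ((X * Y - Z * W) * (X * Z - Y * W) * (X * W - Y * Z))
          - (X + Y - Z - W) * (X - Y + Z - W) * (X - Y - Z + W) *
            (X * Y * Z + X * Y * W + X * Z * W + Y * Z * W)) * h - h ^ 3) := by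
  simp [conicDisc]
  ring

/-- Only B² is prescribed, since the quintic involves B through its square; this square, unlike B,
is a polynomial in the squared coordinates X, Y, Z, W. -/
theorem nieto_squares (X Y Z W h B A C D E : R)
    (hA : A = -4 * ((X * Y - Z * W) * (X * Z - Y * W) * (X * W - Y * Z)) - h ^ 2)
    (hB : B ^ 2 = 64 * (X * Y * Z * W) *
      ((X + Y + Z + W) * (X + Y - Z - W) * (X - Y + Z - W) * (X - Y - Z + W)) ^ 2)
    (hC : C = 4 * ((X ^ 2 + Y ^ 2 - Z ^ 2 - W ^ 2) * (X * Z - Y * W) * (X * W - Y * Z)) - 2 * h ^ 2)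
    (hD : D = 4 * ((X ^ 2 + Z ^ 2 - Y ^ 2 - W ^ 2) * (X * Y - Z * W) * (X * W - Y * Z)) - 2 * h ^ 2)
    (hE : E = 4 * ((X ^ 2 + W ^ 2 - Y ^ 2 - Z ^ 2) * (X * Y - Z * W) * (X * Z - Y * W))
      - 2 * h ^ 2) :
    nieto ![A, B, C, D, E] =
    -65536 * ((X * Y - Z * W) * (X * Z - Y * W) * (X * W - Y * Z) *
      ((X + Y + Z + W) * (X + Y - Z - W) * (X - Y + Z - W) * (X - Y - Z + W))) *
      conicDisc ![X, Y, Z, W]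
      ![X * (X ^ 2 - Y ^ 2 - Z ^ 2 - W ^ 2) + 2 * (Y * Z * W) - h,
        Y * (Y ^ 2 - X ^ 2 - Z ^ 2 - W ^ 2) + 2 * (X * Z * W) - h,
        Z * (Z ^ 2 - X ^ 2 - Y ^ 2 - W ^ 2) + 2 * (X * Y * W) - h,
        W * (W ^ 2 - X ^ 2 - Y ^ 2 - Z ^ 2) + 2 * (X * Y * Z) - h] *
      conicDisc ![X, Y, Z, W]
      ![X * (X ^ 2 - Y ^ 2 - Z ^ 2 - W ^ 2) + 2 * (Y * Z * W) - -h,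
        Y * (Y ^ 2 - X ^ 2 - Z ^ 2 - W ^ 2) + 2 * (X * Z * W) - -h,
        Z * (Z ^ 2 - X ^ 2 - Y ^ 2 - W ^ 2) + 2 * (X * Y * W) - -h,
        W * (W ^ 2 - X ^ 2 - Y ^ 2 - Z ^ 2) + 2 * (X * Y * Z) - -h] := by
  rw [conicDisc_factor, conicDisc_factor]
  set P := (X * Y - Z * W) * (X * Z - Y * W) * (X * W - Y * Z) with hP
  set m := (X + Y - Z - W) * (X - Y + Z - W) * (X - Y - Z + W) with hm
  set q := X * Y * Z + X * Y * W + X * Z * W + Y * Z * W with hq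
  set n := (X + Y + Z + W) * (X * Y + X * Z + X * W + Y * Z + Y * W + Z * W) - 2 * q with hn
  set k1 := -((X ^ 2 + Y ^ 2 - Z ^ 2 - W ^ 2) * (X * Z - Y * W) * (X * W - Y * Z)) with hk1
  set k2 := -((X ^ 2 + Z ^ 2 - Y ^ 2 - W ^ 2) * (X * Y - Z * W) * (X * W - Y * Z)) with hk2
  set k3 := -((X ^ 2 + W ^ 2 - Y ^ 2 - Z ^ 2) * (X * Y - Z * W) * (X * Z - Y * W)) with hk3
  -- Eliminates the product XYZW, which enters only through B².
  have hPe : P + q ^ 2 = (X + Y + Z + W) ^ 2 * (X * Y * Z * W) := by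
    rw [hP, hq]; ring
  have hs3 : (X ^ 2 + Y ^ 2 - Z ^ 2 - W ^ 2) * (X ^ 2 + Z ^ 2 - Y ^ 2 - W ^ 2) *
      (X ^ 2 + W ^ 2 - Y ^ 2 - Z ^ 2) = -4 * q * m - 8 * P + m ^ 2 + 2 * m * n := by
    rw [hn, hP, hm, hq]; ring
  rw [nieto_symm A B (C + D + E) (C * D + D * E + C * E) (C * D * E) C D E rfl rfl rfl,
    nieto_symm_kummer m P q n (h ^ 2) A B (B ^ 2) (C + D + E) (C * D + D * E + C * E) (C * D * E)
      (k1 + k2 + k3) (k1 * k2 + k2 * k3 + k1 * k3) (k1 * k2 * k3) (X + Y + Z + W)]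
  · have hu : (X + Y + Z + W) * (X + Y - Z - W) * (X - Y + Z - W) * (X - Y - Z + W) =
        (X + Y + Z + W) * m := by rw [hm]; ring
    rw [hu]
    generalize X + Y + Z + W = u
    clear_value P m q n
    ring
  · rw [hn, hm, hq]; ring
  · rw [hk1, hk2, hk3, hP, hm, hq]; ring
  · have hs2 : (X ^ 2 + Y ^ 2 - Z ^ 2 - W ^ 2) * (X ^ 2 + Z ^ 2 - Y ^ 2 - W ^ 2) *
        (X * W - Y * Z) + (X ^ 2 + Z ^ 2 - Y ^ 2 - W ^ 2) * (X ^ 2 + W ^ 2 - Y ^ 2 - Z ^ 2) *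
        (X * Y - Z * W) + (X ^ 2 + Y ^ 2 - Z ^ 2 - W ^ 2) * (X ^ 2 + W ^ 2 - Y ^ 2 - Z ^ 2) *
        (X * Z - Y * W) = m * n - 4 * P := by
      rw [hn, hP, hm, hq]; ring
    have : P * m * n - 4 * P ^ 2 = P * (m * n - 4 * P) := by ring
    rw [this, ← hs2, hk1, hk2, hk3, hP]
    generalize X * Y - Z * W = v
    generalize X * Z - Y * W = w
    generalize X * W - Y * Z = t
    ring
  · rw [← hs3, hk1, hk2, hk3, hP]
    generalize X * Y - Z * W = v
    generalize X * Z - Y * W = w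
    generalize X * W - Y * Z = t
    ring
  · rw [hA]
  · rfl
  · rw [hPe, hB, hm]; ring
  all_goals
    have hC' : C = -4 * k1 - 2 * h ^ 2 := by rw [hC, hk1]; ring
    have hD' : D = -4 * k2 - 2 * h ^ 2 := by rw [hD, hk2]; ring
    have hE' : E = -4 * k3 - 2 * h ^ 2 := by rw [hE, hk3]; ring
    clear_value k1 k2 k3
    rw [hC', hD', hE']
    ring

/-- The coefficients of the diagonal quadratic form cutting out one of the conics. -/
def conicCoeff (i : Fin 4) (r : Fin 4 → R) (η : R) (j : Fin 4) : R :=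
  tropeCoeff r j - η * (sgn i j : R)

theorem conicDisc_sgn_mul (i : Fin 4) (X f : Fin 4 → R) :
    conicDisc (fun j => (sgn i j : R) * X j) (fun j => (sgn i j : R) * f j) = conicDisc X f := by
  fin_cases i <;> simp [conicDisc, sgn]

/-- The three signs multiply to one, so they preserve CDE as well as the squares of C, D, E. -/
theorem nieto_sgn (i : Fin 4) (p : Fin 5 → R) :
    nieto p = nieto ![p 0, p 1, sgn i 0 * sgn i 1 * p 2, sgn i 0 * sgn i 2 * p 3,
      sgn i 0 * sgn i 3 * p 4] := by
  fin_cases i <;> simp [nieto, sgn]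

set_option maxHeartbeats 2000000 in
theorem nieto_kummer (i : Fin 4) (r : Fin 4 → R) (η : R) :
    nieto ((-4 : R) • kummer r - η ^ 2 • node (diagNode i)) =
      -65536 * quadricProd r * conicDisc (fun j => r j ^ 2) (conicCoeff i r η) *
        conicDisc (fun j => r j ^ 2) (conicCoeff i r (-η)) := by
  -- Multiplying the squared coordinates by the signs of the `i`-th diagonal quadric turns that
  -- quadric into the sum of squares, so `nieto_squares` covers all four cases.
  have hs (ζ : R) := conicDisc_sgn_mul i (fun j => r j ^ 2) (conicCoeff i r ζ)
  rw [← hs η, ← hs (-η)]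
  have hX : (fun j => (sgn i j : R) * r j ^ 2) = ![(sgn i 0 : R) * r 0 ^ 2, sgn i 1 * r 1 ^ 2,
      sgn i 2 * r 2 ^ 2, sgn i 3 * r 3 ^ 2] := by
    ext j; fin_cases j <;> rfl
  have hf (ζ : R) : (fun j => (sgn i j : R) * conicCoeff i r ζ j) =
      ![(sgn i 0 : R) * conicCoeff i r ζ 0, sgn i 1 * conicCoeff i r ζ 1,
      sgn i 2 * conicCoeff i r ζ 2, sgn i 3 * conicCoeff i r ζ 3] := by
    ext j; fin_cases j <;> rfl
  rw [hX, hf, hf]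
  have key := nieto_squares ((sgn i 0 : R) * r 0 ^ 2) (sgn i 1 * r 1 ^ 2) (sgn i 2 * r 2 ^ 2)
      (sgn i 3 * r 3 ^ 2) η (-4 * kummer r 1) _ _ _ _ rfl
      (by fin_cases i <;> simp [kummer, sgn] <;> ring) rfl rfl rfl
  convert key using 1
  · rw [nieto_sgn i]
    congr 1
    ext j
    fin_cases i <;> fin_cases j <;> simp [kummer, node, diagNode, sgn] <;> ring
  · refine congrArg₂ _ (congrArg₂ _ (congrArg _ ?_) (congrArg _ ?_)) (congrArg _ ?_)
    · rw [quadricProd, mul_comm]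
      refine congrArg₂ _ ?_ ?_ <;> fin_cases i <;> simp [sgn] <;> ring
    all_goals
      ext j
      fin_cases i <;> fin_cases j <;> simp [conicCoeff, tropeCoeff, sgn] <;> ring

end Nieto

end HeisenbergQuartic

namespace HeisenbergQuartic

/-! ### Fundamental quadrics, Heisenberg characters and syntheme products. -/

section Tables

variable {R S : Type*} [CommRing R] [CommRing S]

/-- The constant in the factorization of a singular form on the Segre cubic. -/
def formConst : Fin 15 → ℤ := ![1, -1, 1, -1, 1, -1, 1, 2, 2, 2, 2, -2, -2, -2, -2]

/-- The six fundamental quadrics that divide the pullback of a singular form under `kummer`. -/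
def formQuadrics : Fin 15 → Fin 6 → Fin 10 :=
  ![![4, 5, 6, 7, 8, 9], ![2, 3, 6, 7, 8, 9], ![0, 1, 6, 7, 8, 9], ![1, 3, 4, 5, 8, 9],
    ![0, 2, 4, 5, 8, 9], ![1, 2, 4, 5, 6, 7], ![0, 3, 4, 5, 6, 7], ![1, 2, 3, 5, 7, 9],
    ![0, 2, 3, 5, 6, 8], ![0, 1, 3, 4, 7, 8], ![0, 1, 2, 4, 6, 9], ![1, 2, 3, 4, 6, 8],
    ![0, 2, 3, 4, 7, 9], ![0, 1, 3, 5, 6, 9], ![0, 1, 2, 5, 7, 8]]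

set_option maxHeartbeats 2000000 in
theorem singularForm_kummer (r : Fin 4 → R) (j : Fin 15) :
    singularForm (kummer r) j =
      (formConst j : R) * ∏ t, quadrics r (formQuadrics j t) := by
  fin_cases j <;>
    simp [singularForm, kummer, formConst, formQuadrics, Fin.prod_univ_succ, quadrics, qPlusC,
      qMinusC, qPlusD, qMinusD, qPlusE, qMinusE, pPlus0, pPlus1, pPlus2, pPlus3, pMinus0,
      pMinus1, pMinus2, pMinus3] <;> ring

theorem singularForm_add (p q : Fin 5 → R) (j : Fin 15) :
    singularForm (p + q) j = singularForm p j + singularForm q j := by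
  fin_cases j <;>
    simp [singularForm, qPlusC,
      qMinusC, qPlusD, qMinusD, qPlusE, qMinusE, pPlus0, pPlus1, pPlus2, pPlus3, pMinus0,
      pMinus1, pMinus2, pMinus3] <;> ring

theorem singularForm_smul (c : R) (p : Fin 5 → R) (j : Fin 15) :
    singularForm (c • p) j = c * singularForm p j := by
  fin_cases j <;>
    simp [singularForm, qPlusC,
      qMinusC, qPlusD, qMinusD, qPlusE, qMinusE, pPlus0, pPlus1, pPlus2, pPlus3, pMinus0,
      pMinus1, pMinus2, pMinus3] <;> ring

theorem quadricProd_eq_prod (r : Fin 4 → R) : quadricProd r = ∏ j, quadrics r j := by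
  simp [quadricProd, quadrics, Fin.prod_univ_succ]
  ring

/-- The signs by which the Heisenberg group acts on the fundamental quadrics. -/
def chi (j : Fin 10) (k l : Fin 4) : ℤ :=
  (![sgn 0 k, sgn 1 k, sgn 2 k, sgn 3 k, sgn 1 l, sgn 1 k * sgn 1 l, sgn 2 l, sgn 2 k * sgn 2 l,
    sgn 3 l, sgn 3 k * sgn 3 l] : Fin 10 → ℤ) j

theorem heis_eq_sgn_mul (k l : Fin 4) (r : Fin 4 → R) :
    heis k l r = fun j => (sgn l j : R) * r (kleinPerm k j) := rfl

theorem quadrics_perm (k : Fin 4) (r : Fin 4 → R) (j : Fin 10) :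
    quadrics (fun a => r (kleinPerm k a)) j = (chi j k 0 : R) * quadrics r j := by
  fin_cases k <;> fin_cases j <;>
    simp [quadrics, kleinPerm, sgn, chi] <;> ring

theorem quadrics_sgn_mul (l : Fin 4) (r : Fin 4 → R) (j : Fin 10) :
    quadrics (fun a => (sgn l a : R) * r a) j = (chi j 0 l : R) * quadrics r j := by
  fin_cases l <;> fin_cases j <;>
    simp [quadrics, sgn, chi] <;> ring

theorem chi_mul (j : Fin 10) (k l : Fin 4) : chi j 0 l * chi j k 0 = chi j k l := by
  revert j k l; decide

theorem quadrics_heis (k l : Fin 4) (r : Fin 4 → R) (j : Fin 10) :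
    quadrics (heis k l r) j = (chi j k l : R) * quadrics r j := by
  rw [heis_eq_sgn_mul, quadrics_sgn_mul l (fun a => r (kleinPerm k a)), quadrics_perm, ← mul_assoc,
    ← Int.cast_mul, chi_mul]

theorem quadrics_smul (t : R) (r : Fin 4 → R) (j : Fin 10) :
    quadrics (t • r) j = t ^ 2 * quadrics r j := by
  fin_cases j <;> simp [quadrics] <;> ring

theorem prod_chi (k l : Fin 4) : ∏ j, chi j k l = 1 := by
  revert k l; decide

theorem quadricProd_heis (k l : Fin 4) (r : Fin 4 → R) :
    quadricProd (heis k l r) = quadricProd r := by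
  rw [quadricProd_eq_prod, quadricProd_eq_prod, Finset.prod_congr rfl
    fun j _ => quadrics_heis k l r j, Finset.prod_mul_distrib, ← Int.cast_prod, prod_chi]
  simp

theorem quadricProd_smul (t : R) (r : Fin 4 → R) :
    quadricProd (t • r) = t ^ 20 * quadricProd r := by
  rw [quadricProd_eq_prod, quadricProd_eq_prod, Finset.prod_congr rfl
    fun j _ => quadrics_smul t r j, Finset.prod_mul_distrib]
  simp [← pow_mul]

theorem kummer_perm (k : Fin 4) (r : Fin 4 → R) :
    kummer (fun a => r (kleinPerm k a)) = kummer r := by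
  ext j
  fin_cases k <;> fin_cases j <;> simp [kummer, kleinPerm] <;> ring

theorem kummer_sgn_mul (l : Fin 4) (r : Fin 4 → R) :
    kummer (fun a => (sgn l a : R) * r a) = kummer r := by
  ext j
  fin_cases l <;> fin_cases j <;> simp [kummer, sgn, (by decide : Even 4).neg_pow]

theorem kummer_heis (k l : Fin 4) (r : Fin 4 → R) : kummer (heis k l r) = kummer r := by
  rw [heis_eq_sgn_mul, kummer_sgn_mul l (fun a => r (kleinPerm k a)), kummer_perm]

theorem kummer_smul (t : R) (r : Fin 4 → R) : kummer (t • r) = t ^ 12 • kummer r := by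
  ext j
  fin_cases j <;> simp [kummer] <;> ring

theorem tropeCoeff_smul (t : R) (r : Fin 4 → R) (j : Fin 4) :
    tropeCoeff (t • r) j = t ^ 6 * tropeCoeff r j := by
  fin_cases j <;> simp [tropeCoeff] <;> ring

/-- The three singular forms in each of the fifteen syntheme products. -/
def synthemeForms : Fin 15 → Fin 3 → Fin 15 :=
  ![![0, 1, 2], ![0, 3, 4], ![0, 5, 6], ![1, 7, 12], ![1, 11, 8], ![3, 7, 13], ![3, 11, 9],
    ![5, 7, 14], ![5, 11, 10], ![2, 9, 14], ![2, 13, 10], ![4, 8, 14], ![4, 12, 10],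
    ![6, 8, 13], ![6, 12, 9]]

/-- The signs of the syntheme products. -/
def synthemeSign : Fin 15 → ℤ := ![-1, -1, -1, 1, 1, 1, 1, 1, 1, -1, -1, -1, -1, -1, -1]

/-- The fifteen elements, one for each syntheme, whose square roots generate the field of
definition of the conics. -/
def syntheme (p : Fin 5 → R) (j : Fin 15) : R :=
  (synthemeSign j : R) * segreCubic p * ∏ t, singularForm p (synthemeForms j t)

/-- The four fundamental quadrics that are transversal to a syntheme. -/
def synthemeQuadrics : Fin 15 → Fin 4 → Fin 10 :=
  ![![6, 7, 8, 9], ![4, 5, 8, 9], ![4, 5, 6, 7], ![2, 3, 7, 9], ![2, 3, 6, 8], ![1, 3, 5, 9],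
    ![1, 3, 4, 8], ![1, 2, 5, 7], ![1, 2, 4, 6], ![0, 1, 7, 8], ![0, 1, 6, 9], ![0, 2, 5, 8],
    ![0, 2, 4, 9], ![0, 3, 5, 6], ![0, 3, 4, 7]]

/-- The six synthemes that are transversal to a diagonal quadric. -/
def diagSynthemes : Fin 4 → Fin 6 → Fin 15 :=
  ![![9, 10, 11, 12, 13, 14], ![5, 6, 7, 8, 9, 10], ![3, 4, 7, 8, 11, 12], ![3, 4, 5, 6, 13, 14]]

/-- The diagonal quadric with signs `sgn i`, as one of the fundamental quadrics. -/
def diagQuadric (i : Fin 4) : Fin 10 := Fin.castLE (by norm_num) i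

/-- The square root of a syntheme product in terms of the coordinates of a conic. -/
def synthemeRoot (i : Fin 4) (r : Fin 4 → R) (η : R) (j : Fin 15) : R :=
  128 * η * quadricProd r * quadrics r (diagQuadric i) *
    ∏ t, quadrics r (synthemeQuadrics j t)

theorem map_singularForm (f : R →+* S) (p : Fin 5 → R) (j : Fin 15) :
    f (singularForm p j) = singularForm (fun a => f (p a)) j := by
  fin_cases j <;>
    simp [singularForm, qPlusC, qMinusC, qPlusD, qMinusD, qPlusE, qMinusE, pPlus0, pPlus1, pPlus2,
      pPlus3, pMinus0, pMinus1, pMinus2, pMinus3, map_ofNat f 2, map_ofNat f 4]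

theorem map_node (f : R →+* S) (m : Fin 10) (a : Fin 5) :
    f (node m a) = node m a := by
  fin_cases m <;> fin_cases a <;> simp [node, map_ofNat f 2]

/-- The reason for singling out six synthemes per node: their forms vanish at the node, hence do not
change along the line from the Kummer parameter to `p`. -/
theorem singularForm_diagNode (i : Fin 4) (t : Fin 6) (u : Fin 3) :
    singularForm (node (diagNode i) : Fin 5 → R) (synthemeForms (diagSynthemes i t) u) = 0 := by
  have h : singularForm (node (diagNode i) : Fin 5 → ℤ)
      (synthemeForms (diagSynthemes i t) u) = 0 := by
    revert i t u; decide
  have h2 := map_singularForm (Int.castRingHom R) (node (diagNode i))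
    (synthemeForms (diagSynthemes i t) u)
  simp only [map_node] at h2
  rw [← h2, h, map_zero]

theorem segreCubic_smul (c : R) (p : Fin 5 → R) : segreCubic (c • p) = c ^ 3 * segreCubic p := by
  simp [segreCubic]
  ring

theorem segrePolar_smul (m : Fin 10) (c : R) (p : Fin 5 → R) :
    segrePolar m (c • p) = c ^ 2 * segrePolar m p := by
  simp [segrePolar]
  ring

theorem segreCubic_conicParam (i : Fin 4) (r : Fin 4 → R) (η : R) :
    segreCubic ((-4 : R) • kummer r - η ^ 2 • node (diagNode i)) =
      -64 * η ^ 2 * quadricProd r * quadrics r (diagQuadric i) ^ 2 := by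
  rw [sub_eq_add_neg, ← neg_smul, segreCubic_add_smul_node, segreCubic_smul, segreCubic_kummer,
    segrePolar_smul, segrePolar_kummer, diagQuadric]
  ring

/-- Three forms contribute eighteen quadrics: the four transversal ones occur three times each, the
remaining six once each. -/
theorem synthemeQuadrics_prod (q : Fin 10 → R) (j : Fin 15) :
    ∏ u, ∏ t, q (formQuadrics (synthemeForms j u) t) =
      (∏ m, q m) * (∏ t, q (synthemeQuadrics j t)) ^ 2 := by
  fin_cases j <;>
    simp [Fin.prod_univ_succ, synthemeForms, formQuadrics, synthemeQuadrics] <;> ring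

theorem synthemeSign_mul (i : Fin 4) (t : Fin 6) :
    synthemeSign (diagSynthemes i t) * ∏ u, formConst (synthemeForms (diagSynthemes i t) u) = 4 := by
  revert i t; decide

/-- Δ supplies one factor `quadricProd r` and the three forms supply another; everything else is
already a square. The constants are (-64)·(-4)³·4 = 128², where 4 comes from `synthemeSign_mul`. -/
theorem syntheme_conicParam (i : Fin 4) (t : Fin 6) (r : Fin 4 → R) (η : R) :
    syntheme ((-4 : R) • kummer r - η ^ 2 • node (diagNode i)) (diagSynthemes i t) =
      synthemeRoot i r η (diagSynthemes i t) ^ 2 := by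
  have h (u : Fin 3) : singularForm ((-4 : R) • kummer r - η ^ 2 • node (diagNode i))
      (synthemeForms (diagSynthemes i t) u) =
      -4 * formConst (synthemeForms (diagSynthemes i t) u) *
        ∏ v, quadrics r (formQuadrics (synthemeForms (diagSynthemes i t) u) v) := by
    rw [sub_eq_add_neg, ← neg_smul, singularForm_add, singularForm_smul, singularForm_smul,
      singularForm_diagNode, singularForm_kummer]
    ring
  have hs : (synthemeSign (diagSynthemes i t) : R) *
      ∏ u, (formConst (synthemeForms (diagSynthemes i t) u) : R) = 4 := by
    exact_mod_cast congrArg (Int.cast : ℤ → R) (synthemeSign_mul i t)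
  rw [syntheme, segreCubic_conicParam, Finset.prod_congr rfl fun u _ => h u,
    Finset.prod_mul_distrib, Finset.prod_mul_distrib, synthemeQuadrics_prod, ← quadricProd_eq_prod,
    synthemeRoot]
  simp only [Finset.prod_const, Finset.card_univ, Fintype.card_fin]
  linear_combination (4096 * η ^ 2 * quadricProd r ^ 2 * quadrics r (diagQuadric i) ^ 2 *
    (∏ t_1, quadrics r (synthemeQuadrics (diagSynthemes i t) t_1)) ^ 2) * hs

end Tables

end HeisenbergQuartic

namespace HeisenbergQuartic

/-! ### Singular points of the Kummer quartics and the fibres of `kummer`. -/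

section Kummer

variable {k : Type*} [Field k] [CharZero k]

/-- A coordinate vector off the fundamental quadrics and off the coordinate planes. -/
def GoodPoint (r : Fin 4 → k) : Prop := (∀ j, quadrics r j ≠ 0) ∧ ∀ j, r j ≠ 0

/-- A parameter off the singular hyperplanes and off the hyperplane `B = 0`. -/
def GoodParam (s : Fin 5 → k) : Prop := (∀ j, singularForm s j ≠ 0) ∧ s 1 ≠ 0

/-- The three relations are Euler combinations of the partial derivatives in which B cancels. Each
gives one of C/A, D/A, E/A, and Δ = 0 then gives B², so the sign of B is left open. -/
theorem kummer_of_squares {s : Fin 5 → k} {r : Fin 4 → k} (hA : s 0 ≠ 0) (hB : s 1 ≠ 0)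
    (hΔ : segreCubic s = 0)
    (hu : ∀ i : Fin 4, quadrics r (diagQuadric i) ≠ 0)
    (hC : s 0 * (r 0 ^ 4 + r 1 ^ 4 - r 2 ^ 4 - r 3 ^ 4) +
      s 2 * (r 0 ^ 2 * r 1 ^ 2 - r 2 ^ 2 * r 3 ^ 2) = 0)
    (hD : s 0 * (r 0 ^ 4 + r 2 ^ 4 - r 1 ^ 4 - r 3 ^ 4) +
      s 3 * (r 0 ^ 2 * r 2 ^ 2 - r 1 ^ 2 * r 3 ^ 2) = 0)
    (hE : s 0 * (r 0 ^ 4 + r 3 ^ 4 - r 1 ^ 4 - r 2 ^ 4) +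
      s 4 * (r 0 ^ 2 * r 3 ^ 2 - r 1 ^ 2 * r 2 ^ 2) = 0) :
    GoodPoint r ∧ ∃ c : k, c ≠ 0 ∧ s 0 = c * kummer r 0 ∧ s 2 = c * kummer r 2 ∧
      s 3 = c * kummer r 3 ∧ s 4 = c * kummer r 4 ∧ s 1 ^ 2 = (c * kummer r 1) ^ 2 := by
  have h0 := hu 0
  have h1 := hu 1
  have h2 := hu 2
  have h3 := hu 3
  simp [quadrics, diagQuadric] at h0 h1 h2 h3
  have hV : r 0 ^ 2 * r 1 ^ 2 - r 2 ^ 2 * r 3 ^ 2 ≠ 0 := by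
    intro h
    rw [h, mul_zero, add_zero, mul_eq_zero, or_iff_right hA] at hC
    exact mul_ne_zero h0 h1 (by linear_combination hC + 2 * h)
  have hW : r 0 ^ 2 * r 2 ^ 2 - r 1 ^ 2 * r 3 ^ 2 ≠ 0 := by
    intro h
    rw [h, mul_zero, add_zero, mul_eq_zero, or_iff_right hA] at hD
    exact mul_ne_zero h0 h2 (by linear_combination hD + 2 * h)
  have hT : r 0 ^ 2 * r 3 ^ 2 - r 1 ^ 2 * r 2 ^ 2 ≠ 0 := by
    intro h
    rw [h, mul_zero, add_zero, mul_eq_zero, or_iff_right hA] at hE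
    exact mul_ne_zero h0 h3 (by linear_combination hE + 2 * h)
  have hk0 : kummer r 0 ≠ 0 := by simpa [kummer] using ⟨⟨hV, hW⟩, hT⟩
  set c := s 0 / kummer r 0 with hc
  have hc0 : c ≠ 0 := div_ne_zero hA hk0
  have e0 : s 0 = c * kummer r 0 := by rw [hc]; field_simp
  have e2 : s 2 = c * kummer r 2 := by
    apply mul_right_cancel₀ hV
    rw [e0] at hC
    simp [kummer] at hC ⊢
    linear_combination hC
  have e3 : s 3 = c * kummer r 3 := by
    apply mul_right_cancel₀ hW
    rw [e0] at hD
    simp [kummer] at hD ⊢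
    linear_combination hD
  have e4 : s 4 = c * kummer r 4 := by
    apply mul_right_cancel₀ hT
    rw [e0] at hE
    simp [kummer] at hE ⊢
    linear_combination hE
  have e1 : s 1 ^ 2 = (c * kummer r 1) ^ 2 := by
    apply mul_left_cancel₀ hA
    have hk := segreCubic_kummer r
    rw [segreCubic] at hΔ hk
    rw [e2, e3, e4] at hΔ
    rw [e0] at hΔ ⊢
    linear_combination hΔ - c ^ 3 * hk
  have hk1 : kummer r 1 ≠ 0 := by
    intro h
    rw [h, mul_zero, zero_pow two_ne_zero] at e1
    exact hB (pow_eq_zero_iff two_ne_zero |>.1 e1)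
  refine ⟨⟨fun j => ?_, fun j => ?_⟩, c, hc0, e0, e2, e3, e4, e1⟩
  · have hV' : (r 0 * r 1 + r 2 * r 3) * (r 0 * r 1 - r 2 * r 3) ≠ 0 := by
      convert hV using 1; ring
    have hW' : (r 0 * r 2 + r 1 * r 3) * (r 0 * r 2 - r 1 * r 3) ≠ 0 := by
      convert hW using 1; ring
    have hT' : (r 0 * r 3 + r 1 * r 2) * (r 0 * r 3 - r 1 * r 2) ≠ 0 := by
      convert hT using 1; ring
    fin_cases j
    · exact h0
    · exact h1
    · exact h2
    · exact h3
    · exact left_ne_zero_of_mul hV'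
    · exact right_ne_zero_of_mul hV'
    · exact left_ne_zero_of_mul hW'
    · exact right_ne_zero_of_mul hW'
    · exact left_ne_zero_of_mul hT'
    · exact right_ne_zero_of_mul hT'
  · intro h
    apply hk1
    fin_cases j <;> simp at h <;> simp [kummer, h]

/-- From bcd = 1 the product of the coordinates equals ±r₀⁴. For either sign, r₀ times the first
partial derivative is r₀⁴ times one of the two linear forms assumed nonzero. -/
theorem quarticGrad_ne_zero_of_sq_eq {k : Type*} [Field k] {s : Fin 5 → k} {r : Fin 4 → k} (hr : r ≠ 0)
    (g0 : quarticGrad s r 0 = 0) (b c d : k) (hb : r 1 ^ 2 = b * r 0 ^ 2)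
    (hc : r 2 ^ 2 = c * r 0 ^ 2) (hd : r 3 ^ 2 = d * r 0 ^ 2) (hbcd : b * c * d = 1)
    (hp : 4 * s 0 + s 1 + 2 * (s 2 * b + s 3 * c + s 4 * d) ≠ 0)
    (hm : 4 * s 0 - s 1 + 2 * (s 2 * b + s 3 * c + s 4 * d) ≠ 0) : False := by
  simp [quarticGrad] at g0
  have h4 : (r 0 * r 1 * r 2 * r 3 - r 0 ^ 4) * (r 0 * r 1 * r 2 * r 3 + r 0 ^ 4) = 0 := by
    linear_combination r 0 ^ 2 * (r 2 ^ 2 * r 3 ^ 2 * hb + b * r 0 ^ 2 * r 3 ^ 2 * hc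
      + b * c * r 0 ^ 4 * hd) + r 0 ^ 8 * hbcd
  have h00 : r 0 ^ 4 = 0 := by
    rcases mul_eq_zero.1 h4 with h | h
    · refine (mul_eq_zero.1 ?_).resolve_right hp
      linear_combination r 0 * g0 - s 1 * h
        - 2 * r 0 ^ 2 * (s 2 * hb + s 3 * hc + s 4 * hd)
    · refine (mul_eq_zero.1 ?_).resolve_right hm
      linear_combination r 0 * g0 - s 1 * h
        - 2 * r 0 ^ 2 * (s 2 * hb + s 3 * hc + s 4 * hd)
  have h0 : r 0 = 0 := pow_eq_zero_iff (by norm_num) |>.1 h00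
  rw [h0] at hb hc hd
  apply hr
  ext j
  fin_cases j
  · exact h0
  · simpa using hb
  · simpa using hc
  · simpa using hd

/-- In terms of the diagonal quadrics u₀, …, u₃ the relations say that complementary pairs have
proportional products, with nonzero factors q_±. If one uᵢ vanished, at least three would; that
forces the squared coordinates to be equal up to sign and contradicts p_{±i} ≠ 0. -/
theorem quadrics_ne_zero_of_singular {s : Fin 5 → k} {r : Fin 4 → k}
    (hf : ∀ j, singularForm s j ≠ 0) (hr : r ≠ 0) (g0 : quarticGrad s r 0 = 0)
    (hC : s 0 * (r 0 ^ 4 + r 1 ^ 4 - r 2 ^ 4 - r 3 ^ 4) +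
      s 2 * (r 0 ^ 2 * r 1 ^ 2 - r 2 ^ 2 * r 3 ^ 2) = 0)
    (hD : s 0 * (r 0 ^ 4 + r 2 ^ 4 - r 1 ^ 4 - r 3 ^ 4) +
      s 3 * (r 0 ^ 2 * r 2 ^ 2 - r 1 ^ 2 * r 3 ^ 2) = 0)
    (hE : s 0 * (r 0 ^ 4 + r 3 ^ 4 - r 1 ^ 4 - r 2 ^ 4) +
      s 4 * (r 0 ^ 2 * r 3 ^ 2 - r 1 ^ 2 * r 2 ^ 2) = 0) (i : Fin 4) :
    quadrics r (diagQuadric i) ≠ 0 := by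
  have R1 : qPlusC s * (quadrics r 0 * quadrics r 1) + qMinusC s * (quadrics r 2 * quadrics r 3)
      = 0 := by
    simp [quadrics, qPlusC, qMinusC]; linear_combination 4 * hC
  have R2 : qPlusD s * (quadrics r 0 * quadrics r 2) + qMinusD s * (quadrics r 1 * quadrics r 3)
      = 0 := by
    simp [quadrics, qPlusD, qMinusD]; linear_combination 4 * hD
  have R3 : qPlusE s * (quadrics r 0 * quadrics r 3) + qMinusE s * (quadrics r 1 * quadrics r 2)
      = 0 := by
    simp [quadrics, qPlusE, qMinusE]; linear_combination 4 * hE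
  have f1 : qPlusC s ≠ 0 := hf 1
  have f2 : qMinusC s ≠ 0 := hf 2
  have f3 : qPlusD s ≠ 0 := hf 3
  have f4 : qMinusD s ≠ 0 := hf 4
  have f5 : qPlusE s ≠ 0 := hf 5
  have f6 : qMinusE s ≠ 0 := hf 6
  have c0 : ¬ (quadrics r 1 = 0 ∧ quadrics r 2 = 0 ∧ quadrics r 3 = 0) := by
    rintro ⟨h1, h2, h3⟩
    simp [quadrics] at h1 h2 h3
    refine quarticGrad_ne_zero_of_sq_eq (s := s) hr g0 1 1 1 (by linear_combination (-h2 - h3) / 2) (by linear_combination (-h1 - h3) / 2)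
      (by linear_combination (-h1 - h2) / 2) (by norm_num) ?_ ?_
    · convert hf 7 using 1; simp [singularForm, pPlus0]; ring
    · convert hf 11 using 1; simp [singularForm, pMinus0]; ring
  have c1 : ¬ (quadrics r 0 = 0 ∧ quadrics r 2 = 0 ∧ quadrics r 3 = 0) := by
    rintro ⟨h1, h2, h3⟩
    simp [quadrics] at h1 h2 h3
    refine quarticGrad_ne_zero_of_sq_eq (s := s) hr g0 1 (-1) (-1) (by linear_combination (-h2 - h3) / 2)
      (by linear_combination (h1 + h2) / 2)
      (by linear_combination (h1 + h3) / 2) (by norm_num) ?_ ?_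
    · convert hf 8 using 1; simp [singularForm, pPlus1]; ring
    · convert hf 12 using 1; simp [singularForm, pMinus1]; ring
  have c2 : ¬ (quadrics r 0 = 0 ∧ quadrics r 1 = 0 ∧ quadrics r 3 = 0) := by
    rintro ⟨h1, h2, h3⟩
    simp [quadrics] at h1 h2 h3
    refine quarticGrad_ne_zero_of_sq_eq (s := s) hr g0 (-1) 1 (-1) (by linear_combination (h1 + h2) / 2)
      (by linear_combination (-h2 - h3) / 2)
      (by linear_combination (h1 + h3) / 2) (by norm_num) ?_ ?_
    · convert hf 9 using 1; simp [singularForm, pPlus2]; ring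
    · convert hf 13 using 1; simp [singularForm, pMinus2]; ring
  have c3 : ¬ (quadrics r 0 = 0 ∧ quadrics r 1 = 0 ∧ quadrics r 2 = 0) := by
    rintro ⟨h1, h2, h3⟩
    simp [quadrics] at h1 h2 h3
    refine quarticGrad_ne_zero_of_sq_eq (s := s) hr g0 (-1) (-1) 1 (by linear_combination (h1 + h2) / 2)
      (by linear_combination (h1 + h3) / 2)
      (by linear_combination (-h2 - h3) / 2) (by norm_num) ?_ ?_
    · convert hf 10 using 1; simp [singularForm, pPlus3]; ring
    · convert hf 14 using 1; simp [singularForm, pMinus3]; ring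
  have aux {a b x y : k} (ha : a ≠ 0) (hb : b ≠ 0) (h : a * x + b * y = 0) : x = 0 ↔ y = 0 := by
    constructor
    · rintro rfl; simpa [hb] using h
    · rintro rfl; simpa [ha] using h
  have S1 := aux f1 f2 R1
  have S2 := aux f3 f4 R2
  have S3 := aux f5 f6 R3
  simp only [mul_eq_zero] at S1 S2 S3
  have H : ∀ {p q x y : Prop}, (p ∨ q ↔ x ∨ y) → (p ∨ x ↔ q ∨ y) → (p ∨ y ↔ q ∨ x) →
      ¬ (q ∧ x ∧ y) → ¬ (p ∧ x ∧ y) → ¬ (p ∧ q ∧ y) → ¬ (p ∧ q ∧ x) →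
      ¬ p ∧ ¬ q ∧ ¬ x ∧ ¬ y := by
    intro p q x y
    by_cases p <;> by_cases q <;> by_cases x <;> by_cases y <;> simp_all
  obtain ⟨h0, h1, h2, h3⟩ := H S1 S2 S3 c0 c1 c2 c3
  fin_cases i
  exacts [h0, h1, h2, h3]

theorem goodPoint_of_singular {s : Fin 5 → k} {r : Fin 4 → k} (hs : GoodParam s)
    (hΔ : segreCubic s = 0) (hr : r ≠ 0) (hg : ∀ j, quarticGrad s r j = 0) :
    GoodPoint r ∧ ∃ c : k, c ≠ 0 ∧ s = c • kummer r := by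
  obtain ⟨hf, hB⟩ := hs
  have hA : s 0 ≠ 0 := hf 0
  have g0 := hg 0
  have g1 := hg 1
  have g2 := hg 2
  have g3 := hg 3
  simp [quarticGrad] at g0 g1 g2 g3
  have hC : s 0 * (r 0 ^ 4 + r 1 ^ 4 - r 2 ^ 4 - r 3 ^ 4) +
      s 2 * (r 0 ^ 2 * r 1 ^ 2 - r 2 ^ 2 * r 3 ^ 2) = 0 := by
    linear_combination (r 0 * g0 + r 1 * g1 - r 2 * g2 - r 3 * g3) / 4
  have hD : s 0 * (r 0 ^ 4 + r 2 ^ 4 - r 1 ^ 4 - r 3 ^ 4) +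
      s 3 * (r 0 ^ 2 * r 2 ^ 2 - r 1 ^ 2 * r 3 ^ 2) = 0 := by
    linear_combination (r 0 * g0 + r 2 * g2 - r 1 * g1 - r 3 * g3) / 4
  have hE : s 0 * (r 0 ^ 4 + r 3 ^ 4 - r 1 ^ 4 - r 2 ^ 4) +
      s 4 * (r 0 ^ 2 * r 3 ^ 2 - r 1 ^ 2 * r 2 ^ 2) = 0 := by
    linear_combination (r 0 * g0 + r 3 * g3 - r 1 * g1 - r 2 * g2) / 4
  have hu := quadrics_ne_zero_of_singular hf hr (hg 0) hC hD hE
  obtain ⟨hgood, c, hc, e0, e2, e3, e4, -⟩ := kummer_of_squares hA hB hΔ hu hC hD hE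
  refine ⟨hgood, c, hc, ?_⟩
  -- One partial derivative is enough to fix B including its sign, because r₁r₂r₃ ≠ 0.
  have e1 : s 1 = c * kummer r 1 := by
    have hk := quarticGrad_kummer r 0
    simp only [quarticGrad, Matrix.cons_val_zero] at hk
    rw [e0, e2, e3, e4] at g0
    have h3 : r 1 * r 2 * r 3 ≠ 0 := mul_ne_zero (mul_ne_zero (hgood.2 1) (hgood.2 2)) (hgood.2 3)
    apply mul_right_cancel₀ h3
    linear_combination g0 - c * hk
  ext j
  fin_cases j
  exacts [e0, e1, e2, e3, e4]

theorem exists_kummer [IsAlgClosed k] {s : Fin 5 → k} (hs : GoodParam s)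
    (hΔ : segreCubic s = 0) : ∃ r : Fin 4 → k, s = (-4 : k) • kummer r := by
  obtain ⟨hf, hB⟩ := hs
  have hA : s 0 ≠ 0 := hf 0
  have f1 : qPlusC s ≠ 0 := hf 1
  have f2 : qMinusC s ≠ 0 := hf 2
  have f3 : qPlusD s ≠ 0 := hf 3
  have f4 : qMinusD s ≠ 0 := hf 4
  have f5 : qPlusE s ≠ 0 := hf 5
  have f6 : qMinusE s ≠ 0 := hf 6
  -- The wanted diagonal quadrics, normalized by u₀ = 1, are found by solving the three pair
  -- relations: `u1` and `u2` by square roots, `u3` from the first relation. The squared coordinates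
  -- are signed sums of these, divided by 4.
  obtain ⟨u1, hu1⟩ := IsAlgClosed.exists_pow_nat_eq
    (qPlusD s * qPlusE s / (qMinusD s * qMinusE s)) two_pos
  obtain ⟨u2, hu2⟩ := IsAlgClosed.exists_pow_nat_eq
    (qPlusC s * qPlusE s / (qMinusC s * qMinusE s)) two_pos
  have n1 : u1 ≠ 0 := by rintro rfl; field_simp at hu1; simp_all
  have n2 : u2 ≠ 0 := by rintro rfl; field_simp at hu2; simp_all
  obtain ⟨u3, hu3⟩ : ∃ u3, u3 = -(qPlusC s * u1) / (qMinusC s * u2) := ⟨_, rfl⟩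
  have n3 : u3 ≠ 0 := by rw [hu3]; simp [f1, f2, n1, n2]
  rw [eq_div_iff (mul_ne_zero f4 f6)] at hu1
  rw [eq_div_iff (mul_ne_zero f2 f6)] at hu2
  rw [eq_div_iff (mul_ne_zero f2 n2)] at hu3
  have hq : ∀ x : k, ∃ a, a ^ 2 = x := fun x => IsAlgClosed.exists_pow_nat_eq x two_pos
  obtain ⟨a, ha⟩ := hq ((1 + u1 + u2 + u3) / 4)
  obtain ⟨b, hb⟩ := hq ((1 + u1 - u2 - u3) / 4)
  obtain ⟨c, hc⟩ := hq ((1 - u1 + u2 - u3) / 4)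
  obtain ⟨d, hd⟩ := hq ((1 - u1 - u2 + u3) / 4)
  have R1 : qPlusC s * u1 + qMinusC s * (u2 * u3) = 0 := by linear_combination hu3
  have R2 : qPlusD s * u2 + qMinusD s * (u1 * u3) = 0 := by
    have : qMinusC s * qMinusE s * u2 ≠ 0 := by simp [f2, f6, n2]
    apply mul_left_cancel₀ this
    linear_combination qPlusD s * hu2 - qPlusC s * hu1 + qMinusD s * u1 * qMinusE s * hu3
  have R3 : qPlusE s * u3 + qMinusE s * (u1 * u2) = 0 := by
    have : qMinusC s * u2 ≠ 0 := by simp [f2, n2]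
    apply mul_left_cancel₀ this
    linear_combination u1 * hu2 + qPlusE s * hu3
  simp only [qPlusC, qMinusC, qPlusD, qMinusD, qPlusE, qMinusE] at R1 R2 R3
  obtain ⟨hgood, κ, hκ, e0, e2, e3, e4, e1⟩ := kummer_of_squares (r := ![a, b, c, d]) hA hB hΔ
    (by
      intro i
      fin_cases i
      · have : a ^ 2 + b ^ 2 + c ^ 2 + d ^ 2 = 1 := by rw [ha, hb, hc, hd]; ring
        simp [quadrics, diagQuadric, this]
      · have : a ^ 2 + b ^ 2 - c ^ 2 - d ^ 2 = u1 := by rw [ha, hb, hc, hd]; ring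
        simp [quadrics, diagQuadric, this, n1]
      · have : a ^ 2 - b ^ 2 + c ^ 2 - d ^ 2 = u2 := by rw [ha, hb, hc, hd]; ring
        simp [quadrics, diagQuadric, this, n2]
      · have : a ^ 2 - b ^ 2 - c ^ 2 + d ^ 2 = u3 := by rw [ha, hb, hc, hd]; ring
        simp [quadrics, diagQuadric, this, n3])
    (by
      simp only [show ∀ x : k, x ^ 4 = (x ^ 2) ^ 2 from fun x => by ring, Matrix.cons_val]
      rw [ha, hb, hc, hd]
      linear_combination R1 / 4)
    (by
      simp only [show ∀ x : k, x ^ 4 = (x ^ 2) ^ 2 from fun x => by ring, Matrix.cons_val]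
      rw [ha, hb, hc, hd]
      linear_combination R2 / 4)
    (by
      simp only [show ∀ x : k, x ^ 4 = (x ^ 2) ^ 2 from fun x => by ring, Matrix.cons_val]
      rw [ha, hb, hc, hd]
      linear_combination R3 / 4)
  obtain ⟨r, hr⟩ : ∃ r : Fin 4 → k, s = κ • kummer r := by
    rcases sq_eq_sq_iff_eq_or_eq_neg.1 e1 with h | h
    · refine ⟨![a, b, c, d], ?_⟩
      ext j
      fin_cases j
      exacts [e0, h, e2, e3, e4]
    -- Negating one coordinate changes the sign of B and nothing else.
    · refine ⟨![-a, b, c, d], ?_⟩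
      ext j
      fin_cases j
      · simp [e0, kummer]
      · simp [h, kummer]
      · simp [e2, kummer, (by decide : Even 4).neg_pow]
      · simp [e3, kummer, (by decide : Even 4).neg_pow]
      · simp [e4, kummer, (by decide : Even 4).neg_pow]
  obtain ⟨t, ht⟩ := IsAlgClosed.exists_pow_nat_eq (-κ / 4) (n := 12) (by norm_num)
  refine ⟨t • r, ?_⟩
  rw [hr, kummer_smul, ht, smul_smul]
  congr 1
  ring

/-- The diagonal quadrics determine the squared coordinates. The A-coordinate of `kummer` gives t¹²
= 1, and the B-coordinate fixes the product of the coordinates, which leaves an even number of sign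
changes: up to a global sign, one of the four vectors `sgn l`. -/
theorem heis_of_quadrics_eq {r r' : Fin 4 → k} (hr : GoodPoint r)
    (hk : kummer r' = kummer r) {c : k} [IsAlgClosed k]
    (hu : ∀ i : Fin 4, quadrics r' (diagQuadric i) = c * quadrics r (diagQuadric i)) :
    ∃ (l : Fin 4) (t : k), t ^ 12 = 1 ∧ r' = t • heis 0 l r := by
  have h0 := hu 0
  have h1 := hu 1
  have h2 := hu 2
  have h3 := hu 3
  simp [quadrics, diagQuadric] at h0 h1 h2 h3
  obtain ⟨t, rfl⟩ := IsAlgClosed.exists_pow_nat_eq c two_pos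
  have e0 : r' 0 ^ 2 = (t * r 0) ^ 2 := by linear_combination (h0 + h1 + h2 + h3) / 4
  have e1 : r' 1 ^ 2 = (t * r 1) ^ 2 := by linear_combination (h0 + h1 - h2 - h3) / 4
  have e2 : r' 2 ^ 2 = (t * r 2) ^ 2 := by linear_combination (h0 - h1 + h2 - h3) / 4
  have e3 : r' 3 ^ 2 = (t * r 3) ^ 2 := by linear_combination (h0 - h1 - h2 + h3) / 4
  have k0 := congrFun hk 0
  have k1 := congrFun hk 1
  have n0 : kummer r 0 ≠ 0 := by
    have := singularForm_kummer r 0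
    change kummer r 0 = _ at this
    rw [this]
    exact mul_ne_zero (by simp [formConst]) (Finset.prod_ne_zero_iff.2 fun _ _ => hr.1 _)
  have ht : t ^ 12 = 1 := by
    apply mul_right_cancel₀ n0
    rw [one_mul]
    conv_rhs => rw [← k0]
    simp only [kummer, Matrix.cons_val_zero]
    rw [e0, e1, e2, e3]
    ring
  have hp : r' 0 * r' 1 * r' 2 * r' 3 * t ^ 8 = r 0 * r 1 * r 2 * r 3 := by
    have n : 2 * (quadrics r 0 * quadrics r 1 * quadrics r 2 * quadrics r 3) ≠ 0 :=
      mul_ne_zero two_ne_zero (by simp [hr.1])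
    apply mul_right_cancel₀ n
    change 2 * (r' 0 * r' 1 * r' 2 * r' 3) *
        ((r' 0 ^ 2 + r' 1 ^ 2 + r' 2 ^ 2 + r' 3 ^ 2) * (r' 0 ^ 2 + r' 1 ^ 2 - r' 2 ^ 2 - r' 3 ^ 2) *
        (r' 0 ^ 2 - r' 1 ^ 2 + r' 2 ^ 2 - r' 3 ^ 2) * (r' 0 ^ 2 - r' 1 ^ 2 - r' 2 ^ 2 + r' 3 ^ 2)) =
      2 * (r 0 * r 1 * r 2 * r 3) *
        (quadrics r 0 * quadrics r 1 * quadrics r 2 * quadrics r 3) at k1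
    rw [h0, h1, h2, h3] at k1
    change r' 0 * r' 1 * r' 2 * r' 3 * t ^ 8 *
      (2 * ((r 0 ^ 2 + r 1 ^ 2 + r 2 ^ 2 + r 3 ^ 2) * (r 0 ^ 2 + r 1 ^ 2 - r 2 ^ 2 - r 3 ^ 2) *
        (r 0 ^ 2 - r 1 ^ 2 + r 2 ^ 2 - r 3 ^ 2) * (r 0 ^ 2 - r 1 ^ 2 - r 2 ^ 2 + r 3 ^ 2))) = _
    linear_combination k1
  have hp' : r' 0 * r' 1 * r' 2 * r' 3 = t ^ 4 * (r 0 * r 1 * r 2 * r 3) := by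
    linear_combination t ^ 4 * hp - r' 0 * r' 1 * r' 2 * r' 3 * ht
  have hn : t ^ 4 * (r 0 * r 1 * r 2 * r 3) ≠ 0 := by
    have : t ≠ 0 := by rintro rfl; simp at ht
    simp [this, hr.2]
  have hn' : t ^ 4 * (r 0 * r 1 * r 2 * r 3) ≠ -(t ^ 4 * (r 0 * r 1 * r 2 * r 3)) :=
    self_ne_neg.2 hn
  have hvec (l : Fin 4) (t' : k) (a0 : r' 0 = t' * (sgn l 0 * r 0))
      (a1 : r' 1 = t' * (sgn l 1 * r 1)) (a2 : r' 2 = t' * (sgn l 2 * r 2))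
      (a3 : r' 3 = t' * (sgn l 3 * r 3)) : r' = t' • heis 0 l r := by
    ext j
    fin_cases j
    exacts [a0, a1, a2, a3]
  have ht' : (-t) ^ 12 = 1 := by rw [← ht]; ring
  rcases sq_eq_sq_iff_eq_or_eq_neg.1 e0 with a0 | a0 <;>
  rcases sq_eq_sq_iff_eq_or_eq_neg.1 e1 with a1 | a1 <;>
  rcases sq_eq_sq_iff_eq_or_eq_neg.1 e2 with a2 | a2 <;>
  rcases sq_eq_sq_iff_eq_or_eq_neg.1 e3 with a3 | a3 <;>
  rw [a0, a1, a2, a3] at hp' <;>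
  first
  | (exfalso; apply hn'; linear_combination -hp')
  | (refine ⟨0, t, ht, hvec _ _ ?_ ?_ ?_ ?_⟩ <;> simp [sgn, a0, a1, a2, a3]; done)
  | (refine ⟨0, -t, ht', hvec _ _ ?_ ?_ ?_ ?_⟩ <;> simp [sgn, a0, a1, a2, a3]; done)
  | (refine ⟨1, t, ht, hvec _ _ ?_ ?_ ?_ ?_⟩ <;> simp [sgn, a0, a1, a2, a3]; done)
  | (refine ⟨1, -t, ht', hvec _ _ ?_ ?_ ?_ ?_⟩ <;> simp [sgn, a0, a1, a2, a3]; done)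
  | (refine ⟨2, t, ht, hvec _ _ ?_ ?_ ?_ ?_⟩ <;> simp [sgn, a0, a1, a2, a3]; done)
  | (refine ⟨2, -t, ht', hvec _ _ ?_ ?_ ?_ ?_⟩ <;> simp [sgn, a0, a1, a2, a3]; done)
  | (refine ⟨3, t, ht, hvec _ _ ?_ ?_ ?_ ?_⟩ <;> simp [sgn, a0, a1, a2, a3]; done)
  | (refine ⟨3, -t, ht', hvec _ _ ?_ ?_ ?_ ?_⟩ <;> simp [sgn, a0, a1, a2, a3])

theorem goodPoint_heis {r : Fin 4 → k} (hr : GoodPoint r) (a b : Fin 4) :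
    GoodPoint (heis a b r) := by
  have h1 : ∀ j a b, chi j a b ≠ 0 := by decide
  have h2 : ∀ l j, sgn l j ≠ 0 := by decide
  refine ⟨fun j => ?_, fun j => ?_⟩
  · rw [quadrics_heis]
    exact mul_ne_zero (Int.cast_ne_zero.2 (h1 _ _ _)) (hr.1 j)
  · exact mul_ne_zero (Int.cast_ne_zero.2 (h2 _ _)) (hr.2 _)

/-- The forms q_± have the same values at both points, hence the ratios u₀u₁ : u₂u₃, u₀u₂ : u₁u₃ and
u₀u₃ : u₁u₂ agree. So the diagonal quadrics agree up to a common factor and an even number of signs.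
A Heisenberg permutation realizes these signs, and the sign vectors account for the rest. -/
theorem exists_heis [IsAlgClosed k] {r r' : Fin 4 → k} (hr : GoodPoint r) (hr' : GoodPoint r')
    (hk : kummer r' = kummer r) :
    ∃ (a b : Fin 4) (t : k), t ^ 12 = 1 ∧ r' = t • heis a b r := by
  have hf (j : Fin 15) : ∏ t, quadrics r' (formQuadrics j t) =
      ∏ t, quadrics r (formQuadrics j t) := by
    have h := singularForm_kummer r' j
    rw [hk, singularForm_kummer] at h
    have h0 : ∀ j, formConst j ≠ 0 := by decide
    exact (mul_left_cancel₀ (Int.cast_ne_zero.2 (h0 j)) h).symm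
  have f1 := hf 1
  have f2 := hf 2
  have f3 := hf 3
  have f4 := hf 4
  have f5 := hf 5
  have f6 := hf 6
  have e6 (q : Fin 10 → k) (v : Fin 6 → Fin 10) : ∏ t, q (v t) =
      q (v 0) * (q (v 1) * ((q (v 2) * q (v 3)) * (q (v 4) * q (v 5)))) := by
    rw [Fin.prod_univ_six]; ring
  simp only [e6, formQuadrics, Matrix.cons_val] at f1 f2 f3 f4 f5 f6
  have H := hr.1
  have H' := hr'.1
  have ratio {x y z w m x' y' z' w' m' : k} (hm : m ≠ 0) (hm' : m' ≠ 0)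
      (h1 : x * (y * m) = x' * (y' * m')) (h2 : z * (w * m) = z' * (w' * m')) :
      x * y * (z' * w') = x' * y' * (z * w) := by
    apply mul_right_cancel₀ (mul_ne_zero hm hm')
    linear_combination z' * w' * m' * h1 - x' * y' * m' * h2
  have m1 := ratio (by simp [H']) (by simp [H]) f1 f2
  have m2 := ratio (by simp [H']) (by simp [H]) f3 f4
  have m3 := ratio (by simp [H']) (by simp [H]) f5 f6
  obtain ⟨c, hc⟩ : ∃ c, c = quadrics r' 0 / quadrics r 0 := ⟨_, rfl⟩
  rw [eq_div_iff (H 0)] at hc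
  have hc0 : c ≠ 0 := by rintro rfl; exact H' 0 (by rw [← hc, zero_mul])
  have key {x y z x' y' z' u u' : k} (hx : x ≠ 0) (hx' : x' ≠ 0) (hy : y ≠ 0) (hy' : y' ≠ 0)
      (hu : u ≠ 0) (hc : c * u = u') (hc0 : c ≠ 0)
      (h1 : y' * z' * (u * x) = y * z * (u' * x'))
      (h2 : x' * z' * (u * y) = x * z * (u' * y')) : z' = c * z ∨ z' = -(c * z) := by
    apply sq_eq_sq_iff_eq_or_eq_neg.1
    apply mul_left_cancel₀ (mul_ne_zero (mul_ne_zero hu hu) (mul_ne_zero (mul_ne_zero hx hx')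
      (mul_ne_zero hy hy')))
    subst hc
    linear_combination x' * z' * u * y * h1 + y * z * c * u * x' * h2
  have k2 : quadrics r' 2 = c * quadrics r 2 ∨ quadrics r' 2 = -(c * quadrics r 2) :=
    key (H 1) (H' 1) (H 3) (H' 3) (H 0) hc hc0 (by linear_combination m1) (by linear_combination m3)
  have k1 : quadrics r' 1 = c * quadrics r 1 ∨ quadrics r' 1 = -(c * quadrics r 1) :=
    key (H 2) (H' 2) (H 3) (H' 3) (H 0) hc hc0 (by linear_combination m2) (by linear_combination m3)
  have fin (a : Fin 4) (h1 : quadrics r' 1 = c * (sgn 1 a * quadrics r 1))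
      (h2 : quadrics r' 2 = c * (sgn 2 a * quadrics r 2))
      (h3 : quadrics r' 3 = c * (sgn 3 a * quadrics r 3)) :
      ∃ (a b : Fin 4) (t : k), t ^ 12 = 1 ∧ r' = t • heis a b r := by
    obtain ⟨l, t, ht, h⟩ := heis_of_quadrics_eq (goodPoint_heis hr a 0)
      (by rw [hk, kummer_heis]) (c := c) (by
        intro i
        rw [quadrics_heis]
        fin_cases i
        · have h0 : ∀ a, sgn 0 a = 1 := by decide
          simpa [chi, diagQuadric, h0] using hc.symm
        · simpa [chi, diagQuadric] using h1
        · simpa [chi, diagQuadric] using h2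
        · simpa [chi, diagQuadric] using h3)
    refine ⟨a, l, t, ht, ?_⟩
    rw [h]
    congr 1
    have h0 : ∀ j, sgn 0 j = 1 := by decide
    have h1 : ∀ j, kleinPerm 0 j = j := by decide
    ext j
    simp [heis, h0, h1]
  have h3 (σ : k) (h : quadrics r' 1 * quadrics r' 2 = c * c * σ * (quadrics r 1 * quadrics r 2)) :
      quadrics r' 3 = c * (σ * quadrics r 3) := by
    have : c * quadrics r 1 * quadrics r 2 * quadrics r 0 ≠ 0 := by simp [hc0, H]
    apply mul_left_cancel₀ this
    rw [h, ← hc] at m3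
    linear_combination -m3
  rcases k1 with k1 | k1 <;> rcases k2 with k2 | k2
  · exact fin 0 (by simp [sgn, k1]) (by simp [sgn, k2]) (h3 _ (by rw [k1, k2]; simp [sgn]; ring))
  · exact fin 1 (by simp [sgn, k1]) (by simp [sgn, k2]) (h3 _ (by rw [k1, k2]; simp [sgn]; ring))
  · exact fin 2 (by simp [sgn, k1]) (by simp [sgn, k2]) (h3 _ (by rw [k1, k2]; simp [sgn]; ring))
  · exact fin 3 (by simp [sgn, k1]) (by simp [sgn, k2]) (h3 _ (by rw [k1, k2]; simp [sgn]; ring))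

end Kummer

end HeisenbergQuartic

namespace HeisenbergQuartic

/-! ### Smooth plane conics in projective 3-space over an algebraically closed field. -/

section SmoothConics

open Matrix

variable {k : Type*} [Field k]

theorem eval_smul_of_isHomogeneous {n d : ℕ} {F : MvPolynomial (Fin n) k} (hF : F.IsHomogeneous d)
    (a : k) (v : Fin n → k) :
    MvPolynomial.eval (a • v) F = a ^ d * MvPolynomial.eval v F := by
  rw [MvPolynomial.eval_eq, MvPolynomial.eval_eq, Finset.mul_sum]
  refine Finset.sum_congr rfl fun e he => ?_
  simp only [Pi.smul_apply, smul_eq_mul, mul_pow, Finset.prod_mul_distrib,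
    Finset.prod_pow_eq_pow_sum, hF.degree_eq_sum_deg_support he]
  ring

theorem eval_rep_eq_zero_iff {F : MvPolynomial (Fin 4) k} {d : ℕ} (hF : F.IsHomogeneous d)
    (v : Fin 4 → k) (hv : v ≠ 0) :
    MvPolynomial.eval (Projectivization.mk k v hv).rep F = 0 ↔ MvPolynomial.eval v F = 0 := by
  obtain ⟨a, ha⟩ := Projectivization.exists_smul_eq_mk_rep k v hv
  rw [← ha, Units.smul_def, eval_smul_of_isHomogeneous hF, mul_eq_zero,
    or_iff_right (pow_ne_zero _ a.ne_zero)]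

theorem mk_mem_zeroLocus {S : Set (MvPolynomial (Fin 4) k)} (hS : ∀ F ∈ S, ∃ d, F.IsHomogeneous d)
    (v : Fin 4 → k) (hv : v ≠ 0) :
    Projectivization.mk k v hv ∈ zeroLocus S ↔ ∀ F ∈ S, MvPolynomial.eval v F = 0 := by
  refine forall₂_congr fun F hF => ?_
  obtain ⟨d, hd⟩ := hS F hF
  exact eval_rep_eq_zero_iff hd v hv

theorem eval_dualForm (r v : Fin 4 → k) : MvPolynomial.eval v (dualForm r) = r ⬝ᵥ v := by
  simp [dualForm, dotProduct]

theorem dualForm_isHomogeneous (r : Fin 4 → k) : (dualForm r).IsHomogeneous 1 := by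
  refine MvPolynomial.IsHomogeneous.sum _ _ _ fun j _ => ?_
  exact (MvPolynomial.isHomogeneous_C_mul_X _ _)

theorem quartic_isHomogeneous (p : Fin 5 → k) : (quartic p).IsHomogeneous 4 := by
  have X (i : Fin 4) := MvPolynomial.isHomogeneous_X k i
  have C (c : k) := MvPolynomial.isHomogeneous_C (Fin 4) c
  refine ((((?_ : MvPolynomial.IsHomogeneous _ 4).add ?_).add ?_).add ?_).add ?_
  · simpa using (C (p 0)).mul (((((X 0).pow 4).add ((X 1).pow 4)).add ((X 2).pow 4)).add ((X 3).pow 4))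
  · simpa using (C (p 1)).mul ((((X 0).mul (X 1)).mul (X 2)).mul (X 3))
  · simpa using (C (p 2)).mul ((((X 0).pow 2).mul ((X 1).pow 2)).add (((X 2).pow 2).mul ((X 3).pow 2)))
  · simpa using (C (p 3)).mul ((((X 0).pow 2).mul ((X 2).pow 2)).add (((X 1).pow 2).mul ((X 3).pow 2)))
  · simpa using (C (p 4)).mul ((((X 0).pow 2).mul ((X 3).pow 2)).add (((X 1).pow 2).mul ((X 2).pow 2)))

theorem pderiv_pderiv_comm (i j : Fin 4) (F : MvPolynomial (Fin 4) k) :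
    MvPolynomial.pderiv i (MvPolynomial.pderiv j F) =
      MvPolynomial.pderiv j (MvPolynomial.pderiv i F) := by
  have : ⁅MvPolynomial.pderiv (R := k) i, MvPolynomial.pderiv (R := k) j⁆ = 0 := by
    refine MvPolynomial.derivation_ext fun l => ?_
    simp [Derivation.commutator_apply, MvPolynomial.pderiv_X, Pi.single_apply, apply_ite]
  have h := congrArg (fun D => D F) this
  simpa [Derivation.commutator_apply, sub_eq_zero] using h

/-- The set of points of the plane dual to `r` at which the quadratic form with matrix `q`
vanishes. -/
def conicSet (r : Fin 4 → k) (q : Matrix (Fin 4) (Fin 4) k) : Set (ℙ k (Fin 4 → k)) :=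
  {x | r ⬝ᵥ x.rep = 0 ∧ x.rep ⬝ᵥ q *ᵥ x.rep = 0}

/-- The quadratic form with matrix `q` cuts out a smooth conic in the plane dual to `r`. -/
def IsSmoothPair (r : Fin 4 → k) (q : Matrix (Fin 4) (Fin 4) k) : Prop :=
  ∀ v : Fin 4 → k, v ≠ 0 → r ⬝ᵥ v = 0 → v ⬝ᵥ q *ᵥ v = 0 → LinearIndependent k ![r, q *ᵥ v]

theorem mk_mem_conicSet (r : Fin 4 → k) (q : Matrix (Fin 4) (Fin 4) k) (v : Fin 4 → k)
    (hv : v ≠ 0) : Projectivization.mk k v hv ∈ conicSet r q ↔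
      r ⬝ᵥ v = 0 ∧ v ⬝ᵥ q *ᵥ v = 0 := by
  obtain ⟨a, ha⟩ := Projectivization.exists_smul_eq_mk_rep k v hv
  simp only [conicSet, Set.mem_ofPred_eq, ← ha]
  simp [Units.smul_def, mulVec_smul]

/-- The quadratic form with matrix `q`. -/
noncomputable def matrixForm (q : Matrix (Fin 4) (Fin 4) k) : MvPolynomial (Fin 4) k :=
  ∑ i, ∑ j, MvPolynomial.C (q i j) * (MvPolynomial.X i * MvPolynomial.X j)

theorem matrixForm_isHomogeneous (q : Matrix (Fin 4) (Fin 4) k) :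
    (matrixForm q).IsHomogeneous 2 := by
  refine MvPolynomial.IsHomogeneous.sum _ _ _ fun i _ => MvPolynomial.IsHomogeneous.sum _ _ _
    fun j _ => ?_
  simpa using (MvPolynomial.isHomogeneous_C (Fin 4) (q i j)).mul
    ((MvPolynomial.isHomogeneous_X k i).mul (MvPolynomial.isHomogeneous_X k j))

theorem eval_matrixForm (q : Matrix (Fin 4) (Fin 4) k) (v : Fin 4 → k) :
    MvPolynomial.eval v (matrixForm q) = v ⬝ᵥ q *ᵥ v := by
  simp only [matrixForm, map_sum, map_mul, MvPolynomial.eval_C, MvPolynomial.eval_X, dotProduct,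
    mulVec, Finset.mul_sum]
  exact Finset.sum_congr rfl fun i _ => Finset.sum_congr rfl fun j _ => by ring

theorem eval_pderiv_matrixForm (q : Matrix (Fin 4) (Fin 4) k) (hq : qᵀ = q) (v : Fin 4 → k)
    (l : Fin 4) : MvPolynomial.eval v (MvPolynomial.pderiv l (matrixForm q)) =
      2 * (q *ᵥ v) l := by
  have h (i j : Fin 4) : MvPolynomial.eval v (MvPolynomial.pderiv l
      (MvPolynomial.C (q i j) * (MvPolynomial.X i * MvPolynomial.X j))) =
      (if i = l then q l j * v j else 0) + (if j = l then q l i * v i else 0) := by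
    have hs : q i j = q j i := congrFun (congrFun hq j) i
    simp [MvPolynomial.pderiv_X, Pi.single_apply, Derivation.leibniz]
    split_ifs <;> simp_all
    ring
  simp only [matrixForm, map_sum, h, Finset.sum_add_distrib]
  simp [mulVec, dotProduct, two_mul]

/-- Half the Hessian works: second derivatives of a quadratic form are constants, and Euler's
relation recovers the form and its gradient. -/
theorem exists_matrixForm [CharZero k] {Q : MvPolynomial (Fin 4) k} (hQ : Q.IsHomogeneous 2) :
    ∃ q : Matrix (Fin 4) (Fin 4) k, qᵀ = q ∧ (∀ v, MvPolynomial.eval v Q = v ⬝ᵥ q *ᵥ v) ∧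
      ∀ v j, MvPolynomial.eval v (MvPolynomial.pderiv j Q) = 2 * (q *ᵥ v) j := by
  have h1 (j : Fin 4) : (MvPolynomial.pderiv j Q).IsHomogeneous 1 := hQ.pderiv
  have h0 (i j : Fin 4) : ∃ c : k, MvPolynomial.pderiv i (MvPolynomial.pderiv j Q) =
      MvPolynomial.C c := by
    have : (MvPolynomial.pderiv i (MvPolynomial.pderiv j Q)).IsHomogeneous 0 := (h1 j).pderiv
    rw [← MvPolynomial.totalDegree_zero_iff_isHomogeneous,
      MvPolynomial.totalDegree_eq_zero_iff_eq_C] at this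
    exact ⟨_, this⟩
  choose c hc using h0
  have hp (v : Fin 4 → k) (j : Fin 4) : MvPolynomial.eval v (MvPolynomial.pderiv j Q) =
      ∑ i, v i * c i j := by
    have := congrArg (MvPolynomial.eval v) (h1 j).sum_X_mul_pderiv
    simp [hc] at this
    exact this.symm
  refine ⟨Matrix.of fun j i => c i j / 2, ?_, fun v => ?_, fun v j => ?_⟩
  · ext i j
    have := pderiv_pderiv_comm i j Q
    rw [hc, hc] at this
    simp [MvPolynomial.C_injective _ _ this]
  · have := congrArg (MvPolynomial.eval v) hQ.sum_X_mul_pderiv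
    simp only [map_sum, map_mul, MvPolynomial.eval_X, hp, nsmul_eq_mul, map_natCast] at this
    apply mul_left_cancel₀ (two_ne_zero (α := k))
    push_cast at this
    rw [← this]
    simp only [dotProduct, mulVec, Finset.mul_sum, Matrix.of_apply]
    exact Finset.sum_congr rfl fun i _ => Finset.sum_congr rfl fun j _ => by ring
  · rw [hp]
    simp only [dotProduct, mulVec, Finset.mul_sum, Matrix.of_apply]
    exact Finset.sum_congr rfl fun i _ => by ring

theorem linearIndependent_pair_smul {r w : Fin 4 → k} {a b : k} (ha : a ≠ 0) (hb : b ≠ 0) :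
    LinearIndependent k ![a • r, b • w] ↔ LinearIndependent k ![r, w] := by
  rw [← LinearIndependent.units_smul_iff ![r, w] ![Units.mk0 a ha, Units.mk0 b hb]]
  congr! 1
  ext j
  fin_cases j <;> rfl

theorem isSmoothConicIn_iff [CharZero k] (r : Fin 4 → k) (Z : Set (ℙ k (Fin 4 → k))) :
    IsSmoothConicIn r Z ↔
      ∃ q : Matrix (Fin 4) (Fin 4) k, qᵀ = q ∧ Z = conicSet r q ∧ IsSmoothPair r q := by
  have hz (Q : MvPolynomial (Fin 4) k) (q : Matrix (Fin 4) (Fin 4) k)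
      (h : ∀ v, MvPolynomial.eval v Q = v ⬝ᵥ q *ᵥ v) : zeroLocus {dualForm r, Q} = conicSet r q := by
    ext x
    simp [zeroLocus, conicSet, h, eval_dualForm]
  have hl (Q : MvPolynomial (Fin 4) k) (q : Matrix (Fin 4) (Fin 4) k)
      (h : ∀ v j, MvPolynomial.eval v (MvPolynomial.pderiv j Q) = 2 * (q *ᵥ v) j) :
      (∀ x ∈ conicSet r q, LinearIndependent k
        ![r, fun j => MvPolynomial.eval x.rep (MvPolynomial.pderiv j Q)]) ↔ IsSmoothPair r q := by
    have h2 (v : Fin 4 → k) : (fun j => MvPolynomial.eval v (MvPolynomial.pderiv j Q)) =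
        (2 : k) • (q *ᵥ v) := by
      ext j; simp [h]
    simp only [h2]
    constructor
    · intro hx v hv h1 h3
      obtain ⟨a, ha⟩ := Projectivization.exists_smul_eq_mk_rep k v hv
      have := hx (Projectivization.mk k v hv) ((mk_mem_conicSet r q v hv).2 ⟨h1, h3⟩)
      rw [← ha, Units.smul_def, mulVec_smul, smul_smul, ← one_smul k r,
        linearIndependent_pair_smul one_ne_zero (by simp)] at this
      exact this
    · intro hx x hxc
      rw [← one_smul k r, linearIndependent_pair_smul one_ne_zero two_ne_zero]
      exact hx x.rep x.rep_nonzero hxc.1 hxc.2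
  constructor
  · rintro ⟨Q, hQ, rfl, h⟩
    obtain ⟨q, hq, h1, h2⟩ := exists_matrixForm hQ
    rw [hz Q q h1] at h ⊢
    exact ⟨q, hq, rfl, (hl Q q h2).1 h⟩
  · rintro ⟨q, hq, rfl, h⟩
    exact ⟨matrixForm q, matrixForm_isHomogeneous q, (hz _ q (eval_matrixForm q)).symm,
      (hl _ q (eval_pderiv_matrixForm q hq)).2 h⟩

theorem exists_eq_smul_of_orthogonal {r w : Fin 4 → k} (hr : r ≠ 0)
    (h : ∀ v, r ⬝ᵥ v = 0 → w ⬝ᵥ v = 0) : ∃ c : k, w = c • r := by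
  obtain ⟨j, hj⟩ := Function.ne_iff.1 hr
  refine ⟨w j / r j, ?_⟩
  ext i
  have := h (Pi.single i (r j) - Pi.single j (r i)) (by simp [dotProduct_sub]; ring)
  simp [dotProduct_sub] at this hj
  simp
  field_simp
  linear_combination this

theorem dotProduct_mulVec_comm {q : Matrix (Fin 4) (Fin 4) k} (hq : qᵀ = q) (v w : Fin 4 → k) :
    v ⬝ᵥ q *ᵥ w = w ⬝ᵥ q *ᵥ v := by
  rw [dotProduct_mulVec, ← mulVec_transpose, hq, dotProduct_comm]

/-- Smoothness means that the form is nondegenerate on the plane, so it is a sum of three squares,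
which a square root ι of -1 rewrites as ac - b². The point is the parametrization (t² : t : 1) of
the conic. -/
theorem exists_param [CharZero k] [IsAlgClosed k] {r : Fin 4 → k} (hr : r ≠ 0)
    {q : Matrix (Fin 4) (Fin 4) k} (hq : qᵀ = q) (hs : IsSmoothPair r q) :
    ∃ w : Fin 3 → Fin 4 → k, LinearIndependent k w ∧ (∀ j, r ⬝ᵥ w j = 0) ∧
      (∀ v, r ⬝ᵥ v = 0 → ∃ a b c : k, v = a • w 0 + b • w 1 + c • w 2) ∧
      ∀ a b c : k, (a • w 0 + b • w 1 + c • w 2) ⬝ᵥ q *ᵥ (a • w 0 + b • w 1 + c • w 2) =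
        a * c - b ^ 2 := by
  let f : Module.Dual k (Fin 4 → k) :=
    { toFun := fun v => r ⬝ᵥ v
      map_add' := fun x y => dotProduct_add r x y
      map_smul' := fun c x => by simp }
  have hf : f ≠ 0 := by
    obtain ⟨j, hj⟩ := Function.ne_iff.1 hr
    intro h
    have := LinearMap.congr_fun h (Pi.single j 1)
    simp [f] at this
    exact hj this
  have h3 : Module.finrank k (LinearMap.ker f) = 3 := by
    have := Module.Dual.finrank_ker_add_one_of_ne_zero hf
    simp at this
    omega
  let B : LinearMap.BilinForm k (LinearMap.ker f) :=
    LinearMap.mk₂ k (fun x y => (x : Fin 4 → k) ⬝ᵥ q *ᵥ (y : Fin 4 → k))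
      (fun x y z => by simp) (fun c x y => by simp)
      (fun x y z => by simp [mulVec_add]) (fun c x y => by simp [mulVec_smul])
  have hB (x y : LinearMap.ker f) : B x y = (x : Fin 4 → k) ⬝ᵥ q *ᵥ (y : Fin 4 → k) := rfl
  have : Invertible (2 : k) := invertibleOfNonzero two_ne_zero
  have hsep : (QuadraticMap.associated (R := k) B.toQuadraticMap).SeparatingLeft := by
    intro x hx
    by_contra hx0
    have hxy (y : LinearMap.ker f) : q *ᵥ (x : Fin 4 → k) ⬝ᵥ (y : Fin 4 → k) = 0 := by
      have := hx y
      rw [QuadraticMap.associated_toQuadraticMap, hB, hB, dotProduct_mulVec_comm hq] at this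
      rw [dotProduct_comm]
      simpa using this
    have hx1 : (x : Fin 4 → k) ≠ 0 := fun h => hx0 (Subtype.ext h)
    -- A radical vector lies on the conic and has gradient proportional to `r`, which the Jacobian
    -- criterion excludes.
    have hli := hs x hx1 x.2 (by rw [dotProduct_comm]; exact hxy x)
    obtain ⟨c, hc⟩ := exists_eq_smul_of_orthogonal hr fun v hv => hxy ⟨v, hv⟩
    rw [LinearIndependent.pair_iff' hr] at hli
    exact hli c hc.symm
  have heq := QuadraticForm.equivalent_weightedSumSquares_of_isAlgClosed _ hsep
  rw [h3] at heq
  obtain ⟨e⟩ := heq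
  obtain ⟨ι, hι⟩ := IsAlgClosed.exists_pow_nat_eq (-1 : k) two_pos
  let E : (Fin 3 → k) →ₗ[k] (Fin 4 → k) :=
    (LinearMap.ker f).subtype ∘ₗ (e.symm.toLinearEquiv : (Fin 3 → k) →ₗ[k] LinearMap.ker f)
  have hE (x : Fin 3 → k) : E x ⬝ᵥ q *ᵥ E x = x 0 ^ 2 + x 1 ^ 2 + x 2 ^ 2 := by
    have h : E x ⬝ᵥ q *ᵥ E x = QuadraticMap.weightedSumSquares k (1 : Fin 3 → k) x :=
      e.symm.map_app x
    rw [h]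
    simp [QuadraticMap.weightedSumSquares_apply, Fin.sum_univ_three]
    ring
  have hinj : Function.Injective E :=
    Subtype.val_injective.comp e.symm.toLinearEquiv.injective
  have hcomb (a b c : k) : a • E ![1 / 2, -ι / 2, 0] + b • E ![0, 0, ι] + c • E ![1 / 2, ι / 2, 0]
      = E ![(a + c) / 2, -ι * (a - c) / 2, ι * b] := by
    rw [← map_smul, ← map_smul, ← map_smul, ← map_add, ← map_add]
    congr 1
    ext j
    fin_cases j <;> simp <;> ring
  refine ⟨![E ![1 / 2, -ι / 2, 0], E ![0, 0, ι], E ![1 / 2, ι / 2, 0]], ?_, ?_, ?_, ?_⟩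
  · rw [Fintype.linearIndependent_iff]
    intro g hg
    simp only [Fin.sum_univ_three] at hg
    have h0 := (hcomb (g 0) (g 1) (g 2)).symm.trans hg
    rw [← map_zero E] at h0
    have h1 := hinj h0
    have ι0 : ι ≠ 0 := by rintro rfl; simp at hι
    have e0 := congrFun h1 0
    have e1 := congrFun h1 1
    have e2 := congrFun h1 2
    simp [ι0] at e0 e1 e2
    intro j
    have f0 : g 0 = 0 := by linear_combination (e0 + e1) / 2
    have f2 : g 2 = 0 := by linear_combination (e0 - e1) / 2
    fin_cases j
    exacts [f0, e2, f2]
  · intro j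
    fin_cases j <;> exact (e.symm.toLinearEquiv _).2
  · intro v hv
    let x := e ⟨v, hv⟩
    have hx : E x = v := by
      change ((e.symm (e ⟨v, hv⟩) : LinearMap.ker f) : Fin 4 → k) = v
      simp
    refine ⟨x 0 + ι * x 1, -ι * x 2, x 0 - ι * x 1, ?_⟩
    refine hx.symm.trans (Eq.trans ?_ (hcomb _ _ _).symm)
    congr 1
    ext j
    fin_cases j
    · simp
    · simp; linear_combination (x 1) * hι
    · simp; linear_combination (x 2) * hι
  · intro a b c
    refine (congrArg (fun v => v ⬝ᵥ q *ᵥ v) (hcomb a b c)).trans ?_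
    rw [hE]
    simp
    linear_combination ((a - c) ^ 2 / 4 + b ^ 2) * hι

theorem exists_form_coeffs (w : Fin 3 → Fin 4 → k) (q : Matrix (Fin 4) (Fin 4) k) :
    ∃ g : Fin 6 → k, ∀ a b c : k,
      (a • w 0 + b • w 1 + c • w 2) ⬝ᵥ q *ᵥ (a • w 0 + b • w 1 + c • w 2) =
        g 0 * a ^ 2 + g 1 * (a * b) + g 2 * (a * c) + g 3 * b ^ 2 + g 4 * (b * c) + g 5 * c ^ 2 := by
  refine ⟨![w 0 ⬝ᵥ q *ᵥ w 0, w 0 ⬝ᵥ q *ᵥ w 1 + w 1 ⬝ᵥ q *ᵥ w 0, w 0 ⬝ᵥ q *ᵥ w 2 + w 2 ⬝ᵥ q *ᵥ w 0,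
    w 1 ⬝ᵥ q *ᵥ w 1, w 1 ⬝ᵥ q *ᵥ w 2 + w 2 ⬝ᵥ q *ᵥ w 1, w 2 ⬝ᵥ q *ᵥ w 2], fun a b c => ?_⟩
  simp [mulVec_add, mulVec_smul, dotProduct_add, add_dotProduct]
  ring

theorem exists_form_polynomial (w : Fin 3 → Fin 4 → k) (q : Matrix (Fin 4) (Fin 4) k) :
    ∃ F : Polynomial k, ∀ t : k, F.eval t =
      (t ^ 2 • w 0 + t • w 1 + (1 : k) • w 2) ⬝ᵥ
        q *ᵥ (t ^ 2 • w 0 + t • w 1 + (1 : k) • w 2) := by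
  obtain ⟨g, hg⟩ := exists_form_coeffs w q
  refine ⟨.C (g 0) * .X ^ 4 + .C (g 1) * .X ^ 3 + .C (g 2 + g 3) * .X ^ 2 + .C (g 4) * .X + .C (g 5),
    fun t => ?_⟩
  rw [hg]
  simp
  ring

/-- A quadratic form vanishing along the parametrized conic `a * c = b ^ 2` is a multiple of the
form `a * c - b ^ 2`. -/
theorem exists_form_eq_of_vanishing [CharZero k] (w : Fin 3 → Fin 4 → k)
    (q : Matrix (Fin 4) (Fin 4) k)
    (h : ∀ t : k, (t ^ 2 • w 0 + t • w 1 + (1 : k) • w 2) ⬝ᵥ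
      q *ᵥ (t ^ 2 • w 0 + t • w 1 + (1 : k) • w 2) = 0) :
    ∃ c : k, ∀ x y z : k, (x • w 0 + y • w 1 + z • w 2) ⬝ᵥ q *ᵥ (x • w 0 + y • w 1 + z • w 2) =
      c * (x * z - y ^ 2) := by
  obtain ⟨g, hg⟩ := exists_form_coeffs w q
  simp only [hg] at h ⊢
  refine ⟨g 2, fun x y z => ?_⟩
  -- A polynomial of degree at most four in t is determined by its values at 0, ±1, ±2.
  have e0 := h 0
  have e1 := h 1
  have e2 := h (-1)
  have e3 := h 2
  have e4 := h (-2)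
  have h5 : g 5 = 0 := by linear_combination e0
  have h0 : g 0 = 0 := by
    linear_combination (1 / 24) * (e3 + e4) - (1 / 6) * (e1 + e2) + (1 / 4) * e0
  have h23 : g 2 + g 3 = 0 := by
    linear_combination (1 / 2) * (e1 + e2) - h0 - h5
  have h1 : g 1 = 0 := by
    linear_combination (1 / 12) * (e3 - e4) - (1 / 6) * (e1 - e2)
  have h4 : g 4 = 0 := by
    linear_combination (1 / 2) * (e1 - e2) - h1
  linear_combination x ^ 2 * h0 + x * y * h1 + y ^ 2 * h23 + y * z * h4 + z ^ 2 * h5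

theorem param_ne_zero {w : Fin 3 → Fin 4 → k} (hw : LinearIndependent k w) (t : k) :
    t ^ 2 • w 0 + t • w 1 + (1 : k) • w 2 ≠ 0 := by
  intro h
  have := Fintype.linearIndependent_iff.1 hw ![t ^ 2, t, 1] (by simpa [Fin.sum_univ_three] using h) 2
  simp at this

theorem IsSmoothPair.exists_ne_zero [CharZero k] {r : Fin 4 → k} {q : Matrix (Fin 4) (Fin 4) k} (hq : qᵀ = q)
    (hs : IsSmoothPair r q) {v : Fin 4 → k} (hv : v ≠ 0) (hrv : r ⬝ᵥ v = 0) (hr : r ≠ 0) :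
    ∃ u, r ⬝ᵥ u = 0 ∧ u ⬝ᵥ q *ᵥ u ≠ 0 := by
  by_contra! h
  have hli := hs v hv hrv (h v hrv)
  obtain ⟨c, hc⟩ := exists_eq_smul_of_orthogonal (w := q *ᵥ v) hr fun u hu => by
    have h1 := h (u + v) (by rw [dotProduct_add, hu, hrv, add_zero])
    rw [mulVec_add, dotProduct_add, add_dotProduct, add_dotProduct, h u hu, h v hrv,
      dotProduct_mulVec_comm hq v u] at h1
    rw [dotProduct_comm]
    linear_combination (1 / 2) * h1
  rw [LinearIndependent.pair_iff' hr] at hli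
  exact hli c hc.symm

/-- A smooth conic inside another one in projective 3-space spans the same plane and is given by a
proportional quadratic form. -/
theorem exists_smul_of_conicSet_subset [CharZero k] [IsAlgClosed k] {r r' : Fin 4 → k} (hr : r ≠ 0)
    {q q' : Matrix (Fin 4) (Fin 4) k} (hq : qᵀ = q) (hs : IsSmoothPair r q)
    (h : conicSet r q ⊆ conicSet r' q') :
    (∃ c : k, r' = c • r) ∧ ∃ c : k, ∀ v, r ⬝ᵥ v = 0 → v ⬝ᵥ q' *ᵥ v = c * (v ⬝ᵥ q *ᵥ v) := by
  obtain ⟨w, hw, hwr, hsp, hf⟩ := exists_param hr hq hs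
  have hm (t : k) : r' ⬝ᵥ (t ^ 2 • w 0 + t • w 1 + (1 : k) • w 2) = 0 ∧
      (t ^ 2 • w 0 + t • w 1 + (1 : k) • w 2) ⬝ᵥ
        q' *ᵥ (t ^ 2 • w 0 + t • w 1 + (1 : k) • w 2) = 0 := by
    rw [← mk_mem_conicSet r' q' _ (param_ne_zero hw t)]
    apply h
    rw [mk_mem_conicSet, hf]
    refine ⟨?_, by ring⟩
    simp [dotProduct_add, hwr]
  constructor
  · refine exists_eq_smul_of_orthogonal hr fun v hv => ?_
    obtain ⟨a, b, c, rfl⟩ := hsp v hv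
    have e0 := (hm 0).1
    have e1 := (hm 1).1
    have e2 := (hm (-1)).1
    simp [dotProduct_add] at e0 e1 e2 ⊢
    linear_combination (a / 2) * (e1 + e2) + (b / 2) * (e1 - e2) + (c - a) * e0
  · obtain ⟨c, hc⟩ := exists_form_eq_of_vanishing w q' fun t => (hm t).2
    refine ⟨c, fun v hv => ?_⟩
    obtain ⟨x, y, z, rfl⟩ := hsp v hv
    rw [hf, hc]

theorem conicSet_congr {r : Fin 4 → k} {q q' : Matrix (Fin 4) (Fin 4) k} {c : k} (hc : c ≠ 0)
    (h : ∀ v, r ⬝ᵥ v = 0 → v ⬝ᵥ q' *ᵥ v = c * (v ⬝ᵥ q *ᵥ v)) : conicSet r q' = conicSet r q := by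
  ext x
  simp only [conicSet, Set.mem_ofPred_eq]
  refine and_congr_right fun hx => ?_
  rw [h _ hx, mul_eq_zero, or_iff_right hc]

theorem mk_mem_surface (p : Fin 5 → k) (v : Fin 4 → k) (hv : v ≠ 0) :
    Projectivization.mk k v hv ∈ surface p ↔ quarticVal p v = 0 := by
  rw [surface, mk_mem_zeroLocus]
  · simp [eval_quartic]
  · simpa using ⟨4, quartic_isHomogeneous p⟩

/-- If a quartic surface meets a plane in two smooth conics, these are the only smooth conics in
the intersection. -/
theorem isSmoothConicIn_and_subset_iff [CharZero k] [IsAlgClosed k] {r : Fin 4 → k} (hr : r ≠ 0)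
    {p : Fin 5 → k} {n : k} {q₁ q₂ : Matrix (Fin 4) (Fin 4) k} (hq₁ : q₁ᵀ = q₁) (hq₂ : q₂ᵀ = q₂)
    (hs₁ : IsSmoothPair r q₁) (hs₂ : IsSmoothPair r q₂)
    (hn : n ≠ 0) (h : ∀ v, r ⬝ᵥ v = 0 → n * quarticVal p v = (v ⬝ᵥ q₁ *ᵥ v) * (v ⬝ᵥ q₂ *ᵥ v))
    (Z : Set (ℙ k (Fin 4 → k))) :
    (IsSmoothConicIn r Z ∧ Z ⊆ surface p) ↔ Z = conicSet r q₁ ∨ Z = conicSet r q₂ := by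
  constructor
  · rintro ⟨hZ, hsub⟩
    obtain ⟨q, hq, rfl, hs⟩ := (isSmoothConicIn_iff r Z).1 hZ
    obtain ⟨w, hw, hwr, hsp, hf⟩ := exists_param hr hq hs
    have hr0 (t : k) : r ⬝ᵥ (t ^ 2 • w 0 + t • w 1 + (1 : k) • w 2) = 0 := by
      simp [dotProduct_add, hwr]
    have key (q' : Matrix (Fin 4) (Fin 4) k) (hq' : q'ᵀ = q') (hs' : IsSmoothPair r q')
        (hv : ∀ t : k, (t ^ 2 • w 0 + t • w 1 + (1 : k) • w 2) ⬝ᵥ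
          q' *ᵥ (t ^ 2 • w 0 + t • w 1 + (1 : k) • w 2) = 0) : conicSet r q = conicSet r q' := by
      obtain ⟨c, hc⟩ := exists_form_eq_of_vanishing w q' hv
      have hc' (v : Fin 4 → k) (hv : r ⬝ᵥ v = 0) : v ⬝ᵥ q' *ᵥ v = c * (v ⬝ᵥ q *ᵥ v) := by
        obtain ⟨x, y, z, rfl⟩ := hsp v hv
        rw [hf, hc]
      refine (conicSet_congr ?_ hc').symm
      rintro rfl
      obtain ⟨u, hu, hu'⟩ := hs'.exists_ne_zero hq' (hw.ne_zero 0) (hwr 0) hr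
      exact hu' (by rw [hc' u hu, zero_mul])
    obtain ⟨F₁, hF₁⟩ := exists_form_polynomial w q₁
    obtain ⟨F₂, hF₂⟩ := exists_form_polynomial w q₂
    -- Along the parametrized conic the product of the two forms vanishes identically in t; since
    -- k[t] is a domain, one of them vanishes on the whole conic.
    have hF : F₁ * F₂ = 0 := by
      refine Polynomial.funext fun t => ?_
      rw [Polynomial.eval_mul, hF₁, hF₂, ← h _ (hr0 t), Polynomial.eval_zero, mul_eq_zero,
        or_iff_right hn, ← mk_mem_surface p _ (param_ne_zero hw t)]
      apply hsub
      rw [mk_mem_conicSet, hf]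
      exact ⟨hr0 t, by ring⟩
    rcases mul_eq_zero.1 hF with rfl | rfl
    · exact Or.inl (key q₁ hq₁ hs₁ fun t => by rw [← hF₁]; simp)
    · exact Or.inr (key q₂ hq₂ hs₂ fun t => by rw [← hF₂]; simp)
  · have key (q : Matrix (Fin 4) (Fin 4) k)
        (hv : ∀ v, r ⬝ᵥ v = 0 → v ⬝ᵥ q *ᵥ v = 0 → quarticVal p v = 0) :
        conicSet r q ⊆ surface p := by
      intro x hx
      rw [← x.mk_rep, mk_mem_surface]
      exact hv _ hx.1 hx.2
    rintro (rfl | rfl)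
    · exact ⟨(isSmoothConicIn_iff _ _).2 ⟨q₁, hq₁, rfl, hs₁⟩,
        key q₁ fun v hv h1 => (mul_eq_zero.1 (by rw [h v hv, h1, zero_mul])).resolve_left hn⟩
    · exact ⟨(isSmoothConicIn_iff _ _).2 ⟨q₂, hq₂, rfl, hs₂⟩,
        key q₂ fun v hv h1 => (mul_eq_zero.1 (by rw [h v hv, h1, mul_zero])).resolve_left hn⟩

theorem conicSet_smul {r : Fin 4 → k} {c : k} (hc : c ≠ 0) (q : Matrix (Fin 4) (Fin 4) k) :
    conicSet (c • r) q = conicSet r q := by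
  ext x
  simp [conicSet, hc]

theorem isSmoothConicIn_smul {r : Fin 4 → k} {c : k} (hc : c ≠ 0) (Z : Set (ℙ k (Fin 4 → k))) :
    IsSmoothConicIn (c • r) Z ↔ IsSmoothConicIn r Z := by
  have (Q : MvPolynomial (Fin 4) k) : zeroLocus {dualForm (c • r), Q} = zeroLocus {dualForm r, Q} := by
    ext x
    simp [zeroLocus, eval_dualForm, hc]
  simp only [IsSmoothConicIn, this]
  refine exists_congr fun Q => and_congr_right fun _ => and_congr_right fun _ =>
    forall₂_congr fun x _ => ?_
  conv_lhs => rw [← one_smul k (fun j => MvPolynomial.eval x.rep (MvPolynomial.pderiv j Q))]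
  exact linearIndependent_pair_smul hc one_ne_zero

end SmoothConics

end HeisenbergQuartic

namespace HeisenbergQuartic

/-! ### Diagonal quadratic forms restricted to a plane. -/

section Diagonal

open Matrix

variable {k : Type*} [Field k]

theorem dotProduct_diagonal_mulVec (f v : Fin 4 → k) :
    v ⬝ᵥ diagonal f *ᵥ v = f 0 * v 0 ^ 2 + f 1 * v 1 ^ 2 + f 2 * v 2 ^ 2 + f 3 * v 3 ^ 2 := by
  simp [dotProduct, mulVec_diagonal, Fin.sum_univ_four]
  ring

/-- Makes restriction to the plane injective on diagonal forms, so that the coefficients of a conic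
can be read off from the conic. -/
theorem diagonal_eq_zero_of_plane [CharZero k] {r f : Fin 4 → k} (hr : ∀ j, r j ≠ 0)
    (h : ∀ v, r ⬝ᵥ v = 0 → v ⬝ᵥ diagonal f *ᵥ v = 0) : f = 0 := by
  simp only [dotProduct_diagonal_mulVec] at h
  simp only [dotProduct, Fin.sum_univ_four] at h
  have h01 := h ![r 1, -r 0, 0, 0] (by simp; ring)
  have h02 := h ![r 2, 0, -r 0, 0] (by simp; ring)
  have h03 := h ![r 3, 0, 0, -r 0] (by simp; ring)
  have h12 := h ![0, r 2, -r 1, 0] (by simp; ring)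
  simp at h01 h02 h03 h12
  have h0 := hr 0
  have h1 := hr 1
  have h2 := hr 2
  have h3 := hr 3
  have e0 : f 0 = 0 := by
    have : 2 * (r 1 * r 2) ^ 2 * f 0 = 0 := by
      linear_combination r 2 ^ 2 * h01 + r 1 ^ 2 * h02 - r 0 ^ 2 * h12
    simpa [h1, h2] using this
  ext j
  fin_cases j
  · exact e0
  · simpa [e0, h0] using h01
  · simpa [e0, h0] using h02
  · simpa [e0, h0] using h03

/-- If f_j v_j = c r_j for all j, then r·v = 0 gives c·disc = 0, hence c = 0. A nonzero discriminant
allows at most one f_j to vanish, so `v` is supported on one coordinate, and r·v = 0 makes it zero.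
-/
theorem isSmoothPair_diagonal {r f : Fin 4 → k} (hr : ∀ j, r j ≠ 0)
    (hd : conicDisc (fun j => r j ^ 2) f ≠ 0) : IsSmoothPair r (diagonal f) := by
  intro v hv hrv _
  rw [LinearIndependent.pair_iff' (fun h => hr 0 (congrFun h 0))]
  intro c hc
  have h (j : Fin 4) : c * r j = f j * v j := by
    simpa [mulVec_diagonal] using congrFun hc j
  have h0 := h 0
  have h1 := h 1
  have h2 := h 2
  have h3 := h 3
  simp only [dotProduct, Fin.sum_univ_four] at hrv
  have hcd : c * conicDisc (fun j => r j ^ 2) f = 0 := by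
    simp only [conicDisc]
    linear_combination r 0 * f 1 * f 2 * f 3 * h0 + r 1 * f 0 * f 2 * f 3 * h1 +
      r 2 * f 0 * f 1 * f 3 * h2 + r 3 * f 0 * f 1 * f 2 * h3 + f 0 * f 1 * f 2 * f 3 * hrv
  obtain rfl : c = 0 := (mul_eq_zero.1 hcd).resolve_right hd
  simp only [zero_mul, eq_comm (a := (0 : k)), mul_eq_zero] at h0 h1 h2 h3
  obtain ⟨j, hj⟩ := Function.ne_iff.1 hv
  have hr0 := hr 0
  have hr1 := hr 1
  have hr2 := hr 2
  have hr3 := hr 3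
  clear hc h hcd hr
  fin_cases j <;> simp only [conicDisc] at hd <;> simp at hj
  · simp_all
  · simp_all
  · simp_all
  · simp_all

/-- The trope conic is not the section by the diagonal quadric: sums or differences of two trope
coefficients factor through two fundamental quadrics, so proportionality would make the squared
coordinates equal up to sign and annihilate a fundamental quadric. -/
theorem tropeCoeff_ne_smul_sgn {r : Fin 4 → k} (hr : GoodPoint r) (i : Fin 4) (c : k) :
    ∃ j, tropeCoeff r j ≠ c * (sgn i j : k) := by
  by_contra! h
  have h0 := h 0
  have h1 := h 1
  have h2 := h 2
  have h3 := h 3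
  have u0 := hr.1 0
  have u1 := hr.1 1
  have u2 := hr.1 2
  have u3 := hr.1 3
  fin_cases i <;> simp [tropeCoeff, sgn, quadrics] at h0 h1 h2 h3 u0 u1 u2 u3
  · have a1 : r 0 ^ 2 - r 1 ^ 2 = 0 := by
      apply (mul_eq_zero.1 (_ : (r 0 ^ 2 - r 1 ^ 2) * _ = 0)).resolve_right (mul_ne_zero u0 u1)
      linear_combination h0 - h1
    have a2 : r 0 ^ 2 - r 2 ^ 2 = 0 := by
      apply (mul_eq_zero.1 (_ : (r 0 ^ 2 - r 2 ^ 2) * _ = 0)).resolve_right (mul_ne_zero u0 u2)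
      linear_combination h0 - h2
    have a3 : r 0 ^ 2 - r 3 ^ 2 = 0 := by
      apply (mul_eq_zero.1 (_ : (r 0 ^ 2 - r 3 ^ 2) * _ = 0)).resolve_right (mul_ne_zero u0 u3)
      linear_combination h0 - h3
    exact u1 (by linear_combination a2 + a3 - a1)
  · have a1 : r 0 ^ 2 - r 1 ^ 2 = 0 := by
      apply (mul_eq_zero.1 (_ : (r 0 ^ 2 - r 1 ^ 2) * _ = 0)).resolve_right (mul_ne_zero u0 u1)
      linear_combination h0 - h1
    have a2 : r 0 ^ 2 + r 2 ^ 2 = 0 := by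
      apply (mul_eq_zero.1 (_ : (r 0 ^ 2 + r 2 ^ 2) * _ = 0)).resolve_right (mul_ne_zero u1 u3)
      linear_combination h0 + h2
    have a3 : r 0 ^ 2 + r 3 ^ 2 = 0 := by
      apply (mul_eq_zero.1 (_ : (r 0 ^ 2 + r 3 ^ 2) * _ = 0)).resolve_right (mul_ne_zero u1 u2)
      linear_combination h0 + h3
    exact u0 (by linear_combination a2 + a3 - a1)
  · have a1 : r 0 ^ 2 + r 1 ^ 2 = 0 := by
      apply (mul_eq_zero.1 (_ : (r 0 ^ 2 + r 1 ^ 2) * _ = 0)).resolve_right (mul_ne_zero u2 u3)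
      linear_combination h0 + h1
    have a2 : r 0 ^ 2 - r 2 ^ 2 = 0 := by
      apply (mul_eq_zero.1 (_ : (r 0 ^ 2 - r 2 ^ 2) * _ = 0)).resolve_right (mul_ne_zero u0 u2)
      linear_combination h0 - h2
    have a3 : r 0 ^ 2 + r 3 ^ 2 = 0 := by
      apply (mul_eq_zero.1 (_ : (r 0 ^ 2 + r 3 ^ 2) * _ = 0)).resolve_right (mul_ne_zero u1 u2)
      linear_combination h0 + h3
    exact u0 (by linear_combination a1 - a2 + a3)
  · have a1 : r 0 ^ 2 + r 1 ^ 2 = 0 := by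
      apply (mul_eq_zero.1 (_ : (r 0 ^ 2 + r 1 ^ 2) * _ = 0)).resolve_right (mul_ne_zero u2 u3)
      linear_combination h0 + h1
    have a2 : r 0 ^ 2 + r 2 ^ 2 = 0 := by
      apply (mul_eq_zero.1 (_ : (r 0 ^ 2 + r 2 ^ 2) * _ = 0)).resolve_right (mul_ne_zero u1 u3)
      linear_combination h0 + h2
    have a3 : r 0 ^ 2 - r 3 ^ 2 = 0 := by
      apply (mul_eq_zero.1 (_ : (r 0 ^ 2 - r 3 ^ 2) * _ = 0)).resolve_right (mul_ne_zero u0 u3)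
      linear_combination h0 - h3
    exact u0 (by linear_combination a1 + a2 - a3)

end Diagonal

/-! ### Linear substitutions that move every node to a diagonal one. -/

section Twist

open Matrix

variable {R : Type*} [CommRing R]

/-- Linear maps that carry the ten fundamental quadrics to multiples of each other. -/
def twist (R : Type*) [CommRing R] : Fin 4 → Matrix (Fin 4) (Fin 4) R :=
  ![1, !![1, 1, 0, 0; 1, -1, 0, 0; 0, 0, 1, 1; 0, 0, 1, -1],
    !![1, 0, 1, 0; 0, 1, 0, 1; 1, 0, -1, 0; 0, 1, 0, -1],
    !![1, 0, 0, 1; 0, -1, 1, 0; 0, 1, 1, 0; 1, 0, 0, -1]]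

/-- The scalar that is the square of `twist R τ`. -/
def twistScalar : Fin 4 → ℤ := ![1, 2, 2, 2]

/-- The action of `twist R τ` on the parameters of the quartics. -/
def twistParam (τ : Fin 4) (p : Fin 5 → R) : Fin 5 → R :=
  (![p, ![2 * p 0 + p 2, 8 * p 3 - 8 * p 4, 12 * p 0 - 2 * p 2, p 1 + 2 * p 3 + 2 * p 4,
      -p 1 + 2 * p 3 + 2 * p 4],
    ![2 * p 0 + p 3, 8 * p 2 - 8 * p 4, p 1 + 2 * p 2 + 2 * p 4, 12 * p 0 - 2 * p 3,
      -p 1 + 2 * p 2 + 2 * p 4],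
    ![2 * p 0 + p 4, 8 * p 3 - 8 * p 2, -p 1 + 2 * p 3 + 2 * p 2, p 1 + 2 * p 3 + 2 * p 2,
      12 * p 0 - 2 * p 4]] : Fin 4 → Fin 5 → R) τ

theorem twist_transpose (τ : Fin 4) : (twist R τ)ᵀ = twist R τ := by
  ext i j
  fin_cases τ <;> fin_cases i <;> fin_cases j <;> simp [twist]

theorem twist_mul_self (τ : Fin 4) : twist R τ * twist R τ = (twistScalar τ : R) • 1 := by
  ext i j
  fin_cases τ <;> fin_cases i <;> fin_cases j <;>
    simp [twist, twistScalar, Matrix.mul_apply, Fin.sum_univ_four, Matrix.one_apply] <;> norm_num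

theorem twist_mulVec_zero (v : Fin 4 → R) : twist R 0 *ᵥ v = v := by
  simp [twist]

theorem twist_mulVec_one (v : Fin 4 → R) :
    twist R 1 *ᵥ v = ![v 0 + v 1, v 0 - v 1, v 2 + v 3, v 2 - v 3] := by
  ext j
  fin_cases j <;> simp [twist, mulVec, dotProduct, Fin.sum_univ_four] <;> ring

theorem twist_mulVec_two (v : Fin 4 → R) :
    twist R 2 *ᵥ v = ![v 0 + v 2, v 1 + v 3, v 0 - v 2, v 1 - v 3] := by
  ext j
  fin_cases j <;> simp [twist, mulVec, dotProduct, Fin.sum_univ_four] <;> ring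

theorem twist_mulVec_three (v : Fin 4 → R) :
    twist R 3 *ᵥ v = ![v 0 + v 3, v 2 - v 1, v 1 + v 2, v 0 - v 3] := by
  ext j
  fin_cases j <;> simp [twist, mulVec, dotProduct, Fin.sum_univ_four] <;> ring

theorem quarticVal_twistParam (τ : Fin 4) (p : Fin 5 → R) (v : Fin 4 → R) :
    quarticVal (twistParam τ p) v = quarticVal p (twist R τ *ᵥ v) := by
  fin_cases τ <;>
    simp [twist_mulVec_zero, twist_mulVec_one, twist_mulVec_two, twist_mulVec_three, quarticVal,
      twistParam] <;> ring

/-- The chain rule; the outer matrix is the transpose of the substitution, and `twist` is symmetric.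
-/
theorem quarticGrad_twistParam (τ : Fin 4) (p : Fin 5 → R) (v : Fin 4 → R) :
    quarticGrad (twistParam τ p) v = twist R τ *ᵥ quarticGrad p (twist R τ *ᵥ v) := by
  ext j
  fin_cases τ <;> fin_cases j <;>
    simp [twist_mulVec_zero, twist_mulVec_one, twist_mulVec_two, twist_mulVec_three, quarticGrad,
      twistParam] <;> ring

theorem segreCubic_twistParam (τ : Fin 4) (p : Fin 5 → R) :
    segreCubic (twistParam τ p) = (![1, -64, -64, -64] : Fin 4 → R) τ * segreCubic p := by
  fin_cases τ <;> simp [segreCubic, twistParam] <;> ring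

theorem twistParam_add (τ : Fin 4) (p q : Fin 5 → R) :
    twistParam τ (p + q) = twistParam τ p + twistParam τ q := by
  ext j
  fin_cases τ <;> fin_cases j <;> simp [twistParam] <;> ring

theorem twistParam_smul (τ : Fin 4) (c : R) (p : Fin 5 → R) :
    twistParam τ (c • p) = c • twistParam τ p := by
  ext j
  fin_cases τ <;> fin_cases j <;> simp [twistParam] <;> ring

/-- The twist that makes the quadric of a node diagonal. -/
def nodeTwist : Fin 10 → Fin 4 := ![0, 0, 0, 0, 1, 1, 2, 2, 3, 3]

/-- The index of the diagonal quadric to which the quadric of a node is twisted. -/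
def nodeDiag : Fin 10 → Fin 4 := ![3, 2, 1, 0, 3, 2, 3, 1, 1, 2]

theorem twistParam_node (m : Fin 10) :
    twistParam (nodeTwist m) (node m : Fin 5 → R) = node (diagNode (nodeDiag m)) := by
  ext j
  fin_cases m <;> fin_cases j <;>
    simp [twistParam, node, nodeTwist, diagNode, nodeDiag]

/-- The action of the twists on the synthemes. -/
def twistSyntheme : Fin 4 → Fin 15 → Fin 15 :=
  ![id, ![0, 3, 4, 1, 2, 5, 7, 6, 8, 9, 10, 14, 12, 13, 11],
    ![5, 1, 6, 3, 7, 0, 2, 4, 8, 13, 10, 11, 12, 9, 14],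
    ![8, 7, 2, 6, 4, 5, 3, 1, 0, 12, 10, 11, 9, 13, 14]]

/-- The factors by which the twists change the square roots of the synthemes. -/
def twistFactor : Fin 4 → Fin 15 → ℤ :=
  ![1, ![64, 8, 8, 512, 512, 64, 64, 64, 64, 64, 64, 64, 64, 64, 64],
    ![8, 64, 8, 64, 64, 512, 512, 64, 64, 64, 64, 64, 64, 64, 64],
    ![8, 8, 64, 64, 64, 64, 64, 512, 512, 64, 64, 64, 64, 64, 64]]

-- The factors are perfect squares, so a twist permutes the classes of the fifteen products modulo
-- squares.
set_option maxHeartbeats 1000000 in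
theorem syntheme_twistParam (τ : Fin 4) (p : Fin 5 → R) (j : Fin 15) :
    syntheme (twistParam τ p) j = (twistFactor τ j : R) ^ 2 * syntheme p (twistSyntheme τ j) := by
  simp only [syntheme, segreCubic_twistParam]
  fin_cases τ <;> fin_cases j <;>
    simp [twistFactor, twistSyntheme, synthemeSign, synthemeForms, Fin.prod_univ_three,
      singularForm, qPlusC, qMinusC, qPlusD, qMinusD, qPlusE, qMinusE, pPlus0, pPlus1, pPlus2,
      pPlus3, pMinus0, pMinus1, pMinus2, pMinus3, twistParam] <;> ring

theorem syntheme_castLE (p : Fin 5 → R) (j : Fin 10) :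
    syntheme p (Fin.castLE (by norm_num) j) = radicand p j := by
  fin_cases j <;>
    simp [syntheme, radicand, synthemeSign, synthemeForms, Fin.prod_univ_three, singularForm] <;>
    ring

end Twist

end HeisenbergQuartic

namespace HeisenbergQuartic

/-! ### Coordinates (r, η) for the conics, and their number. -/

section TwistedConics

open Matrix

variable {k : Type*} [Field k]

/-- The conic on the quartic surface attached to the `m`-th node, a singular point `r` of the
twisted Kummer surface and a square root `η` of the multiple of the node in the pencil. -/
def twistedConic (m : Fin 10) (r : Fin 4 → k) (η : k) : Set (ℙ k (Fin 4 → k)) :=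
  conicSet (twist k (nodeTwist m) *ᵥ r)
    (twist k (nodeTwist m) * diagonal (conicCoeff (nodeDiag m) r η) * twist k (nodeTwist m))

/-- The coordinates `r`, `η` describe a plane section of `X_p` that is attached to the `m`-th
node and splits into two conics. -/
structure IsBase (m : Fin 10) (p : Fin 5 → k) (r : Fin 4 → k) (η : k) : Prop where
  good : GoodPoint r
  ne_zero : η ≠ 0
  eq : twistParam (nodeTwist m) p = (-4 : k) • kummer r - η ^ 2 • node (diagNode (nodeDiag m))

/-- The genericity conditions on the parameter of the quartic surface. -/
structure IsGeneric (p : Fin 5 → k) : Prop where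
  segreCubic_ne_zero : segreCubic p ≠ 0
  singularForm_ne_zero : ∀ j, singularForm p j ≠ 0
  segrePolar_ne_zero : ∀ m, segrePolar m p ≠ 0
  goodParam : ∀ m s, IsThirdPoint p m s → GoodParam s
  goodParam_twist : ∀ m s, IsThirdPoint p m s → GoodParam (twistParam (nodeTwist m) s)
  nieto_ne_zero : ∀ m, nieto (twistParam (nodeTwist m) p) ≠ 0

theorem twistScalar_ne_zero [CharZero k] (τ : Fin 4) : (twistScalar τ : k) ≠ 0 := by
  rw [Int.cast_ne_zero]
  revert τ; decide

theorem twist_mulVec_twist_mulVec (τ : Fin 4) (v : Fin 4 → k) :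
    twist k τ *ᵥ (twist k τ *ᵥ v) = (twistScalar τ : k) • v := by
  rw [mulVec_mulVec, twist_mul_self, smul_mulVec, one_mulVec]

theorem twist_dotProduct (τ : Fin 4) (v w : Fin 4 → k) :
    (twist k τ *ᵥ v) ⬝ᵥ w = v ⬝ᵥ twist k τ *ᵥ w := by
  rw [dotProduct_mulVec, ← mulVec_transpose, twist_transpose]

theorem twist_form (τ : Fin 4) (q : Matrix (Fin 4) (Fin 4) k) (v : Fin 4 → k) :
    v ⬝ᵥ (twist k τ * q * twist k τ) *ᵥ v = (twist k τ *ᵥ v) ⬝ᵥ q *ᵥ (twist k τ *ᵥ v) := by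
  rw [twist_dotProduct, mulVec_mulVec, mulVec_mulVec]

theorem twist_mulVec_ne_zero [CharZero k] (τ : Fin 4) {v : Fin 4 → k} (hv : v ≠ 0) :
    twist k τ *ᵥ v ≠ 0 := by
  intro h
  have := twist_mulVec_twist_mulVec τ v
  rw [h, mulVec_zero, eq_comm, smul_eq_zero] at this
  exact this.elim (twistScalar_ne_zero τ) hv

theorem exists_twist_mulVec_eq [CharZero k] (τ : Fin 4) (v : Fin 4 → k) :
    ∃ w, twist k τ *ᵥ w = v :=
  ⟨(twistScalar τ : k)⁻¹ • (twist k τ *ᵥ v), by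
    rw [mulVec_smul, twist_mulVec_twist_mulVec, inv_smul_smul₀ (twistScalar_ne_zero τ)]⟩

theorem isSmoothPair_twist [CharZero k] (τ : Fin 4) {r : Fin 4 → k}
    {q : Matrix (Fin 4) (Fin 4) k} (h : IsSmoothPair r q) :
    IsSmoothPair (twist k τ *ᵥ r) (twist k τ * q * twist k τ) := by
  intro v hv hrv hqv
  rw [twist_dotProduct] at hrv
  rw [twist_form] at hqv
  have := h _ (twist_mulVec_ne_zero τ hv) hrv hqv
  rw [LinearIndependent.pair_iff] at this ⊢
  intro a b hab
  refine this a b ?_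
  by_contra hne
  apply twist_mulVec_ne_zero τ hne
  rw [← hab, mulVec_add, mulVec_smul, mulVec_smul, ← mulVec_mulVec, ← mulVec_mulVec]

theorem twist_conj_transpose (τ : Fin 4) (f : Fin 4 → k) :
    (twist k τ * diagonal f * twist k τ)ᵀ = twist k τ * diagonal f * twist k τ := by
  rw [transpose_mul, transpose_mul, twist_transpose, diagonal_transpose, mul_assoc]

theorem quarticVal_smul (p : Fin 5 → k) (c : k) (v : Fin 4 → k) :
    quarticVal p (c • v) = c ^ 4 * quarticVal p v := by
  simp [quarticVal]
  ring

theorem quarticVal_sub_smul (p q : Fin 5 → k) (c : k) (v : Fin 4 → k) :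
    quarticVal (p - c • q) v = quarticVal p v - c * quarticVal q v := by
  simp [quarticVal]
  ring

theorem quarticVal_diagNode (i : Fin 4) (v : Fin 4 → k) :
    quarticVal (node (diagNode i)) v =
      (sgn i 0 * v 0 ^ 2 + sgn i 1 * v 1 ^ 2 + sgn i 2 * v 2 ^ 2 + sgn i 3 * v 3 ^ 2) ^ 2 := by
  fin_cases i <;> simp [quarticVal, node, diagNode, sgn] <;> ring

/-- The splitting Q² - η²q² = (Q - ηq)(Q + ηq), transported by the twist. The scalar appears to the
fourth power because twisting twice multiplies vectors by it and the quartic has degree four. -/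
theorem IsBase.quarticVal_eq {m : Fin 10} {p : Fin 5 → k} {r : Fin 4 → k} {η : k}
    (h : IsBase m p r η) {v : Fin 4 → k} (hv : (twist k (nodeTwist m) *ᵥ r) ⬝ᵥ v = 0) :
    (twistScalar (nodeTwist m) : k) ^ 4 * quarticVal p v =
      (v ⬝ᵥ (twist k (nodeTwist m) * diagonal (conicCoeff (nodeDiag m) r η) *
        twist k (nodeTwist m)) *ᵥ v) *
      (v ⬝ᵥ (twist k (nodeTwist m) * diagonal (conicCoeff (nodeDiag m) r (-η)) *
        twist k (nodeTwist m)) *ᵥ v) := by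
  rw [twist_dotProduct] at hv
  rw [twist_form, twist_form, ← quarticVal_smul, ← twist_mulVec_twist_mulVec,
    ← quarticVal_twistParam, h.eq]
  set w := twist k (nodeTwist m) *ᵥ v
  rw [quarticVal_sub_smul, quarticVal_kummer_of_plane r w (by
    simpa [dotProduct, Fin.sum_univ_four] using hv), quarticVal_diagNode,
    dotProduct_diagonal_mulVec, dotProduct_diagonal_mulVec]
  simp only [conicCoeff]
  ring

theorem IsBase.isSmoothPair [CharZero k] {m : Fin 10} {p : Fin 5 → k} {r : Fin 4 → k} {η : k}
    (h : IsBase m p r η) (hN : nieto (twistParam (nodeTwist m) p) ≠ 0) :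
    IsSmoothPair (twist k (nodeTwist m) *ᵥ r)
      (twist k (nodeTwist m) * diagonal (conicCoeff (nodeDiag m) r η) * twist k (nodeTwist m)) := by
  refine isSmoothPair_twist _ (isSmoothPair_diagonal h.good.2 fun h0 => hN ?_)
  rw [h.eq, nieto_kummer, h0]
  ring

theorem IsBase.neg {m : Fin 10} {p : Fin 5 → k} {r : Fin 4 → k} {η : k}
    (h : IsBase m p r η) : IsBase m p r (-η) :=
  ⟨h.good, neg_ne_zero.2 h.ne_zero, by rw [neg_sq, h.eq]⟩

theorem IsBase.heis {m : Fin 10} {p : Fin 5 → k} {r : Fin 4 → k} {η : k} [CharZero k]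
    (h : IsBase m p r η) (a b : Fin 4) : IsBase m p (heis a b r) η :=
  ⟨goodPoint_heis h.good a b, h.ne_zero, by rw [kummer_heis, h.eq]⟩

theorem quadricProd_ne_zero {r : Fin 4 → k} (h : GoodPoint r) : quadricProd r ≠ 0 := by
  rw [quadricProd_eq_prod]
  exact Finset.prod_ne_zero_iff.2 fun j _ => h.1 j

/-- Δ is affine linear along the line to the node and nonzero at `p`, which determines η². The
Kummer parameters then coincide and `exists_heis` applies. -/
theorem IsBase.unique [CharZero k] [IsAlgClosed k] {m : Fin 10} {p : Fin 5 → k}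
    {r r' : Fin 4 → k} {η η' : k} (h : IsBase m p r η) (h' : IsBase m p r' η') :
    (∃ (a b : Fin 4) (t : k), t ^ 12 = 1 ∧ r' = t • HeisenbergQuartic.heis a b r) ∧
      (η' = η ∨ η' = -η) := by
  have hΔ : segreCubic (twistParam (nodeTwist m) p) ≠ 0 := by
    rw [h.eq, segreCubic_conicParam]
    refine mul_ne_zero (mul_ne_zero (mul_ne_zero (by norm_num) (pow_ne_zero _ h.ne_zero))
      (quadricProd_ne_zero h.good)) (pow_ne_zero _ (h.good.1 _))
  have key {r : Fin 4 → k} {η : k} (h : IsBase m p r η) :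
      segreCubic (twistParam (nodeTwist m) p) +
        η ^ 2 * segrePolar (diagNode (nodeDiag m)) (twistParam (nodeTwist m) p) = 0 := by
    rw [← segreCubic_add_smul_node, h.eq, sub_add_cancel, segreCubic_smul, segreCubic_kummer,
      mul_zero]
  have hη : η' ^ 2 = η ^ 2 := by
    have h1 := key h
    have h2 := key h'
    have hP : segrePolar (diagNode (nodeDiag m)) (twistParam (nodeTwist m) p) ≠ 0 := by
      intro h0
      rw [h0, mul_zero, add_zero] at h1
      exact hΔ h1
    apply mul_right_cancel₀ hP
    linear_combination h2 - h1
  refine ⟨exists_heis h.good h'.good ?_, sq_eq_sq_iff_eq_or_eq_neg.1 hη⟩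
  have := h'.eq
  rw [h.eq, hη, sub_left_inj] at this
  exact (smul_right_injective _ (by norm_num : (-4 : k) ≠ 0) this).symm

theorem IsGeneric.exists_isThirdPoint {p : Fin 5 → k} (h : IsGeneric p) (m : Fin 10) :
    ∃ c : k, IsThirdPoint p m (p + c • node m) := by
  refine ⟨-segreCubic p / segrePolar m p, ⟨_, rfl⟩, ?_⟩
  rw [segreCubic_add_smul_node, div_mul_cancel₀ _ (h.segrePolar_ne_zero m), add_neg_cancel]

theorem segreCubic_twistParam_eq_zero {s : Fin 5 → k} (h : segreCubic s = 0) (τ : Fin 4) :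
    segreCubic (twistParam τ s) = 0 := by
  rw [segreCubic_twistParam, h, mul_zero]

theorem twistParam_add_smul_node (p : Fin 5 → k) (c : k) (m : Fin 10) :
    twistParam (nodeTwist m) (p + c • node m) =
      twistParam (nodeTwist m) p + c • node (diagNode (nodeDiag m)) := by
  rw [twistParam_add, twistParam_smul, twistParam_node]

theorem isBase_of_thirdPoint {p : Fin 5 → k} (hp : segreCubic p ≠ 0) {m : Fin 10} {c η : k}
    (hs : segreCubic (p + c • node m) = 0) (hη : η ^ 2 = c) {r : Fin 4 → k} (hr : GoodPoint r)
    (h : twistParam (nodeTwist m) (p + c • node m) = (-4 : k) • kummer r) : IsBase m p r η := by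
  refine ⟨hr, ?_, ?_⟩
  · rintro rfl
    rw [← hη] at hs
    exact hp (by simpa using hs)
  · rw [hη, ← h, twistParam_add_smul_node, add_sub_cancel_right]

theorem IsGeneric.exists_isBase [CharZero k] [IsAlgClosed k] {p : Fin 5 → k} (h : IsGeneric p)
    (m : Fin 10) : ∃ r η, IsBase m p r η := by
  obtain ⟨c, hc⟩ := h.exists_isThirdPoint m
  have hg := h.goodParam_twist m _ hc
  have h0 := segreCubic_twistParam_eq_zero hc.2 (nodeTwist m)
  obtain ⟨r, hr⟩ := exists_kummer hg h0
  obtain ⟨η, hη⟩ := IsAlgClosed.exists_pow_nat_eq c two_pos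
  refine ⟨r, η, isBase_of_thirdPoint h.segreCubic_ne_zero hc.2 hη ?_ hr⟩
  refine (goodPoint_of_singular hg h0 ?_ fun j => ?_).1
  -- For r = 0 the Kummer parameter would be zero, against B ≠ 0.
  · rintro rfl
    apply hg.2
    rw [hr]
    simp [kummer]
  · rw [hr]
    have := quarticGrad_kummer r j
    have hsm (c : k) (s : Fin 5 → k) (v : Fin 4 → k) :
        quarticGrad (c • s) v j = c * quarticGrad s v j := by
      fin_cases j <;> simp [quarticGrad] <;> ring
    rw [hsm, this, mul_zero]

/-- The trope coefficients have degree six in `r`, so η carries weight six. -/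
theorem twistedConic_smul {m : Fin 10} {r : Fin 4 → k} {c η : k} (hc : c ≠ 0) :
    twistedConic m (c • r) (c ^ 6 * η) = twistedConic m r η := by
  rw [twistedConic, mulVec_smul, conicSet_smul hc]
  refine conicSet_congr (pow_ne_zero 6 hc) fun v _ => ?_
  rw [twist_form, twist_form, dotProduct_diagonal_mulVec, dotProduct_diagonal_mulVec]
  simp only [conicCoeff, tropeCoeff_smul]
  ring

/-- The singular points of the Kummer surface through the third point are described by bases. -/
theorem IsGeneric.exists_of_isSingularPoint [CharZero k] [IsAlgClosed k] {p : Fin 5 → k}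
    (h : IsGeneric p) {m : Fin 10} {s : Fin 5 → k} (hs : IsThirdPoint p m s) {r : Fin 4 → k}
    (hr : IsSingularPoint s r) :
    ∃ r' η, IsBase m p r' η ∧ ∃ c : k, c ≠ 0 ∧ r = c • (twist k (nodeTwist m) *ᵥ r') := by
  obtain ⟨w, rfl⟩ := exists_twist_mulVec_eq (nodeTwist m) r
  have hg := h.goodParam_twist m _ hs
  have h0 := segreCubic_twistParam_eq_zero hs.2 (nodeTwist m)
  obtain ⟨hw, d, hd, hsd⟩ := goodPoint_of_singular (r := w) hg h0 (by
    rintro rfl; exact hr.1 (mulVec_zero _)) fun j => by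
      rw [quarticGrad_twistParam]
      have : quarticGrad s (twist k (nodeTwist m) *ᵥ w) = 0 := by
        ext i; rw [← eval_pderiv_quartic]; exact hr.2.2 i
      rw [this, mulVec_zero, Pi.zero_apply]
  obtain ⟨e, he⟩ := IsAlgClosed.exists_pow_nat_eq (d / -4) (n := 12) (by norm_num)
  have he0 : e ≠ 0 := by
    rintro rfl
    have : d / -4 = 0 := by rw [← he]; ring
    simp [hd] at this
  obtain ⟨⟨c, rfl⟩, hc⟩ := hs
  obtain ⟨η, hη⟩ := IsAlgClosed.exists_pow_nat_eq c two_pos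
  refine ⟨e • w, η, isBase_of_thirdPoint h.segreCubic_ne_zero hc hη ?_ ?_, e⁻¹, inv_ne_zero he0, ?_⟩
  · refine ⟨fun j => ?_, fun j => mul_ne_zero he0 (hw.2 j)⟩
    rw [quadrics_smul]
    exact mul_ne_zero (pow_ne_zero _ he0) (hw.1 j)
  · rw [hsd, kummer_smul, he, smul_smul]
    congr 1
    ring
  · rw [mulVec_smul, inv_smul_smul₀ he0]

theorem IsBase.twist_ne_zero [CharZero k] {m : Fin 10} {p : Fin 5 → k} {r : Fin 4 → k} {η : k}
    (h : IsBase m p r η) : twist k (nodeTwist m) *ᵥ r ≠ 0 :=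
  twist_mulVec_ne_zero _ fun h0 => h.good.2 0 (congrFun h0 0)

theorem IsBase.isSingularPoint [CharZero k] {m : Fin 10} {p : Fin 5 → k} {r : Fin 4 → k} {η : k}
    (h : IsBase m p r η) : IsThirdPoint p m (p + η ^ 2 • node m) ∧
      IsSingularPoint (p + η ^ 2 • node m) (twist k (nodeTwist m) *ᵥ r) := by
  have hs : twistParam (nodeTwist m) (p + η ^ 2 • node m) = (-4 : k) • kummer r := by
    rw [twistParam_add_smul_node, h.eq, sub_add_cancel]
  have hgr (j : Fin 4) : quarticGrad (twistParam (nodeTwist m) (p + η ^ 2 • node m)) r j = 0 := by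
    rw [hs]
    have hsm (c : k) (s : Fin 5 → k) (v : Fin 4 → k) :
        quarticGrad (c • s) v j = c * quarticGrad s v j := by
      fin_cases j <;> simp [quarticGrad] <;> ring
    rw [hsm, quarticGrad_kummer, mul_zero]
  have h1 : quarticGrad (p + η ^ 2 • node m) (twist k (nodeTwist m) *ᵥ r) = 0 := by
    by_contra hne
    apply twist_mulVec_ne_zero (nodeTwist m) hne
    rw [← quarticGrad_twistParam]
    exact funext hgr
  refine ⟨⟨⟨_, rfl⟩, ?_⟩, h.twist_ne_zero, ?_, fun j => ?_⟩
  · have h2 : segreCubic (twistParam (nodeTwist m) (p + η ^ 2 • node m)) = 0 := by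
      rw [hs, segreCubic_smul, segreCubic_kummer, mul_zero]
    rw [segreCubic_twistParam, mul_eq_zero] at h2
    refine h2.resolve_left ?_
    have : ∀ τ, (![1, -64, -64, -64] : Fin 4 → k) τ ≠ 0 := by
      intro τ; fin_cases τ <;> simp
    exact this _
  · rw [eval_quartic, ← quarticVal_twistParam, hs]
    have := quarticVal_sub_smul 0 (kummer r) 4 r
    rw [quarticVal_kummer] at this
    rw [neg_smul, ← zero_sub, this]
    simp [quarticVal]
  · rw [eval_pderiv_quartic, h1, Pi.zero_apply]

theorem IsGeneric.mem_conics_iff [CharZero k] [IsAlgClosed k] {p : Fin 5 → k}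
    (h : IsGeneric p) (Z : Set (ℙ k (Fin 4 → k))) :
    Z ∈ conics p ↔ ∃ m r η, IsBase m p r η ∧ Z = twistedConic m r η := by
  have key {m : Fin 10} {r : Fin 4 → k} {η : k} (hb : IsBase m p r η) :
      (IsSmoothConicIn (twist k (nodeTwist m) *ᵥ r) Z ∧ Z ⊆ surface p) ↔
        Z = twistedConic m r η ∨ Z = twistedConic m r (-η) :=
    isSmoothConicIn_and_subset_iff hb.twist_ne_zero (twist_conj_transpose _ _)
      (twist_conj_transpose _ _) (hb.isSmoothPair (h.nieto_ne_zero m))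
      (hb.neg.isSmoothPair (h.nieto_ne_zero m)) (pow_ne_zero 4 (twistScalar_ne_zero _))
      (fun v hv => hb.quarticVal_eq hv) Z
  constructor
  · rintro ⟨m, s, r, hs, hr, hZ, hsub⟩
    obtain ⟨r', η, hb, c, hc, rfl⟩ := h.exists_of_isSingularPoint hs hr
    rw [isSmoothConicIn_smul hc] at hZ
    rcases (key hb).1 ⟨hZ, hsub⟩ with h1 | h1
    · exact ⟨m, r', η, hb, h1⟩
    · exact ⟨m, r', -η, hb.neg, h1⟩
  · rintro ⟨m, r, η, hb, hZ⟩
    obtain ⟨h1, h2⟩ := (key hb).2 (Or.inl hZ)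
    exact ⟨m, _, _, hb.isSingularPoint.1, hb.isSingularPoint.2, h1, h2⟩

/-- Coordinates of a conic attached to the `m`-th node are unique up to scaling. -/
theorem eq_smul_of_twistedConic_subset [CharZero k] [IsAlgClosed k] {p p' : Fin 5 → k} {m : Fin 10}
    {r r' : Fin 4 → k} {η η' : k} (h : IsBase m p r η) (h' : IsBase m p' r' η')
    (hN : nieto (twistParam (nodeTwist m) p) ≠ 0)
    (hZ : twistedConic m r η ⊆ twistedConic m r' η') :
    ∃ c : k, c ≠ 0 ∧ r' = c • r ∧ η' = c ^ 6 * η := by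
  obtain ⟨⟨c, hc⟩, d, hd⟩ := exists_smul_of_conicSet_subset h.twist_ne_zero
    (twist_conj_transpose _ _) (h.isSmoothPair hN) hZ
  have hr' : r' = c • r := by
    have := congrArg (fun v => twist k (nodeTwist m) *ᵥ v) hc
    simp only [mulVec_smul, twist_mulVec_twist_mulVec] at this
    rw [smul_comm] at this
    exact smul_right_injective _ (twistScalar_ne_zero (nodeTwist m)) this
  have hc0 : c ≠ 0 := by
    rintro rfl
    exact h'.good.2 0 (by rw [hr']; simp)
  refine ⟨c, hc0, hr', ?_⟩
  have hf : (fun j => conicCoeff (nodeDiag m) r' η' j - d * conicCoeff (nodeDiag m) r η j) = 0 := by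
    refine diagonal_eq_zero_of_plane h.good.2 fun v hv => ?_
    obtain ⟨w, rfl⟩ := exists_twist_mulVec_eq (nodeTwist m) v
    have := hd w (by rw [twist_dotProduct, hv])
    rw [twist_form, twist_form, dotProduct_diagonal_mulVec, dotProduct_diagonal_mulVec] at this
    rw [dotProduct_diagonal_mulVec]
    linear_combination this
  have hf' (j : Fin 4) : (c ^ 6 - d) * tropeCoeff r j = (η' - d * η) * sgn (nodeDiag m) j := by
    have := congrFun hf j
    simp only [conicCoeff, hr', tropeCoeff_smul, Pi.zero_apply] at this
    linear_combination this
  -- Otherwise the trope form would be proportional to the diagonal quadric.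
  have hcd : c ^ 6 - d = 0 := by
    by_contra hne
    obtain ⟨j, hj⟩ := tropeCoeff_ne_smul_sgn h.good (nodeDiag m) ((η' - d * η) / (c ^ 6 - d))
    apply hj
    rw [div_mul_eq_mul_div, eq_div_iff hne, mul_comm]
    exact hf' j
  have := hf' 0
  have hs : (sgn (nodeDiag m) 0 : k) ≠ 0 := by
    rw [Int.cast_ne_zero]
    have : ∀ i j, sgn i j ≠ 0 := by decide
    exact this _ _
  rw [hcd, zero_mul, eq_comm, mul_eq_zero, or_iff_left hs] at this
  linear_combination this - η * hcd

theorem exists_singularForm_separating {m m' : Fin 10} (h : m ≠ m') :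
    (∃ j, singularForm (node m : Fin 5 → ℤ) j = 0 ∧ singularForm (node m' : Fin 5 → ℤ) j = 0) ∧
      ∃ j, singularForm (node m : Fin 5 → ℤ) j ≠ 0 ∧ singularForm (node m' : Fin 5 → ℤ) j = 0 := by
  revert m m'; decide

theorem singularForm_node_cast (m : Fin 10) (j : Fin 15) :
    singularForm (node m : Fin 5 → k) j = ((singularForm (node m : Fin 5 → ℤ) j : ℤ) : k) := by
  have := map_singularForm (Int.castRingHom k) (node m) j
  simp only [map_node] at this
  exact this.symm

/-- Third points for different nodes are different. -/
theorem IsGeneric.eq_of_smul_eq [CharZero k] {p : Fin 5 → k} (h : IsGeneric p) {m m' : Fin 10}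
    {s s' : Fin 5 → k} (hs : IsThirdPoint p m s) (hs' : IsThirdPoint p m' s') {c : k}
    (hc : s' = c • s) : m = m' := by
  by_contra hne
  obtain ⟨⟨j, h1, h2⟩, l, h3, h4⟩ := exists_singularForm_separating hne
  obtain ⟨⟨a, rfl⟩, ha⟩ := hs
  obtain ⟨⟨b, rfl⟩, hb⟩ := hs'
  have e (i : Fin 15) := congrArg (fun s => singularForm s i) hc
  simp only [singularForm_add, singularForm_smul, singularForm_node_cast] at e
  have e1 := e j
  have e2 := e l
  rw [h1, h2] at e1
  rw [h4] at e2
  simp only [Int.cast_zero, mul_zero, add_zero] at e1 e2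
  -- A form vanishing at both nodes has the value of `p` at both third points, so the scalar is 1. A
  -- form vanishing only at the second node then shows that the first third point is `p` itself,
  -- which is off the cubic.
  obtain rfl : c = 1 := mul_right_cancel₀ (h.singularForm_ne_zero j) (by rw [← e1, one_mul])
  have ha0 : a = 0 := by
    have : a * ((singularForm (node m : Fin 5 → ℤ) l : ℤ) : k) = 0 := by linear_combination -e2
    exact (mul_eq_zero.1 this).resolve_right (Int.cast_ne_zero.2 h3)
  rw [ha0, zero_smul, add_zero] at ha
  exact h.segreCubic_ne_zero ha

/-- The conic spans its plane, and the dual point determines the Kummer parameter singular there up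
to a scalar. Different twists are compared here, so the third points must be good parameters before
twisting too. -/
theorem IsGeneric.node_eq_of_twistedConic_eq [CharZero k] [IsAlgClosed k] {p : Fin 5 → k}
    (h : IsGeneric p) {m m' : Fin 10} {r r' : Fin 4 → k} {η η' : k} (hb : IsBase m p r η)
    (hb' : IsBase m' p r' η') (hZ : twistedConic m r η = twistedConic m' r' η') : m = m' := by
  obtain ⟨⟨c, hc⟩, -⟩ := exists_smul_of_conicSet_subset hb.twist_ne_zero
    (twist_conj_transpose _ _) (hb.isSmoothPair (h.nieto_ne_zero m)) hZ.subset
  have key {m : Fin 10} {r : Fin 4 → k} {η : k} (hb : IsBase m p r η) :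
      ∃ d : k, d ≠ 0 ∧ p + η ^ 2 • node m = d • kummer (twist k (nodeTwist m) *ᵥ r) := by
    obtain ⟨h1, h2⟩ := hb.isSingularPoint
    exact (goodPoint_of_singular (h.goodParam m _ h1) h1.2 h2.1 fun j => by
      rw [← eval_pderiv_quartic]; exact h2.2.2 j).2
  obtain ⟨d, hd, h1⟩ := key hb
  obtain ⟨d', -, h2⟩ := key hb'
  rw [hc, kummer_smul, smul_smul] at h2
  refine h.eq_of_smul_eq hb.isSingularPoint.1 hb'.isSingularPoint.1 (c := d' * c ^ 12 / d) ?_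
  rw [h1, h2, smul_smul, div_mul_cancel₀ _ hd]

theorem heis_index_injective {r : Fin 4 → k} [CharZero k] (hr : GoodPoint r) {a b a' b' : Fin 4}
    {c : k} (h : heis a' b' r = c • heis a b r) : a' = a ∧ b' = b ∧ c ^ 2 = 1 := by
  have hq (j : Fin 10) : (chi j a' b' : k) = c ^ 2 * chi j a b := by
    have := congrArg (fun r => quadrics r j) h
    simp only [quadrics_smul, quadrics_heis] at this
    apply mul_right_cancel₀ (hr.1 j)
    linear_combination this
  have hc : c ^ 2 = 1 := by
    have := hq 0
    have h1 : ∀ a b, chi 0 a b = 1 := by decide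
    simpa [h1] using this.symm
  have hz (j : Fin 10) : chi j a' b' = chi j a b := by
    have := hq j
    rw [hc, one_mul] at this
    exact_mod_cast this
  have hd : ∀ a b a' b' : Fin 4, (∀ j, chi j a' b' = chi j a b) → a' = a ∧ b' = b := by decide
  obtain ⟨h1, h2⟩ := hd a b a' b' hz
  exact ⟨h1, h2, hc⟩

theorem IsGeneric.ncard_conics [CharZero k] [IsAlgClosed k] {p : Fin 5 → k} (h : IsGeneric p) :
    (conics p).ncard = 320 := by
  choose r η hb using h.exists_isBase
  let f : Fin 10 × Fin 4 × Fin 4 × ℤˣ → Set (ℙ k (Fin 4 → k)) := fun x =>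
    twistedConic x.1 (heis x.2.1 x.2.2.1 (r x.1)) ((x.2.2.2 : ℤ) * η x.1)
  have hf (x : Fin 10 × Fin 4 × Fin 4 × ℤˣ) : IsBase x.1 p (heis x.2.1 x.2.2.1 (r x.1)) ((x.2.2.2 : ℤ) * η x.1) := by
    have := (hb x.1).heis x.2.1 x.2.2.1
    rcases Int.units_eq_one_or x.2.2.2 with h | h <;> rw [h]
    · simpa using this
    · simpa using this.neg
  have hrange : conics p = Set.range f := by
    ext Z
    rw [h.mem_conics_iff]
    constructor
    · rintro ⟨m, r', η', hb', rfl⟩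
      obtain ⟨⟨a, b, t, ht, rfl⟩, hη⟩ := (hb m).unique hb'
      have ht0 : t ≠ 0 := by rintro rfl; simp at ht
      -- A twelfth root of unity acts on η through its sixth power, a sign, which is absorbed into
      -- the index ε.
      have ht6 : t ^ 6 = 1 ∨ t ^ 6 = -1 := sq_eq_sq_iff_eq_or_eq_neg.1 (by rw [← pow_mul, ht, one_pow])
      have : ∃ ε : ℤˣ, η' = t ^ 6 * ((ε : ℤ) * η m) := by
        rcases ht6 with e | e <;> rcases hη with e' | e' <;> rw [e, e']
        exacts [⟨1, by simp⟩, ⟨-1, by simp⟩, ⟨-1, by simp⟩, ⟨1, by simp⟩]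
      obtain ⟨ε, rfl⟩ := this
      exact ⟨(m, a, b, ε), (twistedConic_smul ht0).symm⟩
    · rintro ⟨x, rfl⟩
      exact ⟨_, _, _, hf x, rfl⟩
  have hinj : Function.Injective f := by
    rintro ⟨m, a, b, ε⟩ ⟨m', a', b', ε'⟩ hxy
    obtain rfl : m = m' := h.node_eq_of_twistedConic_eq (hf (m, a, b, ε)) (hf (m', a', b', ε')) hxy
    obtain ⟨c, hc, h1, h2⟩ := eq_smul_of_twistedConic_subset (hf (m, a, b, ε))
      (hf (m, a', b', ε')) (h.nieto_ne_zero m) hxy.subset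
    obtain ⟨rfl, rfl, hc2⟩ := heis_index_injective (hb m).good h1
    have hc6 : c ^ 6 = 1 := by rw [show c ^ 6 = (c ^ 2) ^ 3 by ring, hc2, one_pow]
    rw [hc6, one_mul] at h2
    have := mul_right_cancel₀ (hb m).ne_zero h2
    have : ε' = ε := by exact_mod_cast this
    rw [this]
  rw [hrange, ← Nat.card_coe_set_eq, Nat.card_range_of_injective hinj]
  simp [Nat.card_eq_fintype_card]

end TwistedConics

end HeisenbergQuartic

namespace HeisenbergQuartic

/-! ### Compatibility with ring homomorphisms. -/

section Maps

open Matrix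

variable {R S : Type*} [CommRing R] [CommRing S] (f : R →+* S)

theorem map_quadrics (r : Fin 4 → R) (j : Fin 10) :
    f (quadrics r j) = quadrics (fun a => f (r a)) j := by
  fin_cases j <;> simp [quadrics]

theorem map_quadricProd (r : Fin 4 → R) : f (quadricProd r) = quadricProd (fun a => f (r a)) := by
  simp [quadricProd]

theorem map_kummer (r : Fin 4 → R) (j : Fin 5) :
    f (kummer r j) = kummer (fun a => f (r a)) j := by
  fin_cases j <;> simp [kummer, map_ofNat f 2]

theorem map_tropeCoeff (r : Fin 4 → R) (j : Fin 4) :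
    f (tropeCoeff r j) = tropeCoeff (fun a => f (r a)) j := by
  fin_cases j <;> simp [tropeCoeff, map_ofNat f 2]

theorem map_conicCoeff (i : Fin 4) (r : Fin 4 → R) (η : R) (j : Fin 4) :
    f (conicCoeff i r η j) = conicCoeff i (fun a => f (r a)) (f η) j := by
  simp [conicCoeff, map_tropeCoeff]

theorem map_synthemeRoot (i : Fin 4) (r : Fin 4 → R) (η : R) (j : Fin 15) :
    f (synthemeRoot i r η j) = synthemeRoot i (fun a => f (r a)) (f η) j := by
  simp [synthemeRoot, map_quadrics, map_quadricProd, map_prod, map_ofNat f 128]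

theorem map_twistParam (τ : Fin 4) (p : Fin 5 → R) (j : Fin 5) :
    f (twistParam τ p j) = twistParam τ (fun a => f (p a)) j := by
  fin_cases τ <;> fin_cases j <;>
    simp [twistParam, map_ofNat f 2, map_ofNat f 8, map_ofNat f 12]

theorem map_twist (τ : Fin 4) : (twist R τ).map f = twist S τ := by
  ext i j
  fin_cases τ <;> fin_cases i <;> fin_cases j <;> simp [twist]

theorem map_segreCubic (p : Fin 5 → R) : f (segreCubic p) = segreCubic fun a => f (p a) := by
  simp [segreCubic, map_ofNat f 4, map_ofNat f 16]

theorem map_syntheme (p : Fin 5 → R) (j : Fin 15) :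
    f (syntheme p j) = syntheme (fun a => f (p a)) j := by
  simp [syntheme, map_singularForm, map_segreCubic]

theorem map_radicand (p : Fin 5 → R) (j : Fin 10) :
    f (radicand p j) = radicand (fun a => f (p a)) j := by
  rw [← syntheme_castLE, ← syntheme_castLE, map_syntheme]

end Maps

/-! ### The fifteen syntheme products modulo squares. -/

section Synthemes

variable {K : Type*} [Field K] [CharZero K]

/-- Each of the fifteen synthemes is a product of radicands up to a square. -/
theorem exists_syntheme_mul_sq {p : Fin 5 → K} (hΔ : segreCubic p ≠ 0)
    (hf : ∀ j, singularForm p j ≠ 0) (j : Fin 15) :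
    ∃ (s : Finset (Fin 10)) (x : K), x ≠ 0 ∧ syntheme p j * x ^ 2 = ∏ l ∈ s, radicand p l := by
  by_cases hj : (j : ℕ) < 10
  · refine ⟨{⟨j, hj⟩}, 1, one_ne_zero, ?_⟩
    rw [Finset.prod_singleton, ← syntheme_castLE]
    simp
  have h0 : p 0 ≠ 0 := hf 0
  have h1 : qPlusC p ≠ 0 := hf 1
  have h2 : qMinusC p ≠ 0 := hf 2
  have h3 : qPlusD p ≠ 0 := hf 3
  have h5 : qPlusE p ≠ 0 := hf 5
  have h7 : pPlus0 p ≠ 0 := hf 7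
  have h9 : pPlus2 p ≠ 0 := hf 9
  have h11 : pMinus0 p ≠ 0 := hf 11
  have h14 : pMinus3 p ≠ 0 := hf 14
  have hj' : j = 10 ∨ j = 11 ∨ j = 12 ∨ j = 13 ∨ j = 14 := by
    revert j; decide
  -- The remaining five classes are given by linear relations over F₂ among exponent vectors. Every
  -- set has odd size, since each product contains Δ exactly once; `x` is the square root of what is
  -- left over.
  rcases hj' with rfl | rfl | rfl | rfl | rfl
  · refine ⟨{5, 6, 7, 8, 9}, segreCubic p ^ 2 * qPlusD p * pPlus0 p * pMinus0 p * pPlus2 p *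
      qPlusE p * pMinus3 p, by simp [*], ?_⟩
    simp [syntheme, radicand, synthemeSign, synthemeForms, Fin.prod_univ_three, singularForm]
    ring
  · refine ⟨{0, 1, 4, 6, 9}, segreCubic p ^ 2 * p 0 * qPlusC p * qMinusC p * qPlusD p *
      pMinus0 p * pPlus2 p, by simp [*], ?_⟩
    simp [syntheme, radicand, synthemeSign, synthemeForms, Fin.prod_univ_three, singularForm]
    ring
  · refine ⟨{0, 1, 3, 6, 7, 8, 9}, segreCubic p ^ 3 * p 0 * qPlusC p * qMinusC p * qPlusD p *
      pPlus0 p * pMinus0 p * pPlus2 p * qPlusE p * pMinus3 p, by simp [*], ?_⟩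
    simp [syntheme, radicand, synthemeSign, synthemeForms, Fin.prod_univ_three, singularForm]
    ring
  · refine ⟨{0, 2, 4, 5, 6, 7, 9}, segreCubic p ^ 3 * p 0 * qPlusC p * qMinusC p * qPlusE p *
      pMinus0 p * qPlusD p * pPlus0 p * pPlus2 p * pMinus3 p, by simp [*], ?_⟩
    simp [syntheme, radicand, synthemeSign, synthemeForms, Fin.prod_univ_three, singularForm]
    ring
  · refine ⟨{0, 2, 3, 7, 9}, segreCubic p ^ 2 * p 0 * qPlusC p * qMinusC p * qPlusE p *
      pPlus0 p * pMinus3 p, by simp [*], ?_⟩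
    simp [syntheme, radicand, synthemeSign, synthemeForms, Fin.prod_univ_three, singularForm]
    ring

theorem mem_radicalField_of_sq_eq_syntheme {p : Fin 5 → K} (hΔ : segreCubic p ≠ 0)
    (hf : ∀ j, singularForm p j ≠ 0) (j : Fin 15) {x : AlgebraicClosure K}
    (hx : x ^ 2 = algebraMap K (AlgebraicClosure K) (syntheme p j)) : x ∈ radicalField p := by
  obtain ⟨s, y, hy, hs⟩ := exists_syntheme_mul_sq hΔ hf j
  choose t ht using fun l => IsAlgClosed.exists_pow_nat_eq
    (algebraMap K (AlgebraicClosure K) (radicand p l)) two_pos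
  have htm (l : Fin 10) : t l ∈ radicalField p := IntermediateField.subset_adjoin _ _ ⟨l, ht l⟩
  have hy' : algebraMap K (AlgebraicClosure K) y ≠ 0 := by simpa using hy
  have h2 : (x * algebraMap K (AlgebraicClosure K) y) ^ 2 = (∏ l ∈ s, t l) ^ 2 := by
    rw [mul_pow, hx, ← map_pow, ← map_mul, hs, map_prod, ← Finset.prod_pow]
    simp only [ht]
  have hp : ∏ l ∈ s, t l ∈ radicalField p := prod_mem fun l _ => htm l
  have hxy : x * algebraMap K (AlgebraicClosure K) y ∈ radicalField p := by
    rcases sq_eq_sq_iff_eq_or_eq_neg.1 h2 with h | h <;> rw [h]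
    exacts [hp, neg_mem hp]
  rw [← mul_div_cancel_right₀ x hy']
  exact div_mem hxy (IntermediateField.algebraMap_mem _ _)

end Synthemes

/-! ### The Galois action on the conics and their field of definition. -/

section FieldOfDefinition

open Matrix

variable {k : Type*} [Field k]

theorem GoodPoint.map {r : Fin 4 → k} (h : GoodPoint r) (σ : k →+* k) :
    GoodPoint fun j => σ (r j) :=
  ⟨fun j => by rw [← map_quadrics]; simpa using h.1 j, fun j => by simpa using h.2 j⟩

theorem IsBase.map {m : Fin 10} {p : Fin 5 → k} {r : Fin 4 → k} {η : k} (h : IsBase m p r η)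
    (σ : k →+* k) (hp : ∀ j, σ (p j) = p j) : IsBase m p (fun j => σ (r j)) (σ η) := by
  refine ⟨h.good.map σ, by simpa using h.ne_zero, ?_⟩
  ext j
  have := congrArg (fun s => σ (s j)) h.eq
  simpa [map_twistParam, hp, map_kummer, map_node, map_ofNat σ 4] using this

theorem map_conicSet_iff (σ : k →+* k) (r : Fin 4 → k) (q : Matrix (Fin 4) (Fin 4) k)
    (v : Fin 4 → k) :
    ((fun j => σ (r j)) ⬝ᵥ (fun j => σ (v j)) = 0 ∧
      (fun j => σ (v j)) ⬝ᵥ q.map σ *ᵥ (fun j => σ (v j)) = 0) ↔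
      r ⬝ᵥ v = 0 ∧ v ⬝ᵥ q *ᵥ v = 0 := by
  have h1 : (fun j => σ (r j)) ⬝ᵥ (fun j => σ (v j)) = σ (r ⬝ᵥ v) := by
    simp [dotProduct]
  have h2 : (fun j => σ (v j)) ⬝ᵥ q.map σ *ᵥ (fun j => σ (v j)) = σ (v ⬝ᵥ q *ᵥ v) := by
    simp [dotProduct, mulVec]
  rw [h1, h2, map_eq_zero, map_eq_zero]

theorem map_twisted_mulVec (σ : k →+* k) (τ : Fin 4) (r : Fin 4 → k) :
    (fun j => σ ((twist k τ *ᵥ r) j)) = twist k τ *ᵥ fun j => σ (r j) := by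
  ext j
  have := RingHom.map_mulVec σ (twist k τ) r j
  rw [map_twist] at this
  exact this

theorem map_twisted_form (σ : k →+* k) (τ i : Fin 4) (r : Fin 4 → k) (η : k) :
    (twist k τ * diagonal (conicCoeff i r η) * twist k τ).map σ =
      twist k τ * diagonal (conicCoeff i (fun j => σ (r j)) (σ η)) * twist k τ := by
  rw [Matrix.map_mul, Matrix.map_mul, map_twist, diagonal_map (map_zero σ)]
  congr 3
  ext j
  exact map_conicCoeff σ i r η j

theorem mk_map_mem_twistedConic_iff (σ : k →+* k) (m : Fin 10) (r : Fin 4 → k) (η : k)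
    (v : Fin 4 → k) (hv : v ≠ 0) (hv' : (fun j => σ (v j)) ≠ 0) :
    Projectivization.mk k (fun j => σ (v j)) hv' ∈ twistedConic m (fun j => σ (r j)) (σ η) ↔
      Projectivization.mk k v hv ∈ twistedConic m r η := by
  rw [twistedConic, twistedConic, mk_mem_conicSet, mk_mem_conicSet, ← map_twisted_mulVec,
    ← map_twisted_form, map_conicSet_iff]

variable {K : Type*} [Field K]

theorem mk_map_mem_of_isDefinedOver {M : IntermediateField K (AlgebraicClosure K)}
    {Z : Set (ℙ (AlgebraicClosure K) (Fin 4 → AlgebraicClosure K))} (h : IsDefinedOver M Z)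
    (σ : AlgebraicClosure K →ₐ[M] AlgebraicClosure K) {v : Fin 4 → AlgebraicClosure K}
    (hv : v ≠ 0) (hv' : (fun j => σ (v j)) ≠ 0) (hZ : Projectivization.mk _ v hv ∈ Z) :
    Projectivization.mk _ (fun j => σ (v j)) hv' ∈ Z := by
  obtain ⟨S, hS, rfl⟩ := h
  have hhom : ∀ F ∈ MvPolynomial.map (algebraMap M (AlgebraicClosure K)) '' S,
      ∃ d, F.IsHomogeneous d := by
    rintro _ ⟨F, hF, rfl⟩
    obtain ⟨d, hd⟩ := hS F hF
    exact ⟨d, hd.map _⟩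
  rw [mk_mem_zeroLocus hhom] at hZ ⊢
  rintro _ ⟨F, hF, rfl⟩
  have := congrArg σ (hZ _ ⟨F, hF, rfl⟩)
  rw [map_zero, MvPolynomial.eval_map, ← MvPolynomial.aeval_def, ← AlgHom.comp_apply,
    MvPolynomial.comp_aeval, MvPolynomial.aeval_def] at this
  rw [MvPolynomial.eval_map]
  exact this

theorem mem_of_forall_fixed [CharZero K] (M : IntermediateField K (AlgebraicClosure K))
    {x : AlgebraicClosure K}
    (h : ∀ σ : AlgebraicClosure K ≃ₐ[M] AlgebraicClosure K, σ x = x) : x ∈ M := by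
  have : IsGalois M (AlgebraicClosure K) := ⟨⟩
  obtain ⟨y, rfl⟩ := (InfiniteGalois.mem_range_algebraMap_iff_fixed x).2 h
  exact y.2

/-- Degrees: 20 for the product of all quadrics, 2 for the diagonal one, 8 for the four transversal
ones. With weight six for η the total is 36, a multiple of 12, so twelfth roots of unity act
trivially. -/
theorem synthemeRoot_smul (i : Fin 4) (c : k) (r : Fin 4 → k) (η : k) (j : Fin 15) :
    synthemeRoot i (c • r) η j = c ^ 30 * synthemeRoot i r η j := by
  simp only [synthemeRoot, quadricProd_smul, quadrics_smul, Finset.prod_mul_distrib,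
    Finset.prod_const, Finset.card_univ, Fintype.card_fin]
  ring

theorem synthemeRoot_mul (i : Fin 4) (c : k) (r : Fin 4 → k) (η : k) (j : Fin 15) :
    synthemeRoot i r (c * η) j = c * synthemeRoot i r η j := by
  simp only [synthemeRoot]
  ring

theorem synthemeRoot_heis (i a b : Fin 4) (r : Fin 4 → k) (η : k) (j : Fin 15) :
    synthemeRoot i (heis a b r) η j =
      ((chi (diagQuadric i) a b * ∏ t, chi (synthemeQuadrics j t) a b : ℤ) : k) *
        synthemeRoot i r η j := by
  simp only [synthemeRoot, quadricProd_heis, quadrics_heis, Finset.prod_mul_distrib]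
  push_cast
  ring

theorem synthemeRoot_ne_zero [CharZero k] {r : Fin 4 → k} (hr : GoodPoint r) {η : k} (hη : η ≠ 0) (i : Fin 4)
    (j : Fin 15) : synthemeRoot i r η j ≠ 0 := by
  refine mul_ne_zero (mul_ne_zero (mul_ne_zero (mul_ne_zero (by norm_num) hη)
    (quadricProd_ne_zero hr)) (hr.1 _)) (Finset.prod_ne_zero_iff.2 fun t _ => hr.1 _)

theorem IsBase.synthemeRoot_sq {m : Fin 10} {p : Fin 5 → k} {r : Fin 4 → k} {η : k}
    (h : IsBase m p r η) (t : Fin 6) :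
    synthemeRoot (nodeDiag m) r η (diagSynthemes (nodeDiag m) t) ^ 2 =
      (twistFactor (nodeTwist m) (diagSynthemes (nodeDiag m) t) : k) ^ 2 *
        syntheme p (twistSyntheme (nodeTwist m) (diagSynthemes (nodeDiag m) t)) := by
  rw [← syntheme_twistParam, h.eq, syntheme_conicParam]

theorem twistFactor_ne_zero [CharZero k] (τ : Fin 4) (j : Fin 15) : (twistFactor τ j : k) ≠ 0 := by
  rw [Int.cast_ne_zero]
  revert τ j; decide

theorem exists_twistSyntheme_eq (j : Fin 15) :
    ∃ (m : Fin 10) (t : Fin 6),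
      twistSyntheme (nodeTwist m) (diagSynthemes (nodeDiag m) t) = j := by
  revert j; decide

/-- Any field over which the conics are defined contains the square roots of the radicands. -/
theorem IsGeneric.radicalField_le [CharZero K] {p : Fin 5 → K}
    (h : IsGeneric fun j => algebraMap K (AlgebraicClosure K) (p j))
    {M : IntermediateField K (AlgebraicClosure K)}
    (hM : ∀ Z ∈ conics fun j => algebraMap K (AlgebraicClosure K) (p j), IsDefinedOver M Z) :
    radicalField p ≤ M := by
  rw [radicalField, IntermediateField.adjoin_le_iff]
  rintro x ⟨j, hj⟩
  refine mem_of_forall_fixed M fun σ => ?_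
  obtain ⟨m, t, hmt⟩ := exists_twistSyntheme_eq (Fin.castLE (by norm_num) j)
  obtain ⟨r, η, hb⟩ := h.exists_isBase m
  have hσp (j : Fin 5) : σ (algebraMap K (AlgebraicClosure K) (p j)) =
      algebraMap K (AlgebraicClosure K) (p j) := by
    rw [IsScalarTower.algebraMap_apply K M, σ.commutes]
  have hb' := hb.map (σ : AlgebraicClosure K →+* AlgebraicClosure K) hσp
  have hdef := hM _ ((h.mem_conics_iff _).2 ⟨m, r, η, hb, rfl⟩)
  have hsub : twistedConic m r η ⊆ twistedConic m (fun j => σ (r j)) (σ η) := by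
    intro x hx
    obtain ⟨v, hv, rfl⟩ : ∃ v hv, Projectivization.mk (AlgebraicClosure K) v hv = x :=
      ⟨x.rep, x.rep_nonzero, x.mk_rep⟩
    have hw0 : (fun j => σ.symm (v j)) ≠ 0 := by
      intro h0
      apply hv
      ext j
      simpa using congrFun h0 j
    have h1 := mk_map_mem_of_isDefinedOver hdef σ.symm.toAlgHom hv hw0 hx
    have h2 : (fun j => (σ : AlgebraicClosure K →+* AlgebraicClosure K) (σ.symm (v j))) = v := by
      ext j; simp
    have h3 := (mk_map_mem_twistedConic_iff
      (σ : AlgebraicClosure K →+* AlgebraicClosure K) m r η _ hw0 (by rw [h2]; exact hv)).2 h1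
    simp only [h2] at h3
    exact h3
  obtain ⟨c, hc, hr, hη⟩ := eq_smul_of_twistedConic_subset hb hb' (h.nieto_ne_zero m) hsub
  -- Both coordinate pairs belong to the same nonzero parameter, which has weight twelve in `r` and
  -- weight two in η.
  have hc12 : c ^ 12 = 1 := by
    have e := hb'.eq
    have hr' : (fun j => (σ : AlgebraicClosure K →+* AlgebraicClosure K) (r j)) = c • r := hr
    have hη' : (σ : AlgebraicClosure K →+* AlgebraicClosure K) η = c ^ 6 * η := hη
    rw [hr', hη', kummer_smul] at e
    have e2 : c ^ 12 • twistParam (nodeTwist m)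
        (fun j => algebraMap K (AlgebraicClosure K) (p j)) =
        (1 : AlgebraicClosure K) • twistParam (nodeTwist m)
          (fun j => algebraMap K (AlgebraicClosure K) (p j)) := by
      conv_rhs => rw [e]
      rw [hb.eq, one_smul, smul_sub, smul_smul, smul_smul, smul_smul]
      congr 2 <;> ring
    have hne : twistParam (nodeTwist m) (fun j => algebraMap K (AlgebraicClosure K) (p j)) ≠ 0 := by
      intro h0
      apply h.nieto_ne_zero m
      rw [h0]
      simp [nieto]
    exact smul_left_injective _ hne e2
  have hroot : σ (synthemeRoot (nodeDiag m) r η (diagSynthemes (nodeDiag m) t)) =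
      synthemeRoot (nodeDiag m) r η (diagSynthemes (nodeDiag m) t) := by
    refine (map_synthemeRoot (σ : AlgebraicClosure K →+* AlgebraicClosure K) _ r η _).trans ?_
    have hr' : (fun j => (σ : AlgebraicClosure K →+* AlgebraicClosure K) (r j)) = c • r := hr
    have hη' : (σ : AlgebraicClosure K →+* AlgebraicClosure K) η = c ^ 6 * η := hη
    rw [hr', hη', synthemeRoot_smul, synthemeRoot_mul, ← mul_assoc, ← pow_add,
      show 30 + 6 = 12 * 3 from rfl, pow_mul, hc12, one_pow, one_mul]
  have hsq : synthemeRoot (nodeDiag m) r η (diagSynthemes (nodeDiag m) t) ^ 2 =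
      ((twistFactor (nodeTwist m) (diagSynthemes (nodeDiag m) t) : AlgebraicClosure K) * x) ^ 2 := by
    rw [hb.synthemeRoot_sq, hmt, mul_pow, hj, syntheme_castLE, map_radicand]
  have hF := twistFactor_ne_zero (k := AlgebraicClosure K) (nodeTwist m)
    (diagSynthemes (nodeDiag m) t)
  rcases sq_eq_sq_iff_eq_or_eq_neg.1 hsq with e | e <;> rw [e] at hroot
  · rw [map_mul, map_intCast] at hroot
    exact mul_left_cancel₀ hF hroot
  · rw [map_neg, map_mul, map_intCast, neg_inj] at hroot
    exact mul_left_cancel₀ hF hroot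

/-- The six monomials of a node separate the sixteen Heisenberg elements. As no element acts by -1
on all six, a simultaneous sign change of η is detected too. -/
theorem chi_diagSynthemes_eq_one (i a b : Fin 4)
    (h : ∀ t, chi (diagQuadric i) a b * ∏ u, chi (synthemeQuadrics (diagSynthemes i t) u) a b = 1) :
    a = 0 ∧ b = 0 := by
  revert i a b; decide

theorem chi_diagSynthemes_ne_neg_one (i a b : Fin 4) : ∃ t,
    chi (diagQuadric i) a b * ∏ u, chi (synthemeQuadrics (diagSynthemes i t) u) a b ≠ -1 := by
  revert i a b; decide

theorem heis_zero (r : Fin 4 → k) : heis 0 0 r = r := by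
  ext j
  fin_cases j <;> simp [heis, sgn, kleinPerm]

/-- The automorphisms over the field generated by the square roots rescale the coordinates of a
conic. -/
theorem IsBase.exists_smul_of_fixed [CharZero K] {p : Fin 5 → K} (hΔ : segreCubic p ≠ 0)
    (hf : ∀ j, singularForm p j ≠ 0) {m : Fin 10} {r : Fin 4 → AlgebraicClosure K}
    {η : AlgebraicClosure K} (h : IsBase m (fun j => algebraMap K (AlgebraicClosure K) (p j)) r η)
    (σ : AlgebraicClosure K ≃ₐ[radicalField p] AlgebraicClosure K) :
    ∃ t : AlgebraicClosure K, t ≠ 0 ∧ (∀ j, σ (r j) = t * r j) ∧ σ η = t ^ 6 * η := by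
  have hσp (j : Fin 5) : σ (algebraMap K (AlgebraicClosure K) (p j)) =
      algebraMap K (AlgebraicClosure K) (p j) := by
    rw [IsScalarTower.algebraMap_apply K (radicalField p), σ.commutes]
  obtain ⟨⟨a, b, t, ht, hr⟩, hη⟩ :=
    h.unique (h.map (σ : AlgebraicClosure K →+* AlgebraicClosure K) hσp)
  have ht0 : t ≠ 0 := by rintro rfl; simp at ht
  have ht6 : t ^ 6 = 1 ∨ t ^ 6 = -1 :=
    sq_eq_sq_iff_eq_or_eq_neg.1 (by rw [← pow_mul, ht, one_pow])
  have hη2 : ∃ ε : ℤˣ, (σ : AlgebraicClosure K →+* AlgebraicClosure K) η = t ^ 6 * ((ε : ℤ) * η) := by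
    rcases ht6 with e | e <;> rcases hη with e' | e' <;> rw [e, e']
    exacts [⟨1, by simp⟩, ⟨-1, by simp⟩, ⟨-1, by simp⟩, ⟨1, by simp⟩]
  obtain ⟨ε, hε⟩ := hη2
  -- The monomial lies in the radical field and is fixed by `σ`, while `σ` multiplies it by this
  -- sign.
  have hroot (u : Fin 6) : (ε : ℤ) * (chi (diagQuadric (nodeDiag m)) a b *
      ∏ v, chi (synthemeQuadrics (diagSynthemes (nodeDiag m) u) v) a b) = 1 := by
    have hF := twistFactor_ne_zero (k := AlgebraicClosure K) (nodeTwist m)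
      (diagSynthemes (nodeDiag m) u)
    have hmem : synthemeRoot (nodeDiag m) r η (diagSynthemes (nodeDiag m) u) ∈ radicalField p := by
      have := mem_radicalField_of_sq_eq_syntheme hΔ hf
        (twistSyntheme (nodeTwist m) (diagSynthemes (nodeDiag m) u))
        (x := synthemeRoot (nodeDiag m) r η (diagSynthemes (nodeDiag m) u) /
          (twistFactor (nodeTwist m) (diagSynthemes (nodeDiag m) u) : AlgebraicClosure K)) (by
        rw [div_pow, h.synthemeRoot_sq, mul_div_cancel_left₀ _ (pow_ne_zero 2 hF), map_syntheme])
      rw [← div_mul_cancel₀ (synthemeRoot (nodeDiag m) r η (diagSynthemes (nodeDiag m) u)) hF]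
      exact mul_mem this (intCast_mem _ _)
    have hfix : (σ : AlgebraicClosure K →+* AlgebraicClosure K)
        (synthemeRoot (nodeDiag m) r η (diagSynthemes (nodeDiag m) u)) =
        synthemeRoot (nodeDiag m) r η (diagSynthemes (nodeDiag m) u) :=
      σ.commutes ⟨_, hmem⟩
    rw [map_synthemeRoot, hr, hε, synthemeRoot_smul, synthemeRoot_mul, synthemeRoot_mul,
      synthemeRoot_heis, ← mul_assoc, ← pow_add, show 30 + 6 = 12 * 3 from rfl, pow_mul, ht,
      one_pow, one_mul, ← mul_assoc, ← Int.cast_mul] at hfix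
    have h1 := mul_right_cancel₀ (synthemeRoot_ne_zero h.good h.ne_zero _ _)
      (hfix.trans (one_mul _).symm)
    exact_mod_cast h1
  have hε1 : ε = 1 := by
    rcases Int.units_eq_one_or ε with e | e
    · exact e
    · obtain ⟨u, hu⟩ := chi_diagSynthemes_ne_neg_one (nodeDiag m) a b
      have := hroot u
      rw [e] at this
      simp only [Units.val_neg, Units.val_one, neg_mul, one_mul] at this
      exact absurd (by linarith) hu
  subst hε1
  obtain ⟨rfl, rfl⟩ := chi_diagSynthemes_eq_one (nodeDiag m) a b fun u => by simpa using hroot u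
  rw [heis_zero] at hr
  exact ⟨t, ht0, fun j => congrFun hr j, by simpa using hε⟩

theorem map_matrixForm {R : Type*} [Field R] (f : R →+* k) (q : Matrix (Fin 4) (Fin 4) R) :
    MvPolynomial.map f (matrixForm q) = matrixForm (q.map f) := by
  simp [matrixForm]

theorem map_dualForm {R : Type*} [Field R] (f : R →+* k) (r : Fin 4 → R) :
    MvPolynomial.map f (dualForm r) = dualForm fun j => f (r j) := by
  simp [dualForm]

theorem isDefinedOver_conicSet {M : IntermediateField K (AlgebraicClosure K)} (r : Fin 4 → M)
    (q : Matrix (Fin 4) (Fin 4) M) :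
    IsDefinedOver M (conicSet (fun j => (r j : AlgebraicClosure K))
      (q.map (algebraMap M (AlgebraicClosure K)))) := by
  refine ⟨{dualForm r, matrixForm q}, ?_, ?_⟩
  · rintro F (rfl | rfl)
    exacts [⟨1, dualForm_isHomogeneous r⟩, ⟨2, matrixForm_isHomogeneous q⟩]
  · ext x
    simp only [conicSet, zeroLocus, Set.mem_ofPred_eq, Set.image_pair, Set.mem_insert_iff,
      Set.mem_singleton_iff, forall_eq_or_imp, forall_eq, map_dualForm, map_matrixForm,
      eval_dualForm, eval_matrixForm]
    rfl

/-- The ratios r_j/r₀ and η/r₀⁶ are invariant under weighted rescaling, hence fixed by all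
automorphisms over the radical field, and they describe the same conic. -/
theorem isDefinedOver_radicalField [CharZero K] {p : Fin 5 → K} (hΔ : segreCubic p ≠ 0)
    (hf : ∀ j, singularForm p j ≠ 0) {m : Fin 10} {r : Fin 4 → AlgebraicClosure K}
    {η : AlgebraicClosure K} (h : IsBase m (fun j => algebraMap K (AlgebraicClosure K) (p j)) r η) :
    IsDefinedOver (radicalField p) (twistedConic m r η) := by
  have h0 := h.good.2 0
  have hr (j : Fin 4) : r j / r 0 ∈ radicalField p := by
    refine mem_of_forall_fixed _ fun σ => ?_
    obtain ⟨t, ht, h1, -⟩ := h.exists_smul_of_fixed hΔ hf σ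
    rw [map_div₀, h1, h1, mul_div_mul_left _ _ ht]
  have hη : η / r 0 ^ 6 ∈ radicalField p := by
    refine mem_of_forall_fixed _ fun σ => ?_
    obtain ⟨t, ht, h1, h2⟩ := h.exists_smul_of_fixed hΔ hf σ
    rw [map_div₀, map_pow, h1, h2, mul_pow, mul_div_mul_left _ _ (pow_ne_zero 6 ht)]
  let L := radicalField p
  let r' : Fin 4 → L := fun j => ⟨r j / r 0, hr j⟩
  let η' : L := ⟨η / r 0 ^ 6, hη⟩
  have hZ : twistedConic m r η =
      twistedConic m (fun j => (r' j : AlgebraicClosure K)) (η' : AlgebraicClosure K) := by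
    refine Eq.trans ?_ (twistedConic_smul h0)
    congr 1
    · ext j
      exact (mul_div_cancel₀ _ h0).symm
    · exact (mul_div_cancel₀ _ (pow_ne_zero 6 h0)).symm
  rw [hZ, twistedConic]
  have := isDefinedOver_conicSet (twist L (nodeTwist m) *ᵥ r')
    (twist L (nodeTwist m) * diagonal (conicCoeff (nodeDiag m) r' η') * twist L (nodeTwist m))
  convert this using 2
  · ext j
    have := RingHom.map_mulVec (algebraMap L (AlgebraicClosure K)) (twist L (nodeTwist m)) r' j
    rw [map_twist] at this
    exact this.symm
  · rw [Matrix.map_mul, Matrix.map_mul, map_twist, diagonal_map (map_zero _)]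
    congr 3
    ext j
    exact (map_conicCoeff (algebraMap L (AlgebraicClosure K)) _ r' η' j).symm

theorem IsGeneric.isFieldOfDefinition [CharZero K] {p : Fin 5 → K}
    (h : IsGeneric fun j => algebraMap K (AlgebraicClosure K) (p j)) (hΔ : segreCubic p ≠ 0)
    (hf : ∀ j, singularForm p j ≠ 0) : IsFieldOfDefinition p (radicalField p) := by
  refine ⟨fun Z hZ => ?_, fun M hM => h.radicalField_le hM⟩
  obtain ⟨m, r, η, hb, rfl⟩ := (h.mem_conics_iff Z).1 hZ
  exact isDefinedOver_radicalField hΔ hf hb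

end FieldOfDefinition

end HeisenbergQuartic

namespace HeisenbergQuartic

/-! ### The form that defines the open set U. -/

section Genericity

variable {R S : Type*} [CommRing R] [CommRing S]

/-- A multiple of the third point of the Segre cubic on the line through `p` and the `m`-th node. -/
def thirdVector (m : Fin 10) (p : Fin 5 → R) : Fin 5 → R :=
  segrePolar m p • p - segreCubic p • node m

/-- The factor of `genericity` that is attached to the `m`-th node. -/
def nodeGenericity (m : Fin 10) (p : Fin 5 → R) : R :=
  segrePolar m p * nieto (twistParam (nodeTwist m) p) *
    (thirdVector m p 1 * twistParam (nodeTwist m) (thirdVector m p) 1) *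
    ∏ j, (singularForm (thirdVector m p) j *
      singularForm (twistParam (nodeTwist m) (thirdVector m p)) j)

/-- A form on the parameter space outside of whose zero set the construction of the conics does
not degenerate. -/
def genericity (p : Fin 5 → R) : R := ∏ m, nodeGenericity m p

theorem map_segrePolar (f : R →+* S) (m : Fin 10) (p : Fin 5 → R) :
    f (segrePolar m p) = segrePolar m fun a => f (p a) := by
  simp [segrePolar, map_node, map_ofNat f 48, map_ofNat f 4, map_ofNat f 2, map_ofNat f 8]

theorem map_nieto (f : R →+* S) (p : Fin 5 → R) : f (nieto p) = nieto fun a => f (p a) := by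
  simp [nieto, map_ofNat f 64, map_ofNat f 4, map_ofNat f 256, map_ofNat f 16, map_ofNat f 8]

theorem map_thirdVector (f : R →+* S) (m : Fin 10) (p : Fin 5 → R) (j : Fin 5) :
    f (thirdVector m p j) = thirdVector m (fun a => f (p a)) j := by
  simp [thirdVector, map_segrePolar, map_segreCubic, map_node]

theorem map_nodeGenericity (f : R →+* S) (m : Fin 10) (p : Fin 5 → R) :
    f (nodeGenericity m p) = nodeGenericity m fun a => f (p a) := by
  simp only [nodeGenericity, map_mul, map_prod, map_segrePolar, map_nieto, map_twistParam,
    map_singularForm, map_thirdVector]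

theorem map_genericity (f : R →+* S) (p : Fin 5 → R) :
    f (genericity p) = genericity fun a => f (p a) := by
  simp only [genericity, map_prod, map_nodeGenericity]

theorem nieto_smul (c : R) (p : Fin 5 → R) : nieto (c • p) = c ^ 5 * nieto p := by
  simp [nieto]
  ring

theorem thirdVector_smul (c : R) (m : Fin 10) (p : Fin 5 → R) :
    thirdVector m (c • p) = c ^ 3 • thirdVector m p := by
  ext j
  simp [thirdVector, segrePolar_smul, segreCubic_smul]
  ring

/-- The exponent is 2 + 5 + (3 + 3) + 15·(3 + 3), as `thirdVector` is cubic and the twists are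
linear; ten nodes give 1030. -/
theorem nodeGenericity_smul (c : R) (m : Fin 10) (p : Fin 5 → R) :
    nodeGenericity m (c • p) = c ^ 103 * nodeGenericity m p := by
  simp only [nodeGenericity, thirdVector_smul, twistParam_smul, singularForm_smul, nieto_smul,
    segrePolar_smul, Pi.smul_apply, smul_eq_mul, Finset.prod_mul_distrib, Finset.prod_const,
    Finset.card_univ, Fintype.card_fin]
  ring

theorem genericity_smul (c : R) (p : Fin 5 → R) :
    genericity (c • p) = c ^ 1030 * genericity p := by
  simp only [genericity, nodeGenericity_smul, Finset.prod_mul_distrib, Finset.prod_const,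
    Finset.card_univ, Fintype.card_fin, ← pow_mul]

theorem genericity_ne_zero : genericity (![1, 3, 7, 12, 26] : Fin 5 → ℤ) ≠ 0 := by
  refine Finset.prod_ne_zero_iff.2 fun m _ => mul_ne_zero ?_ (Finset.prod_ne_zero_iff.2 fun j _ => ?_)
  · revert m
    decide +kernel
  · revert m j
    decide +kernel

/-- For fixed `x` the scaling law is an identity of polynomials in `c`; comparing coefficients kills
every homogeneous component of degree other than `d`. This spares expanding a form of degree 1030.
-/
theorem isHomogeneous_of_eval_smul {n d : ℕ} {k : Type*} [Field k] [Infinite k]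
    {F : MvPolynomial (Fin n) k}
    (h : ∀ (c : k) (x : Fin n → k), MvPolynomial.eval (c • x) F = c ^ d * MvPolynomial.eval x F) :
    F.IsHomogeneous d := by
  have hsmul (c : k) (x : Fin n → k) : MvPolynomial.eval (c • x) F =
      ∑ i ∈ Finset.range (F.totalDegree + 1),
        c ^ i * MvPolynomial.eval x (F.homogeneousComponent i) := by
    conv_lhs => rw [← F.sum_homogeneousComponent, map_sum]
    exact Finset.sum_congr rfl fun i _ =>
      eval_smul_of_isHomogeneous (MvPolynomial.homogeneousComponent_isHomogeneous i F) c x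
  have hz (i : ℕ) (hi : i ∈ Finset.range (F.totalDegree + 1)) (hid : i ≠ d) :
      F.homogeneousComponent i = 0 := by
    refine MvPolynomial.funext fun x => ?_
    have hQ : ∑ i ∈ Finset.range (F.totalDegree + 1),
        Polynomial.monomial i (MvPolynomial.eval x (F.homogeneousComponent i)) =
        Polynomial.monomial d (MvPolynomial.eval x F) := by
      refine Polynomial.funext fun c => ?_
      rw [Polynomial.eval_finsetSum, Polynomial.eval_monomial, mul_comm, ← h, hsmul]
      exact Finset.sum_congr rfl fun i _ => by rw [Polynomial.eval_monomial, mul_comm]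
    have := congrArg (fun Q => Q.coeff i) hQ
    simp only [Polynomial.finsetSum_coeff, Polynomial.coeff_monomial, if_neg hid.symm] at this
    rw [Finset.sum_ite_eq' _ i, if_pos hi] at this
    rw [this, map_zero]
  rw [← F.sum_homogeneousComponent]
  refine MvPolynomial.IsHomogeneous.sum _ _ _ fun i hi => ?_
  by_cases hid : i = d
  · exact hid ▸ MvPolynomial.homogeneousComponent_isHomogeneous i F
  · rw [hz i hi hid]
    exact MvPolynomial.isHomogeneous_zero _ _ _

/-- The genericity form as a polynomial. -/
noncomputable def genericityPoly : MvPolynomial (Fin 5) ℚ := genericity MvPolynomial.X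

theorem aeval_genericityPoly {K : Type*} [Field K] [CharZero K] (p : Fin 5 → K) :
    MvPolynomial.aeval p genericityPoly = genericity p := by
  refine (map_genericity (MvPolynomial.aeval p : MvPolynomial (Fin 5) ℚ →ₐ[ℚ] K).toRingHom
    MvPolynomial.X).trans ?_
  simp

theorem genericityPoly_isHomogeneous : genericityPoly.IsHomogeneous 1030 := by
  refine isHomogeneous_of_eval_smul fun c x => ?_
  have h (x : Fin 5 → ℚ) : MvPolynomial.eval x genericityPoly = genericity x :=
    aeval_genericityPoly x
  rw [h, h, genericity_smul]

theorem genericityPoly_ne_zero : genericityPoly ≠ 0 := by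
  intro h0
  have h1 := aeval_genericityPoly (fun j => ((![1, 3, 7, 12, 26] : Fin 5 → ℤ) j : ℚ))
  rw [h0, map_zero] at h1
  have h2 := map_genericity (Int.castRingHom ℚ) ![1, 3, 7, 12, 26]
  exact genericity_ne_zero (Int.cast_injective (h2.trans h1.symm |>.trans Int.cast_zero.symm))

theorem isGeneric_of_genericity_ne_zero {k : Type*} [Field k] {p : Fin 5 → k}
    (hΔ : segreCubic p ≠ 0) (hf : ∀ j, singularForm p j ≠ 0) (hg : genericity p ≠ 0) :
    IsGeneric p := by
  have hm (m : Fin 10) : nodeGenericity m p ≠ 0 := Finset.prod_ne_zero_iff.1 hg m (Finset.mem_univ m)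
  have hs {m : Fin 10} {s : Fin 5 → k} (h : IsThirdPoint p m s) :
      thirdVector m p = segrePolar m p • s := by
    obtain ⟨⟨c, rfl⟩, hc⟩ := h
    rw [segreCubic_add_smul_node] at hc
    ext j
    simp [thirdVector]
    linear_combination -node m j * hc
  refine ⟨hΔ, hf, fun m h0 => hm m ?_, fun m s h => ⟨fun j h0 => hm m ?_, fun h0 => hm m ?_⟩,
    fun m s h => ⟨fun j h0 => hm m ?_, fun h0 => hm m ?_⟩, fun m h0 => hm m ?_⟩
  · rw [nodeGenericity, h0]
    simp
  · refine mul_eq_zero_of_right _ (Finset.prod_eq_zero (Finset.mem_univ j) ?_)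
    rw [hs h, singularForm_smul, h0]
    simp
  · rw [nodeGenericity, hs h]
    simp [h0]
  · refine mul_eq_zero_of_right _ (Finset.prod_eq_zero (Finset.mem_univ j) ?_)
    rw [hs h, twistParam_smul, singularForm_smul, singularForm_smul, h0]
    simp
  · rw [nodeGenericity, hs h, twistParam_smul]
    simp [h0]
  · rw [nodeGenericity, h0]
    simp

theorem conics_of_genericity {K : Type*} [Field K] [CharZero K] {p : Fin 5 → K}
    (hΔ : segreCubic p ≠ 0) (hf : ∀ j, singularForm p j ≠ 0) (hg : genericity p ≠ 0) :
    (conics fun j => algebraMap K (AlgebraicClosure K) (p j)).ncard = 320 ∧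
      IsFieldOfDefinition p (radicalField p) := by
  have h : IsGeneric fun j => algebraMap K (AlgebraicClosure K) (p j) := by
    refine isGeneric_of_genericity_ne_zero ?_ (fun j => ?_) ?_
    · rw [← map_segreCubic]
      simpa using hΔ
    · rw [← map_singularForm]
      simpa using hf j
    · rw [← map_genericity]
      simpa using hg
  exact ⟨h.ncard_conics, h.isFieldOfDefinition hΔ hf⟩

end Genericity

end HeisenbergQuartic

namespace HeisenbergQuartic

/-! ### Order of vanishing at the origin of a line. -/

section Order

open Polynomial

variable {k : Type*} [Field k]

/-- The polynomial `G` vanishes at `0` to the order `n`. -/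
def HasOrder (n : ℕ) (G : k[X]) : Prop := ∃ H : k[X], G = X ^ n * H ∧ H.eval 0 ≠ 0

theorem hasOrder_zero {G : k[X]} (h : G.eval 0 ≠ 0) : HasOrder 0 G := ⟨G, by simp, h⟩

theorem HasOrder.mul {n m : ℕ} {F G : k[X]} (hF : HasOrder n F) (hG : HasOrder m G) :
    HasOrder (n + m) (F * G) := by
  obtain ⟨F', rfl, hF'⟩ := hF
  obtain ⟨G', rfl, hG'⟩ := hG
  exact ⟨F' * G', by ring, by rw [eval_mul]; exact mul_ne_zero hF' hG'⟩

theorem HasOrder.prod {ι : Type*} (s : Finset ι) {n : ι → ℕ} {F : ι → k[X]}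
    (h : ∀ i ∈ s, HasOrder (n i) (F i)) : HasOrder (∑ i ∈ s, n i) (∏ i ∈ s, F i) := by
  classical
  induction s using Finset.induction_on with
  | empty => exact hasOrder_zero (by simp)
  | insert a s ha ih =>
    rw [Finset.sum_insert ha, Finset.prod_insert ha]
    exact (h a (Finset.mem_insert_self a s)).mul
      (ih fun i hi => h i (Finset.mem_insert_of_mem hi))

theorem HasOrder.natTrailingDegree_eq {n : ℕ} {G : k[X]} (h : HasOrder n G) :
    G ≠ 0 ∧ G.natTrailingDegree = n := by
  obtain ⟨H, rfl, hH⟩ := h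
  have h0 : H ≠ 0 := by rintro rfl; simp at hH
  have h1 : H.natTrailingDegree = 0 :=
    natTrailingDegree_eq_zero.2 (Or.inr (by rwa [coeff_zero_eq_eval_zero]))
  exact ⟨mul_ne_zero (pow_ne_zero _ X_ne_zero) h0, by
    rw [natTrailingDegree_mul (pow_ne_zero _ X_ne_zero) h0, h1, natTrailingDegree_X_pow, add_zero]⟩

theorem HasOrder.even_of_isSquare {n : ℕ} {G : k[X]} (h : HasOrder n G) (hG : IsSquare G) :
    Even n := by
  obtain ⟨h0, h1⟩ := h.natTrailingDegree_eq
  obtain ⟨c, rfl⟩ := hG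
  have hc : c ≠ 0 := by rintro rfl; simp at h0
  rw [natTrailingDegree_mul hc hc] at h1
  exact ⟨_, h1.symm⟩

end Order

/-! ### Independence of the radicands modulo squares of polynomials. -/

section Independence

/-- For each singular form, a point of the affine chart at which it is the only vanishing form. -/
def linePoint : Fin 15 → Fin 5 → ℤ :=
  ![0, ![1, -1, -2, 0, 0], ![1, 0, 2, -1, 0], ![1, 0, 1, -2, 0], ![1, 0, 1, 2, 0],
    ![1, 0, -1, 0, -2], ![1, 0, 0, -1, 2], ![1, 2, -1, -1, -1], ![1, 2, -1, 1, 1],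
    ![1, 2, 1, -1, 1], ![1, 2, 1, 1, -1], ![1, -2, -1, -1, -1], ![1, -2, -1, 1, 1],
    ![1, 2, -1, -3, -1], ![1, -2, 1, 1, -1]]

/-- For each singular form, a direction that is transversal to its zero set. -/
def lineDir : Fin 15 → Fin 5 → ℤ :=
  ![0, ![0, 0, 1, 0, 0], ![0, 0, 1, 0, 0], ![0, 0, 0, 1, 0], ![0, 0, 0, 1, 0],
    ![0, 0, 0, 0, 1], ![0, 0, 0, 0, 1], ![0, 1, 0, 0, 0], ![0, 1, 0, 0, 0], ![0, 1, 0, 0, 0],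
    ![0, 1, 0, 0, 0], ![0, 1, 0, 0, 0], ![0, 1, 0, 0, 0], ![0, 1, 0, 0, 0], ![0, 1, 0, 0, 0]]

theorem singularForm_linePoint (l : Fin 15) (hl : l ≠ 0) (i : Fin 15) :
    singularForm (linePoint l) i = 0 ↔ i = l := by
  revert l i; decide +kernel

theorem segreCubic_linePoint (l : Fin 15) (hl : l ≠ 0) : segreCubic (linePoint l) ≠ 0 := by
  revert l; decide +kernel

theorem singularForm_lineDir (l : Fin 15) (hl : l ≠ 0) : singularForm (lineDir l) l ≠ 0 := by
  revert l; decide +kernel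

/-- The index of a radicand as a syntheme. -/
def radicandSyntheme (j : Fin 10) : Fin 15 := Fin.castLE (by norm_num) j

/-- Independence over F₂ of the ten exponent vectors. The form A, with index 0, is left out since it
is constant on the chart A = 1; the other fourteen suffice. -/
theorem exists_odd_order (s : Finset (Fin 10)) (hs : s.Nonempty) : ∃ l : Fin 15, l ≠ 0 ∧
    Odd (∑ j ∈ s, ∑ t, if synthemeForms (radicandSyntheme j) t = l then 1 else 0) := by
  revert s; decide +kernel

variable {k : Type*} [Field k]

open Polynomial

/-- A line through `linePoint l` with direction `lineDir l`. -/
noncomputable def line (k : Type*) [Field k] (l : Fin 15) (a : Fin 5) : k[X] :=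
  C (linePoint l a : k) + C (lineDir l a : k) * X

theorem eval_singularForm_line (l i : Fin 15) :
    (singularForm (line k l) i).eval 0 = ((singularForm (linePoint l) i : ℤ) : k) := by
  have h1 := map_singularForm (Polynomial.evalRingHom (0 : k)) (line k l) i
  have h2 := map_singularForm (Int.castRingHom k) (linePoint l) i
  simp only [coe_evalRingHom] at h1
  rw [h1]
  refine Eq.trans ?_ h2.symm
  simp [line]

theorem eval_segreCubic_line (l : Fin 15) :
    (segreCubic (line k l)).eval 0 = ((segreCubic (linePoint l) : ℤ) : k) := by
  have h1 := map_segreCubic (Polynomial.evalRingHom (0 : k)) (line k l)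
  have h2 := map_segreCubic (Int.castRingHom k) (linePoint l)
  simp only [coe_evalRingHom] at h1
  rw [h1]
  refine Eq.trans ?_ h2.symm
  simp [line]

theorem hasOrder_singularForm_line [CharZero k] (l : Fin 15) (hl : l ≠ 0) (i : Fin 15) :
    HasOrder (if i = l then 1 else 0) (singularForm (line k l) i) := by
  split_ifs with h
  · subst h
    have hP : line k i = (fun a => C (linePoint i a : k)) +
        (X : k[X]) • fun a => C (lineDir i a : k) := by
      ext1 a
      simp only [line, Pi.add_apply, Pi.smul_apply, smul_eq_mul]
      ring
    have hc (v : Fin 5 → ℤ) : singularForm (fun a => C (v a : k)) i =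
        C ((singularForm v i : ℤ) : k) :=
      (map_singularForm ((C : k →+* k[X]).comp (Int.castRingHom k)) v i).symm
    refine ⟨C ((singularForm (lineDir i) i : ℤ) : k), ?_, ?_⟩
    · rw [hP, singularForm_add, singularForm_smul, hc, hc, (singularForm_linePoint i hl i).2 rfl]
      simp
    · rw [eval_C, Int.cast_ne_zero]
      exact singularForm_lineDir i hl
  · refine hasOrder_zero ?_
    rw [eval_singularForm_line, Int.cast_ne_zero]
    exact fun h0 => h ((singularForm_linePoint l hl i).1 h0)

theorem hasOrder_radicand_line [CharZero k] (l : Fin 15) (hl : l ≠ 0) (j : Fin 10) :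
    HasOrder (∑ t, if synthemeForms (radicandSyntheme j) t = l then 1 else 0)
      (radicand (line k l) j) := by
  rw [← syntheme_castLE, syntheme, ← zero_add (∑ t, _)]
  refine HasOrder.mul (hasOrder_zero ?_)
    (HasOrder.prod _ fun t _ => hasOrder_singularForm_line l hl _)
  rw [eval_mul, eval_segreCubic_line]
  refine mul_ne_zero ?_ (Int.cast_ne_zero.2 (segreCubic_linePoint l hl))
  have h : synthemeSign (Fin.castLE (by norm_num) j) ≠ 0 := by
    revert j; decide
  rw [eval_intCast, Int.cast_ne_zero]
  exact h

/-- No product of distinct radicands is a square in the ring of polynomials on the affine chart. -/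
theorem not_isSquare_prod_radicand [CharZero k] (s : Finset (Fin 10)) (hs : s.Nonempty) :
    ¬IsSquare (∏ j ∈ s, radicand (Matrix.vecCons 1 MvPolynomial.X :
      Fin 5 → MvPolynomial (Fin 4) k) j) := by
  intro hsq
  obtain ⟨l, hl, hodd⟩ := exists_odd_order s hs
  -- Restriction to a line meeting only the hyperplane of index `l` at its origin, where Δ is
  -- nonzero. It preserves squares, so an odd order of vanishing is a contradiction.
  let f : MvPolynomial (Fin 4) k →+* k[X] :=
    (MvPolynomial.aeval fun a : Fin 4 => line k l a.succ).toRingHom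
  have hf : (fun a => f ((Matrix.vecCons 1 MvPolynomial.X :
      Fin 5 → MvPolynomial (Fin 4) k) a)) = line k l := by
    ext1 a
    refine Fin.cases ?_ (fun a => ?_) a
    · have h1 : ∀ l : Fin 15, l ≠ 0 → linePoint l 0 = 1 ∧ lineDir l 0 = 0 := by decide +kernel
      simp [line, h1 l hl]
    · simp [f]
  have h := hsq.map f
  rw [map_prod] at h
  simp only [map_radicand, hf] at h
  exact Nat.not_even_iff_odd.2 hodd
    ((HasOrder.prod s fun j _ => hasOrder_radicand_line l hl j).even_of_isSquare h)

end Independence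

/-! ### The thin set of parameters with dependent radicands. -/

section ThinSet

open Polynomial

variable {K : Type*} [Field K]

theorem radicand_smul (c : K) (p : Fin 5 → K) (j : Fin 10) :
    radicand (c • p) j = c ^ 6 * radicand p j := by
  rw [← syntheme_castLE, ← syntheme_castLE, syntheme, syntheme, segreCubic_smul]
  simp only [singularForm_smul, Finset.prod_mul_distrib, Finset.prod_const, Finset.card_univ,
    Fintype.card_fin]
  ring

/-- The points for which the radicands are not independent modulo squares. -/
def dependentLocus (K : Type*) [Field K] : Set (ℙ K (Fin 5 → K)) :=
  {x | ∃ s : Finset (Fin 10), s.Nonempty ∧ IsSquare (∏ j ∈ s, radicand x.rep j)}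

theorem mk_mem_dependentLocus (p : Fin 5 → K) (hp : p ≠ 0) :
    Projectivization.mk K p hp ∈ dependentLocus K ↔
      ∃ s : Finset (Fin 10), s.Nonempty ∧ IsSquare (∏ j ∈ s, radicand p j) := by
  obtain ⟨a, ha⟩ := Projectivization.exists_smul_eq_mk_rep K p hp
  rw [dependentLocus, Set.mem_ofPred_eq]
  refine exists_congr fun s => and_congr_right fun _ => ?_
  rw [← ha, Units.smul_def]
  simp only [radicand_smul, Finset.prod_mul_distrib, Finset.prod_const]
  have ha0 : (a : K) ^ 3 ≠ 0 := pow_ne_zero _ a.ne_zero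
  constructor
  · rintro ⟨y, hy⟩
    refine ⟨y / ((a : K) ^ 3) ^ s.card, ?_⟩
    have h0 : ((a : K) ^ 3) ^ s.card ≠ 0 := pow_ne_zero _ ha0
    field_simp
    linear_combination hy
  · rintro ⟨y, hy⟩
    refine ⟨((a : K) ^ 3) ^ s.card * y, ?_⟩
    rw [hy]
    ring

/-- A square root in the fraction field is integral over A and hence lies in A. -/
theorem irreducible_X_sq_sub_C {A : Type*} [CommRing A] [IsDomain A] [IsIntegrallyClosed A] {a : A}
    (ha : ¬IsSquare a) :
    Irreducible ((X ^ 2 - C a : A[X]).map (algebraMap A (FractionRing A))) := by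
  rw [Polynomial.map_sub, Polynomial.map_pow, map_X, map_C]
  refine X_pow_sub_C_irreducible_of_prime Nat.prime_two fun b hb => ha ?_
  obtain ⟨c, rfl⟩ := IsIntegrallyClosed.exists_algebraMap_eq_of_isIntegral_pow (R := A) two_pos
    (by rw [hb]; exact isIntegral_algebraMap)
  refine ⟨c, IsFractionRing.injective A (FractionRing A) ?_⟩
  rw [← hb, map_mul, sq]

theorem isThin_dependentLocus [CharZero K] : IsThin (dependentLocus K) := by
  classical
  let F (s : Finset (Fin 10)) : MvPolynomial (Fin 4) K :=
    ∏ j ∈ s, radicand (Matrix.vecCons 1 MvPolynomial.X) j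
  refine ⟨1, (Finset.univ.filter Finset.Nonempty).image fun s => X ^ 2 - C (F s), one_ne_zero, ?_, ?_⟩
  · intro G hG
    obtain ⟨s, hs, rfl⟩ := Finset.mem_image.1 hG
    refine ⟨(natDegree_X_pow_sub_C).ge, irreducible_X_sq_sub_C ?_⟩
    exact not_isSquare_prod_radicand s (Finset.mem_filter.1 hs).2
  · intro t ht
    obtain ⟨s, hs, y, hy⟩ := (mk_mem_dependentLocus _ _).1 ht
    refine Or.inr ⟨_, Finset.mem_image_of_mem _ (Finset.mem_filter.2 ⟨Finset.mem_univ s, hs⟩), y, ?_⟩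
    have hv : (fun a => MvPolynomial.eval t ((Matrix.vecCons 1 MvPolynomial.X :
        Fin 5 → MvPolynomial (Fin 4) K) a)) = Matrix.vecCons 1 t := by
      ext1 a
      refine Fin.cases ?_ (fun a => ?_) a <;> simp
    have hF : MvPolynomial.eval t (F s) = ∏ j ∈ s, radicand (Matrix.vecCons 1 t) j := by
      rw [map_prod]
      simp only [map_radicand, hv]
    rw [Polynomial.map_sub, Polynomial.map_pow, map_X, map_C, eval_sub, eval_pow, eval_X, eval_C]
    erw [hF]
    rw [hy]
    ring

end ThinSet

/-! ### Kummer theory for square roots. -/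

section Multiquadratic

/-- A proper subspace over F₂ is killed by a nonzero linear functional, and `s` is the support of
its coefficients. -/
theorem exists_sum_eq_zero_of_ne_top {n : ℕ} (V : AddSubgroup (Fin n → ZMod 2)) (hV : V ≠ ⊤) :
    ∃ s : Finset (Fin n), s.Nonempty ∧ ∀ x ∈ V, ∑ j ∈ s, x j = 0 := by
  have hlt : AddSubgroup.toZModSubmodule 2 V < ⊤ := by
    rw [lt_top_iff_ne_top]
    intro h
    apply hV
    ext x
    simp [← AddSubgroup.mem_toZModSubmodule (n := 2), h]
  obtain ⟨f, hf0, hf⟩ := Submodule.exists_le_ker_of_lt_top _ hlt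
  have hfx (x : Fin n → ZMod 2) : f x = ∑ j, x j * f (Pi.single j 1) := by
    conv_lhs => rw [pi_eq_sum_univ' x]
    simp [map_sum]
  refine ⟨Finset.univ.filter fun j => f (Pi.single j 1) = 1, ?_, fun x hx => ?_⟩
  · by_contra hne
    rw [Finset.not_nonempty_iff_eq_empty, Finset.filter_eq_empty_iff] at hne
    apply hf0
    refine LinearMap.ext fun x => ?_
    rw [hfx, LinearMap.zero_apply]
    refine Finset.sum_eq_zero fun j _ => ?_
    have h01 : ∀ z : ZMod 2, z ≠ 1 → z = 0 := by decide
    rw [h01 _ (hne (Finset.mem_univ j)), mul_zero]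
  · have h1 : f x = 0 := hf hx
    rw [hfx] at h1
    rw [Finset.sum_filter]
    refine Eq.trans (Finset.sum_congr rfl fun j _ => ?_) h1
    have h01 : ∀ y z : ZMod 2, (if y = 1 then z else 0) = z * y := by decide
    exact h01 _ _

variable {K : Type*} [Field K] [CharZero K] {n : ℕ}

theorem isGalois_adjoin_sqrt (r : Fin n → K) :
    IsGalois K (IntermediateField.adjoin K
      {t : AlgebraicClosure K | ∃ j, t ^ 2 = algebraMap K (AlgebraicClosure K) (r j)}) := by
  have : Normal K (IntermediateField.adjoin K
      {t : AlgebraicClosure K | ∃ j, t ^ 2 = algebraMap K (AlgebraicClosure K) (r j)}) := by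
    rw [IntermediateField.normal_iff_forall_map_le]
    intro σ
    rw [IntermediateField.adjoin_map, IntermediateField.adjoin_le_iff]
    rintro _ ⟨t, ⟨j, hj⟩, rfl⟩
    refine IntermediateField.subset_adjoin _ _ ⟨j, ?_⟩
    exact (map_pow σ t 2).symm.trans ((congrArg σ hj).trans (σ.commutes _))
  exact ⟨⟩

/-- The Galois group of a field generated by independent square roots. -/
theorem nonempty_mulEquiv_of_independent (r : Fin n → K) (hr : ∀ j, r j ≠ 0)
    (hi : ∀ s : Finset (Fin n), s.Nonempty → ¬IsSquare (∏ j ∈ s, r j))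
    (L : IntermediateField K (AlgebraicClosure K))
    (hL : L = IntermediateField.adjoin K
      {t : AlgebraicClosure K | ∃ j, t ^ 2 = algebraMap K (AlgebraicClosure K) (r j)}) :
    IsGalois K L ∧ Nonempty ((L ≃ₐ[K] L) ≃* (Fin n → Multiplicative (ZMod 2))) := by
  have hgal : IsGalois K L := hL ▸ isGalois_adjoin_sqrt r
  refine ⟨hgal, ?_⟩
  choose a ha using fun j => IsAlgClosed.exists_pow_nat_eq
    (algebraMap K (AlgebraicClosure K) (r j)) two_pos
  have haL (j : Fin n) : a j ∈ L := hL ▸ IntermediateField.subset_adjoin _ _ ⟨j, ha j⟩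
  let b (j : Fin n) : L := ⟨a j, haL j⟩
  have hb (j : Fin n) : b j ^ 2 = algebraMap K L (r j) := Subtype.ext (ha j)
  have hb0 (j : Fin n) : b j ≠ 0 := by
    intro h0
    have := hb j
    rw [h0] at this
    rw [zero_pow two_ne_zero, eq_comm, map_eq_zero] at this
    exact hr j this
  have hsign (σ : L ≃ₐ[K] L) (j : Fin n) : ∃ z : ZMod 2, σ (b j) = (-1) ^ z.val * b j := by
    have : (σ (b j)) ^ 2 = b j ^ 2 := by rw [← map_pow, hb, AlgEquiv.commutes]
    rcases sq_eq_sq_iff_eq_or_eq_neg.1 this with h | h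
    exacts [⟨0, by simp [h]⟩, ⟨1, by simp [h, ZMod.val_one]⟩]
  choose z hz using hsign
  have hpow (y y' : ZMod 2) : (-1 : L) ^ (y + y').val = (-1) ^ y.val * (-1) ^ y'.val := by
    rw [ZMod.val_add, ← pow_add, ← neg_one_pow_eq_pow_mod_two]
  have hinj (y y' : ZMod 2) (h : (-1 : L) ^ y.val = (-1) ^ y'.val) : y = y' := by
    have h01 : ∀ y : ZMod 2, y = 0 ∨ y = 1 := by decide
    have h1 : (-1 : L) ≠ 1 := by norm_num
    rcases h01 y with rfl | rfl <;> rcases h01 y' with rfl | rfl <;>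
      simp [ZMod.val_one, h1, h1.symm] at h ⊢
  have hmul (σ τ : L ≃ₐ[K] L) (j : Fin n) : z (σ * τ) j = z σ j + z τ j := by
    apply hinj
    apply mul_right_cancel₀ (hb0 j)
    rw [← hz, AlgEquiv.mul_apply, hz τ, map_mul, map_pow, map_neg, map_one, hz σ, hpow]
    ring
  let Φ : (L ≃ₐ[K] L) →* (Fin n → Multiplicative (ZMod 2)) :=
    MonoidHom.mk' (fun σ j => Multiplicative.ofAdd (z σ j)) fun σ τ => by
      ext1 j
      rw [hmul, ofAdd_add, Pi.mul_apply]
  have hΦinj : Function.Injective Φ := by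
    intro σ τ h
    have hgen (j : Fin n) : σ (b j) = τ (b j) := by
      rw [hz, hz, show z σ j = z τ j from congrFun h j]
    have key (x : AlgebraicClosure K) (hx : x ∈ L) : σ ⟨x, hx⟩ = τ ⟨x, hx⟩ := by
      have hx' := hx
      rw [hL] at hx'
      induction hx' using IntermediateField.adjoin_induction with
      | mem x hx1 =>
        obtain ⟨j, hj⟩ := hx1
        rw [← ha j] at hj
        rcases sq_eq_sq_iff_eq_or_eq_neg.1 hj with rfl | rfl
        · exact hgen j
        · have : (⟨-a j, hx⟩ : L) = -b j := rfl
          rw [this, map_neg, map_neg, hgen]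
      | algebraMap x => exact (σ.commutes x).trans (τ.commutes x).symm
      | add x y hx1 hy1 ihx ihy =>
        rw [← hL] at hx1 hy1
        exact (map_add σ ⟨x, hx1⟩ ⟨y, hy1⟩).trans
          ((congrArg₂ (· + ·) (ihx hx1) (ihy hy1)).trans (map_add τ ⟨x, hx1⟩ ⟨y, hy1⟩).symm)
      | inv x hx1 ihx =>
        rw [← hL] at hx1
        exact (map_inv₀ σ ⟨x, hx1⟩).trans
          ((congrArg (·⁻¹) (ihx hx1)).trans (map_inv₀ τ ⟨x, hx1⟩).symm)
      | mul x y hx1 hy1 ihx ihy =>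
        rw [← hL] at hx1 hy1
        exact (map_mul σ ⟨x, hx1⟩ ⟨y, hy1⟩).trans
          ((congrArg₂ (· * ·) (ihx hx1) (ihy hy1)).trans (map_mul τ ⟨x, hx1⟩ ⟨y, hy1⟩).symm)
    exact AlgEquiv.ext fun x => key x x.2
  -- If the sign vectors did not fill the whole space, a relation among them would make some
  -- nonempty product of the square roots invariant, hence an element of K whose square is the
  -- product of the corresponding radicands.
  have hΦsurj : Function.Surjective Φ := by
    let V : AddSubgroup (Fin n → ZMod 2) :=
      { carrier := Set.range z
        add_mem' := by
          rintro _ _ ⟨σ, rfl⟩ ⟨τ, rfl⟩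
          exact ⟨σ * τ, funext fun j => hmul σ τ j⟩
        zero_mem' := ⟨1, funext fun j => by simpa using hmul 1 1 j⟩
        neg_mem' := by
          rintro _ ⟨σ, rfl⟩
          exact ⟨σ, funext fun j => (ZMod.neg_eq_self_mod_two _).symm⟩ }
    have hV : V = ⊤ := by
      by_contra hne
      obtain ⟨s, hs, hsum⟩ := exists_sum_eq_zero_of_ne_top V hne
      have hfix (σ : L ≃ₐ[K] L) : σ (∏ j ∈ s, b j) = ∏ j ∈ s, b j := by
        have hprod (u : Finset (Fin n)) : ∏ j ∈ u, (-1 : L) ^ (z σ j).val =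
            (-1) ^ (∑ j ∈ u, z σ j).val := by
          classical
          induction u using Finset.induction_on with
          | empty => simp
          | insert i u hi ih => rw [Finset.prod_insert hi, Finset.sum_insert hi, hpow, ih]
        rw [map_prod, Finset.prod_congr rfl fun j _ => hz σ j, Finset.prod_mul_distrib, hprod,
          hsum _ ⟨σ, rfl⟩, ZMod.val_zero, pow_zero, one_mul]
      obtain ⟨y, hy⟩ := (InfiniteGalois.mem_range_algebraMap_iff_fixed _).2 hfix
      refine hi s hs ⟨y, FaithfulSMul.algebraMap_injective K L ?_⟩
      rw [map_mul, hy, map_prod, ← Finset.prod_mul_distrib]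
      exact Finset.prod_congr rfl fun j _ => by rw [← hb, sq]
    intro x
    obtain ⟨σ, hσ⟩ : (fun j => Multiplicative.toAdd (x j)) ∈ V := hV ▸ AddSubgroup.mem_top _
    exact ⟨σ, funext fun j => congrArg Multiplicative.ofAdd (congrFun hσ j)⟩
  exact ⟨MulEquiv.ofBijective Φ ⟨hΦinj, hΦsurj⟩⟩

theorem radicand_ne_zero {p : Fin 5 → K} (hΔ : segreCubic p ≠ 0)
    (hf : ∀ j, singularForm p j ≠ 0) (j : Fin 10) : radicand p j ≠ 0 := by
  rw [← syntheme_castLE, syntheme]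
  refine mul_ne_zero (mul_ne_zero ?_ hΔ) (Finset.prod_ne_zero_iff.2 fun t _ => hf _)
  rw [Int.cast_ne_zero]
  have h : ∀ j, synthemeSign j ≠ 0 := by decide
  exact h _

theorem galois_of_not_mem_dependentLocus {p : Fin 5 → K} (hp : p ≠ 0)
    (h : Projectivization.mk K p hp ∉ dependentLocus K) (hΔ : segreCubic p ≠ 0)
    (hf : ∀ j, singularForm p j ≠ 0) :
    IsGalois K (radicalField p) ∧ Nonempty ((radicalField p ≃ₐ[K] radicalField p) ≃*
      (Fin 10 → Multiplicative (ZMod 2))) := by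
  refine nonempty_mulEquiv_of_independent (radicand p) (radicand_ne_zero hΔ hf) (fun s hs hsq => ?_)
    _ rfl
  exact h ((mk_mem_dependentLocus p hp).2 ⟨s, hs, hsq⟩)

end Multiquadratic

end HeisenbergQuartic

theorem mainTheorem1 :
    ∃ (m : ℕ) (P : MvPolynomial (Fin 5) ℚ), P.IsHomogeneous m ∧ P ≠ 0 ∧
      ∀ (K : Type*) [Field K] [NumberField K],
        (∀ p : Fin 5 → K,
          HeisenbergQuartic.segreCubic p ≠ 0 →
          (∀ j, HeisenbergQuartic.singularForm p j ≠ 0) →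
          MvPolynomial.aeval p P ≠ 0 →
            (HeisenbergQuartic.conics
              (fun j => algebraMap K (AlgebraicClosure K) (p j))).ncard = 320 ∧
            HeisenbergQuartic.IsFieldOfDefinition p (HeisenbergQuartic.radicalField p)) ∧
        ∃ Ω : Set (Projectivization K (Fin 5 → K)), HeisenbergQuartic.IsThin Ω ∧
          ∀ (p : Fin 5 → K) (hp : p ≠ 0), Projectivization.mk K p hp ∉ Ω →
            HeisenbergQuartic.segreCubic p ≠ 0 →
            (∀ j, HeisenbergQuartic.singularForm p j ≠ 0) →
            MvPolynomial.aeval p P ≠ 0 →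
              ∀ L : IntermediateField K (AlgebraicClosure K),
                HeisenbergQuartic.IsFieldOfDefinition p L →
                  IsGalois K L ∧
                  Nonempty ((L ≃ₐ[K] L) ≃* (Fin 10 → Multiplicative (ZMod 2))) := by
  open HeisenbergQuartic in
  refine ⟨1030, genericityPoly, genericityPoly_isHomogeneous, genericityPoly_ne_zero,
    fun K _ _ => ⟨fun p hΔ hf hP => ?_, dependentLocus K, isThin_dependentLocus,
      fun p hp hΩ hΔ hf hP L hL => ?_⟩⟩
  · rw [aeval_genericityPoly] at hP
    exact conics_of_genericity hΔ hf hP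
  · rw [aeval_genericityPoly] at hP
    -- A least field is unique, so `L` is the radical field.
    obtain rfl := hL.unique (conics_of_genericity hΔ hf hP).2
    exact galois_of_not_mem_dependentLocus hp hΩ hΔ hf
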